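/- **Setting.** Let $d\in\{2,3\}$, $T>0$, and let $\Omega\subset\mathbb R^d$ be open, bounded and connected with $\Omega=\operatorname{int}\overline\Omega$. A MAC mesh $\mathcal T=(\mathcal M,\mathcal E)$ of $\Omega$ is a finite conforming partition $\mathcal M$ of $\overline\Omega$ into closed boxes $K$ with edges parallel to the axes: every face of a box is either a whole face of another box (internal face, $\sigma=K|L$) or contained in $\partial\Omega$ (external face). $\mathcal E(K)$ is the set of faces of $K$, $\mathcal E^{(i)}$ the set of faces orthogonal to $e^{(i)}$, $\nu_{\sigma,K}$ the unit normal to $\sigma$ outward from $K$, and $h_{\mathcal T}$ the largest Euclidean diameter of a cell. The dual cell $D_\sigma$ of $\sigma$ is the union of the halves, adjacent to $\sigma$, of the cells having $\sigma$ as a face. A discrete density has one value $q_K$ per cell; a discrete velocity $U$ has one value $U_\sigma$ (the $i$-th component) per face $\sigma\in\mathcal E^{(i)}$, with $U_\sigma=0$ on external faces, and $U_{\sigma,K}=U_\sigma\,e^{(i)}\cdot\nu_{\sigma,K}$. For $\sigma=K|L\in\mathcal E^{(i)}$ put $$|D_\sigma|q_{D_\sigma}=\tfrac{|K|}2q_K+\tfrac{|L|}2q_L,\qquad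 (\partial^{(i)}q)_\sigma=\tfrac{|\sigma|}{|D_\sigma|}(q_L-q_K)\,e^{(i)}\cdot\nu_{\sigma,K},\qquad (\partial^{(i)}q)_{\sigma,K}=\tfrac{|\sigma|}{|D_\sigma|}(q_L-q_K),$$ $(\partial^{(i)}q)_\sigma=0$ on external faces, and $(\operatorname{div}_{\mathcal M}U)_K=\frac1{|K|}\sum_{\sigma\in\mathcal E(K)}|\sigma|U_{\sigma,K}$. The interface density is $\rho_\sigma=\frac{\rho_K-\rho_L}{\ln\rho_K-\ln\rho_L}$ if $\rho_K\ne\rho_L$, and $\rho_\sigma=\rho_K$ otherwise. **Scheme.** Let $\delta t=T/N$ and let $\tilde\rho_0\in L^\infty(\Omega)$, $U_0\in L^\infty(\Omega)^d$. A solution of the limiting semi-implicit scheme is a family $(\tilde\rho^n,U^n)_{0\le n\le N}$ with $\tilde\rho^n>0$ such that $\tilde\rho^0_K$ is the mean of $\tilde\rho_0$ over $K$, $U^0_\sigma$ is the mean of $(U_0)_i$ over $D_\sigma$ for each internal $\sigma\in\mathcal E^{(i)}$, and, for $0\le n\le N-1$, every $K\in\mathcal M$, every $i$ and every internal $\sigma\in\mathcal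 E^{(i)}$, $$\frac{\tilde\rho_K^{n+1}-\tilde\rho_K^n}{\delta t}+\frac1{|K|}\sum_{\sigma\in\mathcal E(K)}F_{\sigma,K}=0,$$ $$\frac{\tilde\rho^{n+1}_{D_\sigma}U^{n+1}_\sigma-\tilde\rho^n_{D_\sigma}U^n_\sigma}{\delta t}+\frac1{|D_\sigma|}\sum_{\epsilon}F_{\epsilon,\sigma}U^n_{\epsilon,\mathrm{up}}+(\partial^{(i)}\tilde\rho^{n+1})_\sigma-(\tilde\rho^{n+1}_\sigma-\tilde\rho^n_\sigma)(\partial^{(i)}\ln\tilde\rho^{n+1})_\sigma-\delta t\,(\partial^{(i)}\operatorname{div}_{\mathcal M}U^n)_\sigma=0,$$ where $F_{\sigma,K}=|\sigma|\big(\tilde\rho^n_\sigma U^n_{\sigma,K}-\eta^n_\sigma\,\delta t\,(\partial^{(i)}\ln\tilde\rho^{n+1})_{\sigma,K}\big)$ for $\sigma\in\mathcal E^{(i)}$ internal and $F_{\sigma,K}=0$ for $\sigma$ external, with $\eta^n_\sigma>\frac{5(\tilde\rho^n_\sigma)^2}{4\tilde\rho^n_{D_\sigma}}$ on internal faces. Here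 $\epsilon$ runs over the faces of $D_\sigma$, $\sigma=K|L$, and $F_{\epsilon,\sigma}$ is the flux through $\epsilon$ outward from $D_\sigma$: if $\epsilon\subset\tau\cup\tau'$ with parallel faces $\tau\in\mathcal E(K)$, $\tau'\in\mathcal E(L)$ not parallel to $\sigma$, then $F_{\epsilon,\sigma}=\frac12(F_{\tau,K}+F_{\tau',L})$; if $\epsilon$ is the mid-section of $K$, and $\sigma'$ the face of $K$ opposite to $\sigma$, then $F_{\epsilon,\sigma}=\frac12(F_{\sigma',K}-F_{\sigma,K})$, and likewise for $L$. Finally $U_{\epsilon,\mathrm{up}}=U_\sigma$ if $F_{\epsilon,\sigma}\ge0$, and $U_{\epsilon,\mathrm{up}}=U_{\sigma'}$ otherwise, where $D_{\sigma'}$ is the dual cell on the other side of $\epsilon$. **Theorem.** Let $(\mathcal T^{(m)},\delta t^{(m)})_{m\in\mathbb N}$ be discretisations with $\delta t^{(m)}=T/N^{(m)}\to0$ and $h_{\mathcal T^{(m)}}\to0$, and let $(\tilde\rho^{(m)},U^{(m)})$ be corresponding solutions of the scheme, all for the same initial data $(\tilde\rho_0,U_0)\in L^\infty(\Omega)^{1+d}$,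 with stabilisation parameters bounded by a constant $\eta_{\max}$ independent of $m$. Assume that, with constants $\underline C,\overline C,C>0$ independent of $m$, 1. $\underline C<(\tilde\rho^{(m)})^n_K\le\overline C$ and $|(U^{(m)})^n_\sigma|\le C$ for all $K\in\mathcal M^{(m)}$, $\sigma\in\mathcal E^{(m)}$, $0\le n\le N^{(m)}$ and $m\in\mathbb N$; 2. $\displaystyle\sum_{n=0}^{N^{(m)}}\delta t^{(m)}\sum_{\sigma=K|L\in\mathcal E^{(m)}_{\mathrm{int}}}|\sigma|\,\big|(\tilde\rho^{(m)})^n_L-(\tilde\rho^{(m)})^n_K\big|\le C$ for all $m$; 3. the piecewise constant functions equal to $(\tilde\rho^{(m)})^n_K$ on $[n\delta t^{(m)},(n+1)\delta t^{(m)})\times K$, respectively, in the $i$-th component, to $(U^{(m)})^n_\sigma$ on $[n\delta t^{(m)},(n+1)\delta t^{(m)})\times D_\sigma$ for $\sigma\in\mathcal E^{(i)}$, converge in $L^r((0,T)\times\Omega)^{1+d}$, for all $1\le r<\infty$, to $(\tilde\rho,U)\in L^\infty((0,T)\times\Omega)^{1+d}$; 4. there is $\theta>0$ such that, for all $m$,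 all $K\in\mathcal M^{(m)}$ and all $\sigma\in\mathcal E(K)$, $\delta t^{(m)}\le\theta|K|$, $\operatorname{diam}(K)^d\le\theta|K|$ and $|D_\sigma|\le\theta|K|$. Then $(\tilde\rho,U)$ is a weak solution of the isothermal compressible Euler system $$\partial_t\tilde\rho+\operatorname{div}(\tilde\rho U)=0,\qquad\partial_t(\tilde\rho U)+\operatorname{div}(\tilde\rho U\otimes U)+\nabla\tilde\rho=0$$ with initial data $(\tilde\rho_0,U_0)$ and boundary condition $U\cdot\nu=0$. That is, $\tilde\rho\in L^\infty((0,T)\times\Omega)$, $\tilde\rho>0$ a.e., $U\in L^\infty((0,T)\times\Omega)^d$, $$\int_0^T\!\!\int_\Omega(\tilde\rho\,\partial_t\psi+\tilde\rho U\cdot\nabla\psi)\,dx\,dt=-\int_\Omega\tilde\rho_0\,\psi(0,\cdot)\,dx$$ for all $\psi\in C_c^\infty([0,T)\times\overline\Omega)$, and $$\int_0^T\!\!\int_\Omega\big(\tilde\rho U\cdot\partial_t\psi+(\tilde\rho U\otimes U):\nabla\psi+\tilde\rho\operatorname{div}\psi\big)\,dx\,dt=-\int_\Omega\tilde\rho_0U_0\cdot\psi(0,\cdot)\,dx$$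 for all $\psi\in C_c^\infty([0,T)\times\overline\Omega)^d$ with $\psi\cdot\nu=0$ on $[0,T)\times\partial\Omega$. -/

import Mathlib

open MeasureTheory Set Filter Topology
open scoped ContDiff ENNReal

noncomputable section

/-! ## Boxes -/

/-- The open box with corners `lo` and `hi`. -/
def openBox {d : ℕ} (lo hi : Fin d → ℝ) : Set (Fin d → ℝ) :=
  Set.univ.pi fun i => Ioo (lo i) (hi i)

/-- The face of the closed box `[lo, hi]` orthogonal to the `i`-th axis;
`s = true` is the upper one and `s = false` the lower one. -/
def boxFace {d : ℕ} (lo hi : Fin d → ℝ) (i : Fin d) (s : Bool) : Set (Fin d → ℝ) :=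
  {x | x ∈ Icc lo hi ∧ x i = if s then hi i else lo i}

/-- The box `[lo', hi']` lies on the other side of the face `(i, s)` of the box `[lo, hi]`, and that
whole face is a face of both boxes. -/
def SharesFace {d : ℕ} (lo hi : Fin d → ℝ) (i : Fin d) (s : Bool) (lo' hi' : Fin d → ℝ) : Prop :=
  (if s then lo' i = hi i else hi' i = lo i) ∧ ∀ j, j ≠ i → lo' j = lo j ∧ hi' j = hi j

/-! ## MAC meshes -/

/-- A conforming partition of the closure of `Ω` into finitely many closed boxes with pairwise
disjoint interiors: every face of a cell is either a whole face of another cell (internal face) or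
contained in the boundary of `Ω` (external face). -/
structure MACMesh (d : ℕ) (Ω : Set (Fin d → ℝ)) where
  numCells : ℕ
  lo : Fin numCells → Fin d → ℝ
  hi : Fin numCells → Fin d → ℝ
  lo_lt_hi : ∀ K i, lo K i < hi K i
  cover : (⋃ K, Icc (lo K) (hi K)) = closure Ω
  disjoint : ∀ K L, K ≠ L → Disjoint (openBox (lo K) (hi K)) (openBox (lo L) (hi L))
  conforming : ∀ K i s,
    (∃ L, SharesFace (lo K) (hi K) i s (lo L) (hi L)) ∨
      boxFace (lo K) (hi K) i s ⊆ frontier Ω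

namespace MACMesh

variable {d : ℕ} {Ω : Set (Fin d → ℝ)}

/-- The primal cells. -/
abbrev Cell (M : MACMesh d Ω) : Type := Fin M.numCells

/-- The cell on the other side of the face `(i, s)` of `K`; `none` if this face is external. -/
def nbr (M : MACMesh d Ω) (K : M.Cell) (i : Fin d) (s : Bool) : Option M.Cell :=
  open Classical in
  if h : ∃ L : M.Cell, SharesFace (M.lo K) (M.hi K) i s (M.lo L) (M.hi L) then some h.choose
  else none

/-- The edge length of `K` in the direction `i`. -/
def width (M : MACMesh d Ω) (K : M.Cell) (i : Fin d) : ℝ := M.hi K i - M.lo K i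

/-- The volume `|K|`. -/
def vol (M : MACMesh d Ω) (K : M.Cell) : ℝ := ∏ i, M.width K i

/-- The Euclidean diameter of `K`. -/
def diam (M : MACMesh d Ω) (K : M.Cell) : ℝ := Real.sqrt (∑ i, M.width K i ^ 2)

/-- The mesh size: the largest diameter of a cell. -/
def meshSize (M : MACMesh d Ω) : ℝ := ⨆ K : M.Cell, M.diam K

/-- The area `|σ|` of the faces of `K` that are orthogonal to the direction `i`. -/
def area (M : MACMesh d Ω) (K : M.Cell) (i : Fin d) : ℝ :=
  ∏ j ∈ Finset.univ.erase i, M.width K j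

/-- The half `D_{σ,K}` of the open cell `K` adjacent to its face `σ = (i, s)`. -/
def halfCell (M : MACMesh d Ω) (K : M.Cell) (i : Fin d) (s : Bool) : Set (Fin d → ℝ) :=
  {x | x ∈ openBox (M.lo K) (M.hi K) ∧
    if s then (M.lo K i + M.hi K i) / 2 < x i else x i < (M.lo K i + M.hi K i) / 2}

/-- The volume `|D_σ|` of the dual cell of the face `σ = (i, s)` of `K`. -/
def dualVol (M : MACMesh d Ω) (K : M.Cell) (i : Fin d) (s : Bool) : ℝ :=
  match M.nbr K i s with
  | some L => M.vol K / 2 + M.vol L / 2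
  | none => M.vol K / 2

/-- Scalar fields that are constant on each primal cell. -/
abbrev CellField (M : MACMesh d Ω) : Type := M.Cell → ℝ

/-- Values attached to the faces: `v K i s` is the value at the face `(i, s)` of `K`. A face common
to two cells is named twice, see `IsFaceField`. For a velocity, `v K i s` is the `i`-th
component. -/
abbrev FaceField (M : MACMesh d Ω) : Type := M.Cell → Fin d → Bool → ℝ

/-- The two names of an internal face carry the same value. -/
def IsFaceField (M : MACMesh d Ω) (v : M.FaceField) : Prop :=
  ∀ K i s L, M.nbr K i s = some L → v L i (!s) = v K i s

/-- Membership in `H_{E,0}`: a field on the faces that vanishes on the external ones. -/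
def IsFaceFieldZero (M : MACMesh d Ω) (v : M.FaceField) : Prop :=
  M.IsFaceField v ∧ ∀ K i s, M.nbr K i s = none → v K i s = 0

/-! ## Discrete operators -/

/-- The `i`-th component of the outward normal of a face on the side `s`. -/
def side (s : Bool) : ℝ := if s then 1 else -1

/-- The interface value `ρ_{KL}`: `a - b = ρ_{KL} (ln a - ln b)` if `a ≠ b`, and `a` if `a = b`. -/
def logMean (a b : ℝ) : ℝ :=
  open Classical in if a = b then a else (a - b) / (Real.log a - Real.log b)

/-- The interface density `ρ_σ`. It is used on internal faces; on an external face it is multiplied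
by a vanishing velocity. -/
def faceDensity (M : MACMesh d Ω) (ρ : M.CellField) (K : M.Cell) (i : Fin d) (s : Bool) : ℝ :=
  match M.nbr K i s with
  | some L => logMean (ρ K) (ρ L)
  | none => ρ K

/-- The dual average `q_{D_σ}`. -/
def dualAvg (M : MACMesh d Ω) (q : M.CellField) (K : M.Cell) (i : Fin d) (s : Bool) : ℝ :=
  match M.nbr K i s with
  | some L => (M.vol K / 2 * q K + M.vol L / 2 * q L) / M.dualVol K i s
  | none => q K

/-- The discrete derivative `(∂^{(i)} q)_σ` at the face `σ = (i, s)` of `K`; it vanishes on external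
faces. -/
def grad (M : MACMesh d Ω) (q : M.CellField) (K : M.Cell) (i : Fin d) (s : Bool) : ℝ :=
  match M.nbr K i s with
  | some L => M.area K i / M.dualVol K i s * (q L - q K) * side s
  | none => 0

/-- The discrete divergence of a face field. -/
def div (M : MACMesh d Ω) (v : M.FaceField) (K : M.Cell) : ℝ :=
  (∑ i, ∑ s, M.area K i * (v K i s * side s)) / M.vol K

/-- The mass flux `F_{σ,K} = |σ| (ρ_σ u_{σ,K} - η δt (∂ ln ρ')_{σ,K})` through the face
`σ = (i, s)` of `K`, outward from `K`; here `ρ, u` belong to the old and `ρ'` to the new time. -/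
def massFlux (M : MACMesh d Ω) (δt : ℝ) (η : M.FaceField) (ρ ρ' : M.CellField) (u : M.FaceField) :
    M.FaceField := fun K i s =>
  M.area K i * (M.faceDensity ρ K i s * (u K i s * side s) -
    η K i s * δt * (M.grad (fun J => Real.log (ρ' J)) K i s * side s))

/-- `f v_up`, where `v_up` is the inner value `v` if the outward flux `f` is nonnegative and the
outer value `v'` otherwise. -/
def upwind (f v v' : ℝ) : ℝ := open Classical in if 0 ≤ f then f * v else f * v'

/-- The velocity at the dual cell across the faces `(j, s)` of `K` and of `L` (`j ≠ i`), where `K`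
and `L` are the lower and upper cell at an internal face orthogonal to the direction `i`. If both
of these faces are external, the mass flux is zero and the value is irrelevant. -/
def sideVelocity (M : MACMesh d Ω) (u : M.FaceField) (K L : M.Cell) (i j : Fin d) (s : Bool) : ℝ :=
  match M.nbr K j s, M.nbr L j s with
  | some K', _ => u K' i true
  | none, some L' => u L' i false
  | none, none => 0

/-- The sum `∑ F_{ε,σ} u_{ε,up}` over the faces `ε` of the dual cell `D_σ`, for the internal face
`σ = K|L` orthogonal to the direction `i`, with `K` the lower and `L` the upper cell.
The dual fluxes `F_{ε,σ}` are the half-sums of primal fluxes for which averaging the mass balances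
of `K` and `L` gives the mass balance of `D_σ`. -/
def convection (M : MACMesh d Ω) (F u : M.FaceField) (K L : M.Cell) (i : Fin d) : ℝ :=
  upwind ((F K i false - F K i true) / 2) (u K i true) (u K i false) +
  upwind ((F L i true - F L i false) / 2) (u K i true) (u L i true) +
  ∑ j ∈ Finset.univ.erase i, ∑ s,
    upwind ((F K j s + F L j s) / 2) (u K i true) (M.sideVelocity u K L i j s)

/-! ## The limiting scheme -/

/-- `(ρ, u)` is a solution of the limiting semi-implicit scheme on the mesh `M` with `N` time steps
of size `δt`, stabilisation parameters `η` (one for each time step and face) and initial data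
`(ρ₀, u₀)`. -/
structure IsSchemeSolution (M : MACMesh d Ω) (δt : ℝ) (N : ℕ)
    (ρ₀ : (Fin d → ℝ) → ℝ) (u₀ : (Fin d → ℝ) → Fin d → ℝ)
    (η : ℕ → M.FaceField) (ρ : ℕ → M.CellField) (u : ℕ → M.FaceField) : Prop where
  density_pos : ∀ n ≤ N, ∀ K, 0 < ρ n K
  velocity_mem : ∀ n ≤ N, M.IsFaceFieldZero (u n)
  eta_mem : ∀ n < N, M.IsFaceField (η n)
  eta_gt : ∀ n < N, ∀ K i s L, M.nbr K i s = some L →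
    5 * M.faceDensity (ρ n) K i s ^ 2 / (4 * M.dualAvg (ρ n) K i s) < η n K i s
  density_init : ∀ K, ρ 0 K = (∫ x in openBox (M.lo K) (M.hi K), ρ₀ x) / M.vol K
  velocity_init : ∀ K i L, M.nbr K i true = some L →
    u 0 K i true =
      ((∫ x in M.halfCell K i true, u₀ x i) + ∫ x in M.halfCell L i false, u₀ x i) /
        M.dualVol K i true
  mass : ∀ n < N, ∀ K,
    (ρ (n + 1) K - ρ n K) / δt +
      (∑ i, ∑ s, M.massFlux δt (η n) (ρ n) (ρ (n + 1)) (u n) K i s) / M.vol K = 0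
  momentum : ∀ n < N, ∀ K i L, M.nbr K i true = some L →
    (M.dualAvg (ρ (n + 1)) K i true * u (n + 1) K i true -
        M.dualAvg (ρ n) K i true * u n K i true) / δt +
      M.convection (M.massFlux δt (η n) (ρ n) (ρ (n + 1)) (u n)) (u n) K L i /
        M.dualVol K i true +
      (M.grad (ρ (n + 1)) K i true -
        (M.faceDensity (ρ (n + 1)) K i true - M.faceDensity (ρ n) K i true) *
          M.grad (fun J => Real.log (ρ (n + 1) J)) K i true -
        δt * M.grad (M.div (u n)) K i true) = 0

/-! ## Norms and reconstructions -/

/-- The discrete `L¹(0,T; BV)` seminorm: the sum of `δt |σ| |ρ_L^n - ρ_K^n|` over `0 ≤ n ≤ N` and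
all internal faces `σ = K|L`. -/
def discreteBV (M : MACMesh d Ω) (δt : ℝ) (N : ℕ) (ρ : ℕ → M.CellField) : ℝ :=
  ∑ n ∈ Finset.range (N + 1), δt * ∑ K, ∑ i,
    match M.nbr K i true with
    | some L => M.area K i * |ρ n L - ρ n K|
    | none => 0

/-- The function on `[0,T) × Ω` equal to `ρ n K` on `[n δt, (n+1) δt) × K`. -/
def cellFun (M : MACMesh d Ω) (δt : ℝ) (ρ : ℕ → M.CellField) (z : ℝ × (Fin d → ℝ)) : ℝ :=
  ∑ K, (openBox (M.lo K) (M.hi K)).indicator (fun _ => ρ ⌊z.1 / δt⌋₊ K) z.2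

/-- The function on `[0,T) × Ω` whose `i`-th component is equal to the value of `u n` at `σ` on
`[n δt, (n+1) δt) × D_σ`, for each face `σ` orthogonal to the direction `i`. -/
def faceFun (M : MACMesh d Ω) (δt : ℝ) (u : ℕ → M.FaceField) (z : ℝ × (Fin d → ℝ)) (i : Fin d) :
    ℝ :=
  ∑ K, ∑ s, (M.halfCell K i s).indicator (fun _ => u ⌊z.1 / δt⌋₊ K i s) z.2

end MACMesh

/-! ## Weak solutions of the isothermal compressible Euler system -/

/-- The space-time cylinder `(0,T) × Ω`. -/
def spaceTime {d : ℕ} (T : ℝ) (Ω : Set (Fin d → ℝ)) : Set (ℝ × (Fin d → ℝ)) := Ioo 0 T ×ˢ Ω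

/-- The time derivative. -/
def dt {d : ℕ} (ψ : ℝ × (Fin d → ℝ) → ℝ) (z : ℝ × (Fin d → ℝ)) : ℝ := fderiv ℝ ψ z (1, 0)

/-- The derivative in the `i`-th space direction. -/
def dx {d : ℕ} (i : Fin d) (ψ : ℝ × (Fin d → ℝ) → ℝ) (z : ℝ × (Fin d → ℝ)) : ℝ :=
  fderiv ℝ ψ z (0, Pi.single i 1)

/-- Smooth functions with compact support in `(-∞,T) × ℝ^d`. Their restrictions to `[0,T) × closure
Ω` form `C_c^∞([0,T) × closure Ω)` for a bounded `Ω`. -/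
structure IsTestFunction {d : ℕ} (T : ℝ) (ψ : ℝ × (Fin d → ℝ) → ℝ) : Prop where
  smooth : ContDiff ℝ ∞ ψ
  compact : HasCompactSupport ψ
  support : tsupport ψ ⊆ Iio T ×ˢ univ

/-- Near `x` the set `Ω` is a half space bounded by the hyperplane through `x` orthogonal to the
`i`-th axis; so the unit outward normal to the boundary at `x` is `±e_i`. -/
def HasAxisNormal {d : ℕ} (Ω : Set (Fin d → ℝ)) (i : Fin d) (x : Fin d → ℝ) : Prop :=
  ∃ s : Bool, ∀ᶠ y in 𝓝 x, y ∈ Ω ↔ MACMesh.side s * (y i - x i) < 0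

/-- `ψ · ν = 0` on `[0,T) × ∂Ω`, for a domain `Ω` with boundary faces orthogonal to the axes. -/
def IsTangential {d : ℕ} (T : ℝ) (Ω : Set (Fin d → ℝ)) (ψ : Fin d → ℝ × (Fin d → ℝ) → ℝ) : Prop :=
  ∀ i x, HasAxisNormal Ω i x → ∀ t ∈ Ico 0 T, ψ i (t, x) = 0

/-- `(ρ, u)` is a weak solution on `(0,T) × Ω` of
`∂_t ρ + div (ρ u) = 0`, `∂_t (ρ u) + div (ρ u ⊗ u) + ∇ ρ = 0`
with initial data `(ρ₀, u₀)` and the boundary condition `u · ν = 0`. -/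
structure IsWeakSolution {d : ℕ} (T : ℝ) (Ω : Set (Fin d → ℝ))
    (ρ₀ : (Fin d → ℝ) → ℝ) (u₀ : (Fin d → ℝ) → Fin d → ℝ)
    (ρ : ℝ × (Fin d → ℝ) → ℝ) (u : ℝ × (Fin d → ℝ) → Fin d → ℝ) : Prop where
  density_bounded : MemLp ρ ⊤ (volume.restrict (spaceTime T Ω))
  density_pos : ∀ᵐ z ∂(volume.restrict (spaceTime T Ω)), 0 < ρ z
  velocity_bounded : ∀ i, MemLp (fun z => u z i) ⊤ (volume.restrict (spaceTime T Ω))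
  mass : ∀ ψ : ℝ × (Fin d → ℝ) → ℝ, IsTestFunction T ψ →
    ∫ z in spaceTime T Ω, (ρ z * dt ψ z + ∑ i, ρ z * u z i * dx i ψ z) =
      -∫ x in Ω, ρ₀ x * ψ (0, x)
  momentum : ∀ ψ : Fin d → ℝ × (Fin d → ℝ) → ℝ, (∀ i, IsTestFunction T (ψ i)) →
    IsTangential T Ω ψ →
    ∫ z in spaceTime T Ω, ((∑ i, ρ z * u z i * dt (ψ i) z) +
        (∑ i, ∑ j, ρ z * u z i * u z j * dx j (ψ i) z) + ρ z * ∑ i, dx i (ψ i) z) =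
      -∫ x in Ω, ∑ i, ρ₀ x * u₀ x i * ψ i (0, x)

end

noncomputable section

namespace MACMesh

variable {d : ℕ} {Ω : Set (Fin d → ℝ)} (M : MACMesh d Ω)

/-! ## Geometry of MAC meshes -/

/-! This is a Lax–Wendroff argument. The mass balance is tested with the values of `ψ` at the cell
centres, each momentum component with the values at the face centres. Summation by parts in time and
space then turns the scheme into a Riemann sum of the weak formulation plus a consistency error
(`abs_weak_mass_le`, `abs_weak_momentum_le`). It remains to send the error to zero and to pass to
the limit in the Riemann sums.

In each cell the fields are represented by `ρ K` and by the velocities `u K i true` on the upper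
faces. Every other local value differs from these by at most the local oscillation `osc`, so a
numerical mass flux equals the area times `± ρ K * u K i true` up to the area times `osc + h`
(`StepBounds.abs_massFlux_sub_le`). Conservativity allows a single-valued quantity to be subtracted
from the test values: face values for the mass fluxes, cell-centre values for the dual fluxes
through the mid-sections, edge-centre values for the lateral dual fluxes (`sum_lateral_eq_zero`).
Only differences of `ψ` over half a cell survive, and Taylor's formula makes them derivatives. No
boundary term appears, because the mass flux through external faces is zero and because a tangential
test field vanishes on the closed external faces (`eq_zero_on_external`), including the edges at
re-entrant corners.

The remaining terms of the scheme are small. Since the time step is at most a constant times every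
cell volume, the stabilisation flux is of order `h` times the area, `δt` times the divergence is of
order `h`, and the mass balance gives a density increment of order `h` in each time step. The
pressure correction is therefore `h` times the discrete BV sum, and the gradient of the divergence
is harmless once it is moved onto the test function.

The accumulated error `totalError` tends to zero by two different mechanisms (`tendsto_totalError`).
Density jumps weighted by cell volumes are `h` times the BV sum. The velocity has no BV bound; its
jumps are controlled by comparing it with a continuous compactly supported function close in `L¹` to
the limit velocity, which uses the strong convergence and the comparability of neighbouring cell
volumes.

Finally, products of uniformly bounded sequences converging in `L¹` converge in `L¹`
(`BoundedL1Limit.mul`), which settles the nonlinear terms (`tendsto_discrete_sum`). The initial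
momentum is a product of averages over different sets, treated in `tendsto_initial_momentum`. -/

lemma side_mul_side (s : Bool) : side s * side s = 1 := by cases s <;> simp [side]

lemma abs_side (s : Bool) : |side s| = 1 := by cases s <;> simp [side]

lemma side_not (s : Bool) : side (!s) = -side s := by cases s <;> simp [side]

lemma width_pos (K : M.Cell) (i : Fin d) : 0 < M.width K i := sub_pos.2 (M.lo_lt_hi K i)

lemma vol_pos (K : M.Cell) : 0 < M.vol K := Finset.prod_pos fun i _ => M.width_pos K i

lemma area_pos (K : M.Cell) (i : Fin d) : 0 < M.area K i :=
  Finset.prod_pos fun j _ => M.width_pos K j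

lemma area_mul_width (K : M.Cell) (i : Fin d) : M.area K i * M.width K i = M.vol K :=
  Finset.prod_erase_mul _ _ (Finset.mem_univ i)

/-- The centre of a cell. -/
def center (K : M.Cell) : Fin d → ℝ := fun j => (M.lo K j + M.hi K j) / 2

/-- The position of the face `(i, s)` of `K` on the `i`-th axis. -/
def faceCoord (K : M.Cell) (i : Fin d) (s : Bool) : ℝ := if s then M.hi K i else M.lo K i

/-- The centre of the face `(i, s)` of `K`. -/
def faceCenter (K : M.Cell) (i : Fin d) (s : Bool) : Fin d → ℝ :=
  Function.update (M.center K) i (M.faceCoord K i s)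

/-- The centre of the intersection of the faces `(i, r)` and `(j, s)` of `K`. -/
def edgeCenter (K : M.Cell) (i : Fin d) (r : Bool) (j : Fin d) (s : Bool) : Fin d → ℝ :=
  Function.update (M.faceCenter K i r) j (M.faceCoord K j s)

lemma faceCoord_sub_center (K : M.Cell) (i : Fin d) (s : Bool) :
    M.faceCoord K i s - M.center K i = side s * (M.width K i / 2) := by
  cases s <;> simp [faceCoord, center, side, width] <;> ring

lemma faceCenter_sub_center (K : M.Cell) (i : Fin d) (s : Bool) :
    M.faceCenter K i s - M.center K = Pi.single i (side s * (M.width K i / 2)) := by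
  ext j
  by_cases h : j = i
  · subst h; simp [faceCenter, faceCoord_sub_center]
  · simp [faceCenter, h]

lemma edgeCenter_sub_faceCenter (K : M.Cell) {i j : Fin d} (hj : j ≠ i) (r s : Bool) :
    M.edgeCenter K i r j s - M.faceCenter K i r = Pi.single j (side s * (M.width K j / 2)) := by
  ext k
  by_cases h : k = j
  · subst h; simp [edgeCenter, faceCenter, faceCoord_sub_center, hj]
  · simp [edgeCenter, h]

lemma center_mem_Icc (K : M.Cell) (j : Fin d) :
    M.lo K j < M.center K j ∧ M.center K j < M.hi K j := by
  have := M.lo_lt_hi K j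
  constructor <;> simp only [center] <;> linarith

lemma faceCoord_mem (K : M.Cell) (j : Fin d) (s : Bool) :
    M.lo K j ≤ M.faceCoord K j s ∧ M.faceCoord K j s ≤ M.hi K j := by
  have := M.lo_lt_hi K j
  cases s <;> simp [faceCoord, this.le]

/-! ### Boxes, overlapping cells and the neighbour relation -/

lemma openBox_mem_iff (lo hi x : Fin d → ℝ) :
    x ∈ openBox lo hi ↔ ∀ j, lo j < x j ∧ x j < hi j := by
  simp [openBox, Set.mem_pi]

lemma isOpen_openBox (lo hi : Fin d → ℝ) : IsOpen (openBox lo hi) :=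
  isOpen_set_pi Set.finite_univ fun _ _ => isOpen_Ioo

lemma interior_Icc_eq_openBox (lo hi : Fin d → ℝ) : interior (Icc lo hi) = openBox lo hi := by
  rw [← Set.pi_univ_Icc, interior_pi_set Set.finite_univ]
  simp [openBox]

/-- The midpoint of the common interval in every direction lies in both open boxes, against the
disjointness of distinct cells. -/
lemma eq_of_overlap {K L : M.Cell}
    (h : ∀ j, M.lo K j < M.hi L j ∧ M.lo L j < M.hi K j) : K = L := by
  by_contra hne
  have hdisj := Set.disjoint_left.1 (M.disjoint K L hne)
  refine @hdisj (fun j => (max (M.lo K j) (M.lo L j) + min (M.hi K j) (M.hi L j)) / 2) ?_ ?_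
  all_goals
    rw [openBox_mem_iff]
    intro j
    have h1 := M.lo_lt_hi K j
    have h2 := M.lo_lt_hi L j
    obtain ⟨h3, h4⟩ := h j
    have h5 : max (M.lo K j) (M.lo L j) < min (M.hi K j) (M.hi L j) := by simp [*]
    have h6 := le_max_left (M.lo K j) (M.lo L j)
    have h7 := le_max_right (M.lo K j) (M.lo L j)
    have h8 := min_le_left (M.hi K j) (M.hi L j)
    have h9 := min_le_right (M.hi K j) (M.hi L j)
    constructor <;> linarith

lemma openBox_subset (hreg : interior (closure Ω) = Ω) (K : M.Cell) :
    openBox (M.lo K) (M.hi K) ⊆ Ω := by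
  refine Subset.trans ?_ hreg.subset
  rw [← interior_Icc_eq_openBox]
  apply interior_mono
  rw [← M.cover]
  exact Set.subset_iUnion (fun K => Icc (M.lo K) (M.hi K)) K

variable {M}

lemma sharesFace_of_nbr {K L : M.Cell} {i : Fin d} {s : Bool} (h : M.nbr K i s = some L) :
    SharesFace (M.lo K) (M.hi K) i s (M.lo L) (M.hi L) := by
  unfold nbr at h
  split at h
  · rename_i hex
    cases h
    exact hex.choose_spec
  · cases h

lemma boxFace_subset_of_nbr {K : M.Cell} {i : Fin d} {s : Bool} (h : M.nbr K i s = none) :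
    boxFace (M.lo K) (M.hi K) i s ⊆ frontier Ω := by
  unfold nbr at h
  split at h
  · cases h
  · rename_i hex
    exact (M.conforming K i s).resolve_left hex

/-- Since `nbr` is defined by choice and conformity is stated face by face, this is the tool by
which neighbours are identified. If the face of `K` has a neighbour, that cell overlaps `L` and so
equals `L`. If the face were external, a point in the relative interior of both faces would have a
neighbourhood inside `K ∪ L`, hence would be interior to `closure Ω`, that is, in `Ω`; but it lies
on the boundary of the open set `Ω`. -/
lemma nbr_eq_some_of_overlap (hreg : interior (closure Ω) = Ω) {K L : M.Cell} {i : Fin d} {s : Bool}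
    (hi : M.faceCoord L i (!s) = M.faceCoord K i s)
    (hov : ∀ j, j ≠ i → M.lo K j < M.hi L j ∧ M.lo L j < M.hi K j) : M.nbr K i s = some L := by
  have hKi := M.lo_lt_hi K i
  have hLi := M.lo_lt_hi L i
  cases hn : M.nbr K i s with
  | some L' =>
    obtain ⟨h1, h2⟩ := sharesFace_of_nbr hn
    congr 1
    apply M.eq_of_overlap
    intro j
    by_cases hj : j = i
    · subst hj
      have hLi' := M.lo_lt_hi L' j
      cases s <;> simp [faceCoord] at h1 hi <;> constructor <;> linarith
    · rw [(h2 j hj).1, (h2 j hj).2]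
      exact hov j hj
  | none =>
    exfalso
    have hfr := boxFace_subset_of_nbr hn
    -- A point of the common face plane that is transversally in the interior of both faces.
    set y : Fin d → ℝ := Function.update
      (fun j => (max (M.lo K j) (M.lo L j) + min (M.hi K j) (M.hi L j)) / 2) i (M.faceCoord K i s)
      with hy
    have hyj : ∀ j, j ≠ i →
        (M.lo K j < y j ∧ y j < M.hi K j) ∧ (M.lo L j < y j ∧ y j < M.hi L j) := by
      intro j hj
      have h1 := M.lo_lt_hi K j
      have h2 := M.lo_lt_hi L j
      obtain ⟨h3, h4⟩ := hov j hj
      have h5 : max (M.lo K j) (M.lo L j) < min (M.hi K j) (M.hi L j) := by simp [*]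
      have h6 := le_max_left (M.lo K j) (M.lo L j)
      have h7 := le_max_right (M.lo K j) (M.lo L j)
      have h8 := min_le_left (M.hi K j) (M.hi L j)
      have h9 := min_le_right (M.hi K j) (M.hi L j)
      simp only [hy, Function.update_of_ne hj]
      refine ⟨⟨?_, ?_⟩, ?_, ?_⟩ <;> linarith
    have hyi : y i = M.faceCoord K i s := by simp [hy]
    have hyK : y ∈ boxFace (M.lo K) (M.hi K) i s := by
      refine ⟨⟨fun j => ?_, fun j => ?_⟩, hyi⟩
      · by_cases hj : j = i
        · subst hj; rw [hyi]; exact (M.faceCoord_mem K j s).1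
        · exact (hyj j hj).1.1.le
      · by_cases hj : j = i
        · subst hj; rw [hyi]; exact (M.faceCoord_mem K j s).2
        · exact (hyj j hj).1.2.le
    have hynot : y ∉ Ω := by
      have := (hfr hyK).2
      rwa [← hreg, interior_interior, hreg] at this
    apply hynot
    rw [← hreg, mem_interior_iff_mem_nhds, ← M.cover]
    -- The open box around `y` spans both cells in the direction `i` and their intersection in the
    -- others, so it is contained in `K ∪ L`.
    let a : Fin d → ℝ := fun j => if j = i then min (M.lo K i) (M.lo L i) else
      max (M.lo K j) (M.lo L j)
    let b : Fin d → ℝ := fun j => if j = i then max (M.hi K i) (M.hi L i) else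
      min (M.hi K j) (M.hi L j)
    have hyab : y ∈ openBox a b := by
      rw [openBox_mem_iff]
      intro j
      by_cases hj : j = i
      · subst hj
        simp only [a, b, if_true, hyi, min_lt_iff, lt_max_iff]
        cases s <;> simp only [faceCoord, Bool.not_false, Bool.not_true, if_true,
          Bool.false_eq_true, if_false] at hi ⊢
        · exact ⟨Or.inr (by linarith), Or.inl (by linarith)⟩
        · exact ⟨Or.inl (by linarith), Or.inr (by linarith)⟩
      · simp only [a, b, if_neg hj]
        obtain ⟨⟨h1, h2⟩, h3, h4⟩ := hyj j hj
        exact ⟨max_lt h1 h3, lt_min h2 h4⟩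
    refine Filter.mem_of_superset ((isOpen_openBox a b).mem_nhds hyab) ?_
    intro z hz
    rw [openBox_mem_iff] at hz
    have hzj : ∀ j, j ≠ i →
        (M.lo K j ≤ z j ∧ z j ≤ M.hi K j) ∧ (M.lo L j ≤ z j ∧ z j ≤ M.hi L j) := by
      intro j hj
      have := hz j
      simp only [a, b, if_neg hj, max_lt_iff, lt_min_iff] at this
      obtain ⟨⟨h1, h2⟩, h3, h4⟩ := this
      exact ⟨⟨h1.le, h3.le⟩, h2.le, h4.le⟩
    have hzi := hz i
    simp only [a, b, if_true, min_lt_iff, lt_max_iff] at hzi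
    rw [Set.mem_iUnion]
    have key : (M.lo K i ≤ z i ∧ z i ≤ M.hi K i) ∨ (M.lo L i ≤ z i ∧ z i ≤ M.hi L i) := by
      cases s <;> simp [faceCoord] at hi
      · rcases le_total (z i) (M.lo K i) with h | h
        · right; exact ⟨by rcases hzi.1 with h' | h' <;> linarith, by linarith⟩
        · left; exact ⟨h, by rcases hzi.2 with h' | h' <;> linarith⟩
      · rcases le_total (z i) (M.hi K i) with h | h
        · left; exact ⟨by rcases hzi.1 with h' | h' <;> linarith, by linarith⟩
        · right; exact ⟨by linarith, by rcases hzi.2 with h' | h' <;> linarith⟩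
    rcases key with h | h
    · refine ⟨K, fun j => ?_, fun j => ?_⟩ <;> by_cases hj : j = i
      · subst hj; exact h.1
      · exact (hzj j hj).1.1
      · subst hj; exact h.2
      · exact (hzj j hj).1.2
    · refine ⟨L, fun j => ?_, fun j => ?_⟩ <;> by_cases hj : j = i
      · subst hj; exact h.1
      · exact (hzj j hj).2.1
      · subst hj; exact h.2
      · exact (hzj j hj).2.2

/-! ### Geometric data shared by neighbouring cells -/

lemma faceCoord_nbr {K L : M.Cell} {i : Fin d} {s : Bool} (h : M.nbr K i s = some L) :
    M.faceCoord L i (!s) = M.faceCoord K i s := by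
  have := (sharesFace_of_nbr h).1
  cases s <;> simpa [faceCoord] using this

lemma lo_nbr {K L : M.Cell} {i j : Fin d} {s : Bool} (h : M.nbr K i s = some L) (hj : j ≠ i) :
    M.lo L j = M.lo K j := ((sharesFace_of_nbr h).2 j hj).1

lemma hi_nbr {K L : M.Cell} {i j : Fin d} {s : Bool} (h : M.nbr K i s = some L) (hj : j ≠ i) :
    M.hi L j = M.hi K j := ((sharesFace_of_nbr h).2 j hj).2

lemma width_nbr {K L : M.Cell} {i j : Fin d} {s : Bool} (h : M.nbr K i s = some L) (hj : j ≠ i) :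
    M.width L j = M.width K j := by simp [width, lo_nbr h hj, hi_nbr h hj]

lemma center_nbr {K L : M.Cell} {i j : Fin d} {s : Bool} (h : M.nbr K i s = some L) (hj : j ≠ i) :
    M.center L j = M.center K j := by simp [center, lo_nbr h hj, hi_nbr h hj]

lemma faceCoord_nbr_of_ne {K L : M.Cell} {i j : Fin d} {s : Bool} (h : M.nbr K i s = some L)
    (hj : j ≠ i) (r : Bool) : M.faceCoord L j r = M.faceCoord K j r := by
  simp [faceCoord, lo_nbr h hj, hi_nbr h hj]

lemma area_nbr {K L : M.Cell} {i : Fin d} {s : Bool} (h : M.nbr K i s = some L) :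
    M.area L i = M.area K i :=
  Finset.prod_congr rfl fun _ hj => width_nbr h (Finset.ne_of_mem_erase hj)

lemma faceCenter_nbr {K L : M.Cell} {i : Fin d} {s : Bool} (h : M.nbr K i s = some L) :
    M.faceCenter L i (!s) = M.faceCenter K i s := by
  ext j
  by_cases hj : j = i
  · subst hj; simp [faceCenter, faceCoord_nbr h]
  · simp [faceCenter, hj, center_nbr h hj]

lemma edgeCenter_nbr_left {K L : M.Cell} {i j : Fin d} {r : Bool} (h : M.nbr K i r = some L)
    (hj : j ≠ i) (s : Bool) : M.edgeCenter L i (!r) j s = M.edgeCenter K i r j s := by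
  simp [edgeCenter, faceCenter_nbr h, faceCoord_nbr_of_ne h hj]

lemma edgeCenter_nbr_right {K L : M.Cell} {i j : Fin d} {s : Bool} (h : M.nbr K j s = some L)
    (hj : j ≠ i) (r : Bool) : M.edgeCenter L i r j (!s) = M.edgeCenter K i r j s := by
  ext k
  by_cases hk : k = j
  · subst hk; simp [edgeCenter, faceCoord_nbr h]
  · by_cases hk' : k = i
    · subst hk'; simp [edgeCenter, faceCenter, hk, faceCoord_nbr_of_ne h hk]
    · simp [edgeCenter, faceCenter, hk, hk', center_nbr h hk]

/-- Both directions of `nbr` are separate choices; the uniqueness of the cell across a face makes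
them agree. -/
lemma nbr_symm (hreg : interior (closure Ω) = Ω) {K L : M.Cell} {i : Fin d} {s : Bool}
    (h : M.nbr K i s = some L) : M.nbr L i (!s) = some K := by
  apply nbr_eq_some_of_overlap hreg
  · rw [faceCoord_nbr h, Bool.not_not]
  · intro j hj
    rw [lo_nbr h hj, hi_nbr h hj]
    exact ⟨M.lo_lt_hi K j, M.lo_lt_hi K j⟩

/-- Around the intersection of the faces `(i, r)` and `(j, s)` of `K` the neighbours fit together. -/
lemma nbr_corner (hreg : interior (closure Ω) = Ω) {K L K' L' : M.Cell} {i j : Fin d} {r s : Bool}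
    (hij : j ≠ i) (hL : M.nbr K i r = some L) (hK' : M.nbr K j s = some K')
    (hL' : M.nbr L j s = some L') : M.nbr K' i r = some L' := by
  apply nbr_eq_some_of_overlap hreg
  · rw [faceCoord_nbr_of_ne hL' hij.symm, faceCoord_nbr hL, faceCoord_nbr_of_ne hK' hij.symm]
  · intro k hk
    by_cases hkj : k = j
    · subst hkj
      -- In the direction `j` both `K'` and `L'` start from the face `(j, s)` of `K` and extend to
      -- the same side, so they overlap even though their widths are not known to agree.
      have h1 := faceCoord_nbr hK'
      have h2 := faceCoord_nbr hL'
      rw [faceCoord_nbr_of_ne hL hij] at h2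
      have h3 := M.lo_lt_hi K' k
      have h4 := M.lo_lt_hi L' k
      cases s <;> simp [faceCoord] at h1 h2 <;> constructor <;> linarith
    · rw [lo_nbr hL' hkj, hi_nbr hL' hkj, lo_nbr hL hk, hi_nbr hL hk, lo_nbr hK' hkj,
        hi_nbr hK' hkj]
      exact ⟨M.lo_lt_hi K k, M.lo_lt_hi K k⟩

/-- The boundary of `Ω` is flat at the relative interior of an external face. -/
lemma hasAxisNormal_of_nbr (hreg : interior (closure Ω) = Ω) {K : M.Cell} {i : Fin d} {s : Bool}
    (h : M.nbr K i s = none) {x : Fin d → ℝ} (hxi : x i = M.faceCoord K i s)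
    (hx : ∀ j, j ≠ i → M.lo K j < x j ∧ x j < M.hi K j) : HasAxisNormal Ω i x := by
  have hother : ∀ L, L ≠ K → x ∉ Icc (M.lo L) (M.hi L) := by
    intro L hL hxL
    have hov : ∀ j, j ≠ i → M.lo K j < M.hi L j ∧ M.lo L j < M.hi K j := fun j hj =>
      ⟨(hx j hj).1.trans_le (hxL.2 j), (hxL.1 j).trans_lt (hx j hj).2⟩
    have hKi := M.lo_lt_hi K i
    have hLi := M.lo_lt_hi L i
    have h1 := hxL.1 i
    have h2 := hxL.2 i
    -- Either `L` touches `K` from outside, and then it is a neighbour across an external face, or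
    -- it reaches beyond the face plane into `K`, and then it is `K` itself.
    by_cases hface : M.faceCoord L i (!s) = M.faceCoord K i s
    · rw [nbr_eq_some_of_overlap hreg hface hov] at h
      cases h
    · apply hL
      symm
      apply M.eq_of_overlap
      intro j
      by_cases hj : j = i
      · subst hj
        cases s
        · simp only [faceCoord, Bool.not_false, if_true, Bool.false_eq_true, if_false] at hface hxi
          refine ⟨lt_of_le_of_ne (by linarith) (Ne.symm hface), by linarith⟩
        · simp only [faceCoord, Bool.not_true, if_true, Bool.false_eq_true, if_false] at hface hxi
          refine ⟨by linarith, lt_of_le_of_ne (by linarith) hface⟩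
      · exact hov j hj
  refine ⟨s, ?_⟩
  have hV : ∀ᶠ y in 𝓝 x, ∀ L, L ≠ K → y ∉ Icc (M.lo L) (M.hi L) := by
    rw [Filter.eventually_all]
    intro L
    by_cases hL : L = K
    · simp [hL]
    · filter_upwards [isClosed_Icc.isOpen_compl.mem_nhds (hother L hL)] with y hy _ using hy
  have hj : ∀ᶠ y in 𝓝 x, ∀ j, j ≠ i → M.lo K j < y j ∧ y j < M.hi K j := by
    rw [Filter.eventually_all]
    intro j
    by_cases hji : j = i
    · simp [hji]
    · have := (continuous_apply j).continuousAt.eventually_mem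
        (s := Ioo (M.lo K j) (M.hi K j)) (x := x) (isOpen_Ioo.mem_nhds (hx j hji))
      filter_upwards [this] with y hy _ using hy
  -- This keeps `y` away from the opposite face, so that the sign of `y i - x i` alone decides
  -- membership in the interior of `K`.
  have hi' : ∀ᶠ y in 𝓝 x, |y i - x i| < M.width K i := by
    have : ContinuousAt (fun y : Fin d → ℝ => |y i - x i|) x :=
      ((continuous_apply i).sub continuous_const).abs.continuousAt
    exact this.eventually_lt continuousAt_const (by simpa using M.width_pos K i)
  filter_upwards [hV.eventually_nhds, hj, hi'] with y hyV hyj hyi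
  constructor
  · intro hyΩ
    have hyint : y ∈ interior (Icc (M.lo K) (M.hi K)) := by
      rw [mem_interior_iff_mem_nhds]
      have hΩ : Ω ∈ 𝓝 y := (hreg ▸ isOpen_interior : IsOpen Ω).mem_nhds hyΩ
      filter_upwards [hΩ, hyV] with z hz hzV
      have hz' : z ∈ closure Ω := subset_closure hz
      rw [← M.cover, Set.mem_iUnion] at hz'
      obtain ⟨L, hL⟩ := hz'
      by_cases hLK : L = K
      · exact hLK ▸ hL
      · exact absurd hL (hzV L hLK)
    rw [interior_Icc_eq_openBox, openBox_mem_iff] at hyint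
    have := hyint i
    cases s <;> simp [side, faceCoord] at hxi ⊢ <;> linarith
  · intro hy
    apply M.openBox_subset hreg K
    rw [openBox_mem_iff]
    intro j
    by_cases hji : j = i
    · subst hji
      rw [abs_lt, width] at hyi
      cases s <;> simp [side, faceCoord] at hxi hy <;> constructor <;> linarith
    · exact hyj j hji

/-- A tangential continuous field vanishes on the closed external faces. -/
lemma eq_zero_on_external (hreg : interior (closure Ω) = Ω) {K : M.Cell} {i : Fin d} {s : Bool}
    (h : M.nbr K i s = none) {f : (Fin d → ℝ) → ℝ} (hf : Continuous f)
    (hzero : ∀ x, HasAxisNormal Ω i x → f x = 0) {x : Fin d → ℝ}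
    (hx : x ∈ boxFace (M.lo K) (M.hi K) i s) : f x = 0 := by
  -- The boundary is known to be flat only over the relative interior of the face. The segment from
  -- `x` to the face centre stays there for positive `t`, and `x` is reached by continuity.
  have hc : Continuous fun t : ℝ => f (x + t • (M.faceCenter K i s - x)) := by fun_prop
  have hev : ∀ t ∈ Ioc (0 : ℝ) 1, f (x + t • (M.faceCenter K i s - x)) = 0 := by
    intro t ht
    apply hzero
    refine hasAxisNormal_of_nbr hreg h ?_ ?_
    · have : x i = M.faceCoord K i s := hx.2
      simp [faceCenter, this]
    · intro j hj
      have h1 := hx.1.1 j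
      have h2 := hx.1.2 j
      have h3 := M.center_mem_Icc K j
      simp only [faceCenter, Pi.add_apply, Pi.smul_apply, Pi.sub_apply, smul_eq_mul,
        Function.update_of_ne hj]
      constructor
      · nlinarith [mul_pos ht.1 (sub_pos.2 h3.1), mul_nonneg (sub_nonneg.2 ht.2) (sub_nonneg.2 h1)]
      · nlinarith [mul_pos ht.1 (sub_pos.2 h3.2), mul_nonneg (sub_nonneg.2 ht.2) (sub_nonneg.2 h2)]
  have hlim : Tendsto (fun t : ℝ => f (x + t • (M.faceCenter K i s - x))) (𝓝[>] 0) (𝓝 (f x)) := by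
    have := hc.tendsto 0
    simp only [zero_smul, add_zero] at this
    exact this.mono_left nhdsWithin_le_nhds
  refine tendsto_nhds_unique hlim (tendsto_const_nhds.congr' ?_)
  filter_upwards [Ioc_mem_nhdsGT (zero_lt_one' ℝ)] with t ht using (hev t ht).symm

lemma faceCenter_mem_boxFace (K : M.Cell) (i : Fin d) (s : Bool) :
    M.faceCenter K i s ∈ boxFace (M.lo K) (M.hi K) i s := by
  refine ⟨⟨fun j => ?_, fun j => ?_⟩, by simp [faceCenter, faceCoord]⟩ <;>
    by_cases hj : j = i
  · subst hj; simpa [faceCenter] using (M.faceCoord_mem K j s).1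
  · simpa [faceCenter, hj] using (M.center_mem_Icc K j).1.le
  · subst hj; simpa [faceCenter] using (M.faceCoord_mem K j s).2
  · simpa [faceCenter, hj] using (M.center_mem_Icc K j).2.le

lemma edgeCenter_mem_boxFace (K : M.Cell) {i j : Fin d} (hij : j ≠ i) (r s : Bool) :
    M.edgeCenter K i r j s ∈ boxFace (M.lo K) (M.hi K) i r := by
  obtain ⟨⟨h1, h2⟩, h3⟩ := faceCenter_mem_boxFace K i r
  refine ⟨⟨fun k => ?_, fun k => ?_⟩, by simpa [edgeCenter, hij.symm] using h3⟩ <;>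
    by_cases hk : k = j
  · subst hk; simpa [edgeCenter] using (M.faceCoord_mem K k s).1
  · simpa [edgeCenter, hk] using h1 k
  · subst hk; simpa [edgeCenter] using (M.faceCoord_mem K k s).2
  · simpa [edgeCenter, hk] using h2 k

/-! ## Summation over faces -/

/-- The other name of a face; an external face has only one. -/
def otherName (M : MACMesh d Ω) (i : Fin d) (p : M.Cell × Bool) : M.Cell × Bool :=
  (M.nbr p.1 i p.2).elim p fun L => (L, !p.2)

lemma otherName_involutive (hreg : interior (closure Ω) = Ω) (i : Fin d) :
    Function.Involutive (M.otherName i) := by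
  rintro ⟨K, s⟩
  cases h : M.nbr K i s with
  | none => simp [otherName, h]
  | some L => simp [otherName, h, nbr_symm hreg h]

/-- Passing to the other name of a face is an involution of pairs (cell, side), so it only permutes
the summands. All exchanges of cells across faces are obtained from this reindexing. -/
lemma sum_otherName (hreg : interior (closure Ω) = Ω) (i : Fin d) (f : M.Cell → Bool → ℝ) :
    ∑ K, ∑ s, (M.nbr K i s).elim (f K s) (fun L => f L (!s)) = ∑ K, ∑ s, f K s := by
  rw [← Fintype.sum_prod_type', ← Fintype.sum_prod_type']
  rw [← Equiv.sum_comp (otherName_involutive hreg i).toPerm fun p : M.Cell × Bool => f p.1 p.2]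
  refine Finset.sum_congr rfl fun p _ => ?_
  rcases p with ⟨K, s⟩
  cases h : M.nbr K i s <;> simp [otherName, h]

/-- Exchanging the two names of every face shows that the sum equals its own negative. This is
discrete conservativity. -/
lemma sum_eq_zero_of_antisymm (hreg : interior (closure Ω) = Ω) (i : Fin d) (f : M.Cell → Bool → ℝ)
    (hint : ∀ K s L, M.nbr K i s = some L → f L (!s) = -f K s)
    (hext : ∀ K s, M.nbr K i s = none → f K s = 0) : ∑ K, ∑ s, f K s = 0 := by
  have h := sum_otherName hreg i f
  have h2 : ∑ K, ∑ s, (M.nbr K i s).elim (f K s) (fun L => f L (!s)) = -∑ K, ∑ s, f K s := by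
    simp only [← Finset.sum_neg_distrib]
    refine Finset.sum_congr rfl fun K _ => Finset.sum_congr rfl fun s _ => ?_
    cases hn : M.nbr K i s with
    | none => simp [hext K s hn]
    | some L => simpa using hint K s L hn
  linarith

/-- Sums over the internal faces `K|L` orthogonal to the direction `i`, with `K` the lower cell. -/
def sumFaces (M : MACMesh d Ω) (i : Fin d) (f : M.Cell → M.Cell → ℝ) : ℝ :=
  ∑ K, (M.nbr K i true).elim 0 (f K)

lemma sumFaces_congr {i : Fin d} {f g : M.Cell → M.Cell → ℝ}
    (h : ∀ K L, M.nbr K i true = some L → f K L = g K L) : M.sumFaces i f = M.sumFaces i g := by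
  refine Finset.sum_congr rfl fun K _ => ?_
  cases hn : M.nbr K i true with
  | none => rfl
  | some L => exact h K L hn

lemma abs_sumFaces_le {i : Fin d} {f g : M.Cell → M.Cell → ℝ}
    (h : ∀ K L, M.nbr K i true = some L → |f K L| ≤ g K L) :
    |M.sumFaces i f| ≤ M.sumFaces i g := by
  refine (Finset.abs_sum_le_sum_abs _ _).trans (Finset.sum_le_sum fun K _ => ?_)
  cases hn : M.nbr K i true with
  | none => simp
  | some L => exact h K L hn

lemma sumFaces_add (i : Fin d) (f g : M.Cell → M.Cell → ℝ) :
    M.sumFaces i (fun K L => f K L + g K L) = M.sumFaces i f + M.sumFaces i g := by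
  unfold sumFaces
  rw [← Finset.sum_add_distrib]
  refine Finset.sum_congr rfl fun K _ => ?_
  cases M.nbr K i true <;> simp

lemma sumFaces_sub (i : Fin d) (f g : M.Cell → M.Cell → ℝ) :
    M.sumFaces i (fun K L => f K L - g K L) = M.sumFaces i f - M.sumFaces i g := by
  unfold sumFaces
  rw [← Finset.sum_sub_distrib]
  refine Finset.sum_congr rfl fun K _ => ?_
  cases M.nbr K i true <;> simp

lemma sumFaces_mul_left (i : Fin d) (c : ℝ) (f : M.Cell → M.Cell → ℝ) :
    M.sumFaces i (fun K L => c * f K L) = c * M.sumFaces i f := by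
  unfold sumFaces
  rw [Finset.mul_sum]
  refine Finset.sum_congr rfl fun K _ => ?_
  cases M.nbr K i true <;> simp

/-- A sum over internal faces of contributions of the two adjacent cells. -/
lemma sumFaces_eq (hreg : interior (closure Ω) = Ω) (i : Fin d) (A : M.Cell → Bool → ℝ)
    (hA : ∀ K s, M.nbr K i s = none → A K s = 0) :
    M.sumFaces i (fun K L => A K true + A L false) = ∑ K, ∑ s, A K s := by
  -- Only contributions of lower faces are moved to the cell on the other side, hence the zero for
  -- `s = true`.
  have h := sum_otherName hreg i fun K s => if s then 0 else A K s
  simp only [Fintype.sum_bool, Bool.not_true, Bool.not_false, if_true, Bool.false_eq_true,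
    if_false, zero_add] at h
  simp only [Fintype.sum_bool, Finset.sum_add_distrib]
  rw [← h, ← Finset.sum_add_distrib]
  refine Finset.sum_congr rfl fun K _ => ?_
  cases hn : M.nbr K i true <;> cases hn' : M.nbr K i false <;> simp [hA, hn, hn']

end MACMesh

namespace MACMesh

/-! ## The logarithmic mean and the upwind value -/

/-- The conditions `1 ≤ B * a` and `1 ≤ B * b` are lower bounds written without division; with them
`log x ≤ x - 1`, applied to the quotients, gives the Lipschitz constant `B`. The same `B` thus
serves as upper bound and as inverse lower bound of the densities. -/
lemma abs_log_sub_log_le {a b B : ℝ} (ha : 0 < a) (hb : 0 < b) (haB : 1 ≤ B * a) (hbB : 1 ≤ B * b) :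
    |Real.log a - Real.log b| ≤ B * |a - b| := by
  have key : ∀ x y : ℝ, 0 < x → 0 < y → 1 ≤ B * y → Real.log x - Real.log y ≤ B * |x - y| := by
    intro x y hx hy hyB
    rw [← Real.log_div hx.ne' hy.ne']
    have h1 := Real.log_le_sub_one_of_pos (div_pos hx hy)
    have h2 : x / y - 1 = (x - y) / y := by field_simp
    have h3 : (x - y) / y ≤ B * |x - y| := by
      rw [div_le_iff₀ hy]
      nlinarith [le_abs_self (x - y), abs_nonneg (x - y)]
    linarith
  rw [abs_le]
  have h1 := key a b ha hb hbB
  have h2 := key b a hb ha haB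
  rw [abs_sub_comm b a] at h2
  constructor <;> linarith

/-- The graph of `exp` lies above its tangents, and the slope is at most `B` at both end points. -/
lemma abs_exp_sub_exp_le {x y B : ℝ} (hx : Real.exp x ≤ B) (hy : Real.exp y ≤ B) :
    |Real.exp x - Real.exp y| ≤ B * |x - y| := by
  have key : ∀ x y : ℝ, Real.exp x ≤ B → Real.exp x - Real.exp y ≤ B * |x - y| := by
    intro x y hx
    have h1 := Real.add_one_le_exp (y - x)
    have h2 : Real.exp y = Real.exp x * Real.exp (y - x) := by rw [← Real.exp_add]; ring_nf
    have h3 := Real.exp_pos x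
    rw [h2]
    calc Real.exp x - Real.exp x * Real.exp (y - x) ≤ Real.exp x * (x - y) := by nlinarith
      _ ≤ Real.exp x * |x - y| := by gcongr; exact le_abs_self _
      _ ≤ B * |x - y| := by gcongr
  rw [abs_le]
  have h1 := key x y hx
  have h2 := key y x hy
  rw [abs_sub_comm y x] at h2
  constructor <;> linarith

/-- The integral has no case distinction at `a = b`; bounds and Lipschitz continuity of the
logarithmic mean can be read off from the integrand. -/
lemma logMean_eq_integral {a b : ℝ} (ha : 0 < a) (hb : 0 < b) :
    logMean a b =
      ∫ s in (0 : ℝ)..1, Real.exp ((1 - s) * Real.log b + s * Real.log a) := by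
  unfold logMean
  split_ifs with h
  · subst h
    have : ∀ s : ℝ, (1 - s) * Real.log a + s * Real.log a = Real.log a := fun s => by ring
    simp [this, Real.exp_log ha]
  · have hne : Real.log a - Real.log b ≠ 0 := fun h0 =>
      h (Real.log_injOn_pos ha hb (sub_eq_zero.1 h0))
    have : ∀ s : ℝ, (1 - s) * Real.log b + s * Real.log a =
      (Real.log a - Real.log b) * s + Real.log b := fun s => by ring
    simp only [this]
    rw [intervalIntegral.integral_comp_mul_add (f := Real.exp) hne]
    simp only [mul_zero, zero_add, mul_one, sub_add_cancel, integral_exp, Real.exp_log ha,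
      Real.exp_log hb, smul_eq_mul]
    field_simp

lemma exp_interpolation_mem {a b c B : ℝ} (ha : 0 < a) (hb : 0 < b) (hac : c ≤ Real.log a)
    (hbc : c ≤ Real.log b) (haB : a ≤ B) (hbB : b ≤ B) {s : ℝ} (hs : s ∈ Icc (0 : ℝ) 1) :
    Real.exp c ≤ Real.exp ((1 - s) * Real.log b + s * Real.log a) ∧
      Real.exp ((1 - s) * Real.log b + s * Real.log a) ≤ B := by
  have hB : 0 < B := ha.trans_le haB
  have h1 := Real.log_le_log ha haB
  have h2 := Real.log_le_log hb hbB
  refine ⟨Real.exp_le_exp.2 ?_, ?_⟩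
  · nlinarith [hs.1, hs.2]
  · rw [← Real.le_log_iff_exp_le hB]
    nlinarith [hs.1, hs.2]

lemma intervalIntegrable_exp_interpolation (a b : ℝ) :
    IntervalIntegrable (fun s : ℝ => Real.exp ((1 - s) * Real.log b + s * Real.log a))
      volume 0 1 := by
  apply Continuous.intervalIntegrable
  fun_prop

lemma logMean_le {a b B : ℝ} (ha : 0 < a) (hb : 0 < b) (haB : a ≤ B) (hbB : b ≤ B) :
    logMean a b ≤ B := by
  rw [logMean_eq_integral ha hb]
  calc _ ≤ ∫ s in (0 : ℝ)..1, B := by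
        apply intervalIntegral.integral_mono_on zero_le_one
          (intervalIntegrable_exp_interpolation a b) (by simp)
        intro s hs
        exact (exp_interpolation_mem ha hb (min_le_left _ _) (min_le_right _ _) haB hbB hs).2
    _ = B := by simp

lemma le_logMean {a b c : ℝ} (hc : 0 < c) (hca : c ≤ a) (hcb : c ≤ b) : c ≤ logMean a b := by
  have ha := hc.trans_le hca
  have hb := hc.trans_le hcb
  rw [logMean_eq_integral ha hb]
  calc c = ∫ s in (0 : ℝ)..1, c := by simp
    _ ≤ _ := by
        apply intervalIntegral.integral_mono_on zero_le_one (by simp)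
          (intervalIntegrable_exp_interpolation a b)
        intro s hs
        have := (exp_interpolation_mem ha hb (Real.log_le_log hc hca) (Real.log_le_log hc hcb)
          (le_max_left a b) (le_max_right a b) hs).1
        rwa [Real.exp_log hc] at this

lemma logMean_pos {a b : ℝ} (ha : 0 < a) (hb : 0 < b) : 0 < logMean a b :=
  (lt_min ha hb).trans_le (le_logMean (lt_min ha hb) (min_le_left a b) (min_le_right a b))

lemma abs_logMean_sub_le {a b : ℝ} (ha : 0 < a) (hb : 0 < b) : |logMean a b - a| ≤ |b - a| := by
  have h1 := logMean_le ha hb (le_max_left a b) (le_max_right a b)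
  have h2 := le_logMean (lt_min ha hb) (min_le_left a b) (min_le_right a b)
  rcases le_total a b with h | h
  · rw [max_eq_right h] at h1
    rw [min_eq_left h] at h2
    rw [abs_of_nonneg (by linarith), abs_of_nonneg (by linarith)]
    linarith
  · rw [max_eq_left h] at h1
    rw [min_eq_right h] at h2
    rw [abs_of_nonpos (by linarith), abs_of_nonpos (by linarith)]
    linarith

lemma logMean_comm (a b : ℝ) : logMean a b = logMean b a := by
  unfold logMean
  by_cases h : a = b
  · simp [h]
  · rw [if_neg h, if_neg (Ne.symm h), ← neg_sub b a, ← neg_sub (Real.log b), neg_div_neg_eq]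

/-- Under the integral, one factor `B` is the Lipschitz constant of `exp` on the relevant range, the
other that of `log`. It transfers the smallness of the density increments in time to the interface
densities. -/
lemma abs_logMean_sub_logMean_le {a b a' b' B : ℝ} (ha : 0 < a) (hb : 0 < b) (ha' : 0 < a')
    (hb' : 0 < b') (haB : a ≤ B) (hbB : b ≤ B) (haB' : a' ≤ B) (hbB' : b' ≤ B)
    (hai : 1 ≤ B * a) (hbi : 1 ≤ B * b) (hai' : 1 ≤ B * a') (hbi' : 1 ≤ B * b') :
    |logMean a b - logMean a' b'| ≤ B * (B * |a - a'| + B * |b - b'|) := by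
  have hB : 0 ≤ B := ha.le.trans haB
  rw [logMean_eq_integral ha hb, logMean_eq_integral ha' hb',
    ← intervalIntegral.integral_sub (intervalIntegrable_exp_interpolation a b)
      (intervalIntegrable_exp_interpolation a' b')]
  have h1 := abs_log_sub_log_le ha ha' hai hai'
  have h2 := abs_log_sub_log_le hb hb' hbi hbi'
  have h := intervalIntegral.norm_integral_le_of_norm_le_const
    (a := (0 : ℝ)) (b := 1) (C := B * (B * |a - a'| + B * |b - b'|))
    (f := fun s => Real.exp ((1 - s) * Real.log b + s * Real.log a) -
      Real.exp ((1 - s) * Real.log b' + s * Real.log a')) ?_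
  · simpa using h
  · intro s hs
    rw [uIoc_of_le zero_le_one] at hs
    have hs' : s ∈ Icc (0 : ℝ) 1 := ⟨hs.1.le, hs.2⟩
    refine (abs_exp_sub_exp_le
      (exp_interpolation_mem ha hb (min_le_left _ _) (min_le_right _ _) haB hbB hs').2
      (exp_interpolation_mem ha' hb' (min_le_left _ _) (min_le_right _ _) haB' hbB' hs').2).trans ?_
    gcongr
    have : (1 - s) * Real.log b + s * Real.log a - ((1 - s) * Real.log b' + s * Real.log a') =
      (1 - s) * (Real.log b - Real.log b') + s * (Real.log a - Real.log a') := by ring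
    rw [this]
    refine (abs_add_le _ _).trans ?_
    rw [abs_mul, abs_mul, abs_of_nonneg (by linarith [hs'.2] : 0 ≤ 1 - s), abs_of_nonneg hs'.1]
    nlinarith [hs'.1, hs'.2, abs_nonneg (Real.log b - Real.log b'),
      abs_nonneg (Real.log a - Real.log a')]

/-- Both sides of a dual face select the same upwind value; for zero flux the choice is irrelevant.
This makes the convected momentum conservative. -/
lemma upwind_neg (f v v' : ℝ) : upwind (-f) v' v = -upwind f v v' := by
  unfold upwind
  rcases lt_trichotomy f 0 with h | h | h
  · rw [if_pos (by linarith), if_neg (by linarith)]; ring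
  · simp [h]
  · rw [if_neg (by linarith), if_pos h.le]; ring

lemma upwind_zero (v v' : ℝ) : upwind 0 v v' = 0 := by simp [upwind]

/-- Upwinding costs at most the flux times the velocity jump, so the jump can be charged to `osc`.
-/
lemma abs_upwind_sub_le (f v v' : ℝ) : |upwind f v v' - f * v| ≤ |f| * |v - v'| := by
  unfold upwind
  split_ifs
  · simp only [sub_self, abs_zero]; positivity
  · rw [← mul_sub, abs_mul, abs_sub_comm]

/-- Comparison of a product of a flux and a difference quotient with its expected value. -/
lemma abs_flux_mul_sub_le {f D a w σ X g c e h B : ℝ} (hσ : σ * σ = 1) (ha : 0 ≤ a) (hw : 0 ≤ w)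
    (hB : 1 ≤ B) (_hh : 0 ≤ h) (hh1 : h ≤ 1) (hhe : h ≤ e)
    (hf : |f - a * (σ * X)| ≤ c * a * e) (hD : |D - σ * (w / 2 * g)| ≤ B * h * w)
    (hX : |X| ≤ B ^ 3) (hg : |g| ≤ B) :
    |f * D - a * w / 2 * (X * g)| ≤ (2 * B * c + B ^ 4) * (a * w * e) := by
  have hσ1 : |σ| = 1 := by
    have : |σ| * |σ| = 1 := by rw [← abs_mul, hσ, abs_one]
    nlinarith [abs_nonneg σ]
  have hce : 0 ≤ c * a * e := (abs_nonneg _).trans hf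
  have hD' : |D| ≤ 2 * B * w := by
    have h1 : |σ * (w / 2 * g)| ≤ w / 2 * B := by
      rw [abs_mul, hσ1, one_mul, abs_mul, abs_of_nonneg (by positivity : 0 ≤ w / 2)]
      gcongr
    have h2 : |D| ≤ |D - σ * (w / 2 * g)| + |σ * (w / 2 * g)| := by
      simpa using abs_add_le (D - σ * (w / 2 * g)) (σ * (w / 2 * g))
    have h3 : B * h * w ≤ B * w := by
      have : B * w * h ≤ B * w * 1 := by gcongr
      linarith
    have : 0 ≤ B * w := by positivity
    linarith
  -- The flux error is multiplied by the full difference `D`, of size `w`, and the Taylor error by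
  -- the expected flux. The signs cancel in the main term because `σ * σ = 1`.
  have h1 : f * D - a * w / 2 * (X * g) =
      (f - a * (σ * X)) * D + a * (σ * X) * (D - σ * (w / 2 * g)) := by
    have : a * (σ * X) * (σ * (w / 2 * g)) = σ * σ * (a * w / 2 * (X * g)) := by ring
    rw [sub_mul, mul_sub, this, hσ]
    ring
  rw [h1]
  refine (abs_add_le _ _).trans ?_
  rw [abs_mul, abs_mul, abs_mul, abs_mul, hσ1, one_mul, abs_of_nonneg ha]
  calc |f - a * (σ * X)| * |D| + a * |X| * |D - σ * (w / 2 * g)|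
      ≤ c * a * e * (2 * B * w) + a * B ^ 3 * (B * h * w) := by gcongr
    _ ≤ c * a * e * (2 * B * w) + a * B ^ 3 * (B * e * w) := by gcongr
    _ = (2 * B * c + B ^ 4) * (a * w * e) := by ring

variable {d : ℕ} {Ω : Set (Fin d → ℝ)} {M : MACMesh d Ω}

/-! ## Symmetry of the discrete operators -/

lemma dualVol_of_nbr {K L : M.Cell} {i : Fin d} {s : Bool} (h : M.nbr K i s = some L) :
    M.dualVol K i s = M.vol K / 2 + M.vol L / 2 := by simp [dualVol, h]

lemma half_vol_le_dualVol (K : M.Cell) (i : Fin d) (s : Bool) :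
    M.vol K / 2 ≤ M.dualVol K i s := by
  unfold dualVol
  cases M.nbr K i s with
  | none => exact le_rfl
  | some L => have := M.vol_pos L; simp only; linarith

lemma dualVol_pos (K : M.Cell) (i : Fin d) (s : Bool) : 0 < M.dualVol K i s := by
  have := M.vol_pos K
  have := half_vol_le_dualVol K i s
  linarith

lemma faceDensity_of_nbr {K L : M.Cell} {i : Fin d} {s : Bool} (h : M.nbr K i s = some L)
    (ρ : M.CellField) : M.faceDensity ρ K i s = logMean (ρ K) (ρ L) := by simp [faceDensity, h]

lemma grad_of_nbr {K L : M.Cell} {i : Fin d} {s : Bool} (h : M.nbr K i s = some L)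
    (q : M.CellField) :
    M.grad q K i s = M.area K i / M.dualVol K i s * (q L - q K) * side s := by simp [grad, h]

lemma dualAvg_of_nbr {K L : M.Cell} {i : Fin d} {s : Bool} (h : M.nbr K i s = some L)
    (q : M.CellField) :
    M.dualAvg q K i s = (M.vol K / 2 * q K + M.vol L / 2 * q L) / M.dualVol K i s := by
  simp [dualAvg, h]

/-- Fluxes through the faces, outward from the cells: antisymmetric on internal faces and zero on
external ones. -/
structure IsFlux (M : MACMesh d Ω) (F : M.FaceField) : Prop where
  nbr : ∀ K i s L, M.nbr K i s = some L → F L i (!s) = -F K i s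
  ext : ∀ K i s, M.nbr K i s = none → F K i s = 0

/-- Interface density, area, dual volume and `η` are symmetric in the two cells, while the normal
changes sign. The sign in `grad` cancels against that of the normal, so the stabilisation is a
multiple of the difference of the logarithms and is antisymmetric too. -/
lemma isFlux_massFlux (hreg : interior (closure Ω) = Ω) {δt : ℝ} {η u : M.FaceField}
    (ρ ρ' : M.CellField) (hη : M.IsFaceField η) (hu : M.IsFaceFieldZero u) :
    M.IsFlux (M.massFlux δt η ρ ρ' u) := by
  constructor
  · intro K i s L h
    have h' := nbr_symm hreg h
    simp only [massFlux, faceDensity_of_nbr h, faceDensity_of_nbr h', grad_of_nbr h,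
      grad_of_nbr h', dualVol_of_nbr h, dualVol_of_nbr h', area_nbr h, hu.1 K i s L h,
      hη K i s L h, side_not, logMean_comm (ρ L) (ρ K)]
    ring
  · intro K i s h
    simp [massFlux, hu.2 K i s h, grad, h]

/-! ## Local oscillation -/

/-- The oscillation of the density and the velocity around a cell. -/
def osc (M : MACMesh d Ω) (ρ : M.CellField) (u : M.FaceField) (K : M.Cell) : ℝ :=
  (∑ i, ∑ s, |u K i true - u K i s|) +
  (∑ i, ∑ s, (M.nbr K i s).elim 0 fun L => |ρ L - ρ K|) +
  ∑ i, ∑ r, ∑ j, ∑ s, (M.nbr K j s).elim 0 fun L => |u L i r - u K i r|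

lemma elim_abs_nonneg {α : Type*} (o : Option α) (f : α → ℝ) : 0 ≤ o.elim 0 fun a => |f a| := by
  cases o <;> simp

lemma le_sum_sum_bool {f : Fin d → Bool → ℝ} (hf : ∀ i s, 0 ≤ f i s) (i : Fin d) (s : Bool) :
    f i s ≤ ∑ i, ∑ s, f i s :=
  (Finset.single_le_sum (f := fun s => f i s) (fun s _ => hf i s) (Finset.mem_univ s)).trans
    (Finset.single_le_sum (f := fun i => ∑ s, f i s)
      (fun i _ => Finset.sum_nonneg fun s _ => hf i s) (Finset.mem_univ i))

section osc

variable (ρ : M.CellField) (u : M.FaceField) (K : M.Cell)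

lemma osc_terms_nonneg : 0 ≤ (∑ i, ∑ s, |u K i true - u K i s|) ∧
    0 ≤ (∑ i, ∑ s, (M.nbr K i s).elim 0 fun L => |ρ L - ρ K|) ∧
    0 ≤ ∑ i, ∑ r, ∑ j, ∑ s, (M.nbr K j s).elim 0 fun L => |u L i r - u K i r| := by
  refine ⟨?_, ?_, ?_⟩
  · positivity
  · exact Finset.sum_nonneg fun i _ => Finset.sum_nonneg fun s _ => elim_abs_nonneg _ _
  · exact Finset.sum_nonneg fun i _ => Finset.sum_nonneg fun s _ => Finset.sum_nonneg fun i _ =>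
      Finset.sum_nonneg fun s _ => elim_abs_nonneg _ _

lemma osc_nonneg : 0 ≤ M.osc ρ u K := by
  obtain ⟨h1, h2, h3⟩ := osc_terms_nonneg ρ u K
  unfold osc
  positivity

lemma abs_true_sub_le_osc (i : Fin d) (s : Bool) : |u K i true - u K i s| ≤ M.osc ρ u K := by
  obtain ⟨h1, h2, h3⟩ := osc_terms_nonneg ρ u K
  have := le_sum_sum_bool (f := fun i s => |u K i true - u K i s|) (fun _ _ => abs_nonneg _) i s
  unfold osc
  linarith

lemma density_sub_le_osc {L : M.Cell} {i : Fin d} {s : Bool} (h : M.nbr K i s = some L) :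
    |ρ L - ρ K| ≤ M.osc ρ u K := by
  obtain ⟨h1, h2, h3⟩ := osc_terms_nonneg ρ u K
  have := le_sum_sum_bool (f := fun i s => (M.nbr K i s).elim 0 fun L => |ρ L - ρ K|)
    (fun _ _ => elim_abs_nonneg _ _) i s
  simp only [h, Option.elim_some] at this
  unfold osc
  linarith

lemma velocity_sub_le_osc {L : M.Cell} (i : Fin d) (r : Bool) {j : Fin d} {s : Bool}
    (h : M.nbr K j s = some L) : |u L i r - u K i r| ≤ M.osc ρ u K := by
  obtain ⟨h1, h2, h3⟩ := osc_terms_nonneg ρ u K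
  have ha := le_sum_sum_bool (f := fun j s => (M.nbr K j s).elim 0 fun L => |u L i r - u K i r|)
    (fun _ _ => elim_abs_nonneg _ _) j s
  have hb := le_sum_sum_bool
    (f := fun i r => ∑ j, ∑ s, (M.nbr K j s).elim 0 fun L => |u L i r - u K i r|)
    (fun _ _ => Finset.sum_nonneg fun i _ => Finset.sum_nonneg fun s _ => elim_abs_nonneg _ _) i r
  simp only [h, Option.elim_some] at ha
  unfold osc
  linarith

end osc

/-! ## Bounds on a time step -/

/-- Quantitative bounds on the data of one time step, with a constant `B` and a small parameter
`h`. -/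
structure StepBounds (M : MACMesh d Ω) (δt B h : ℝ) (η : M.FaceField) (ρ ρ' : M.CellField)
    (u : M.FaceField) : Prop where
  one_le : 1 ≤ B
  δt_pos : 0 < δt
  δt_le_h : δt ≤ h
  h_le_one : h ≤ 1
  width_le : ∀ K i, M.width K i ≤ h
  area_le : ∀ K i, M.area K i ≤ h
  δt_le_vol : ∀ K, δt ≤ B * M.vol K
  density_pos : ∀ K, 0 < ρ K
  density_le : ∀ K, ρ K ≤ B
  density_inv : ∀ K, 1 ≤ B * ρ K
  density_pos' : ∀ K, 0 < ρ' K
  density_le' : ∀ K, ρ' K ≤ B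
  density_inv' : ∀ K, 1 ≤ B * ρ' K
  velocity_le : ∀ K i s, |u K i s| ≤ B
  velocity_mem : M.IsFaceFieldZero u
  eta_mem : M.IsFaceField η
  eta_le : ∀ K i s L, M.nbr K i s = some L → |η K i s| ≤ B

namespace StepBounds

variable {δt B h : ℝ} {η : M.FaceField} {ρ ρ' : M.CellField} {u : M.FaceField}

lemma h_pos (S : StepBounds M δt B h η ρ ρ' u) : 0 < h := S.δt_pos.trans_le S.δt_le_h

lemma abs_density (S : StepBounds M δt B h η ρ ρ' u) (K : M.Cell) : |ρ K| ≤ B := by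
  rw [abs_of_pos (S.density_pos K)]; exact S.density_le K

lemma abs_density' (S : StepBounds M δt B h η ρ ρ' u) (K : M.Cell) : |ρ' K| ≤ B := by
  rw [abs_of_pos (S.density_pos' K)]; exact S.density_le' K

/-- The jump of the logarithm is only estimated by a constant here. Smallness comes from the
prefactor: `δt` is controlled by the cell volume and the area by `h`. -/
lemma abs_stabilisation_le (S : StepBounds M δt B h η ρ ρ' u)
    {K L : M.Cell} {i : Fin d} {s : Bool} (hn : M.nbr K i s = some L) :
    |η K i s * δt * (M.grad (fun J => Real.log (ρ' J)) K i s * side s)| ≤ 2 * B ^ 4 * h := by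
  have hB := S.one_le
  have hlog : |Real.log (ρ' L) - Real.log (ρ' K)| ≤ B * B := by
    refine (abs_log_sub_log_le (S.density_pos' L) (S.density_pos' K) (S.density_inv' L)
      (S.density_inv' K)).trans ?_
    gcongr
    rw [abs_le]
    have h1 := S.density_pos' L
    have h2 := S.density_pos' K
    have h3 := S.density_le' L
    have h4 := S.density_le' K
    constructor <;> linarith
  have hdv := dualVol_pos K i s
  -- The factor two appears because the dual cell contains half of `K`.
  have hquot : δt * (M.area K i / M.dualVol K i s) ≤ 2 * B * h := by
    have h1 := half_vol_le_dualVol K i s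
    have h2 := S.δt_le_vol K
    have h3 := S.area_le K i
    have h4 := (M.area_pos K i).le
    rw [mul_div_assoc', div_le_iff₀ hdv]
    calc δt * M.area K i ≤ (B * M.vol K) * h := by gcongr; exact (S.δt_pos.le.trans h2)
      _ = B * h * M.vol K := by ring
      _ ≤ B * h * (2 * M.dualVol K i s) := by
          have := S.h_pos.le
          gcongr
          linarith
      _ = _ := by ring
  rw [grad_of_nbr hn]
  have : η K i s * δt * (M.area K i / M.dualVol K i s *
      (Real.log (ρ' L) - Real.log (ρ' K)) * side s * side s) =
      (δt * (M.area K i / M.dualVol K i s)) * (η K i s * (Real.log (ρ' L) - Real.log (ρ' K))) *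
        (side s * side s) := by ring
  rw [this, side_mul_side, mul_one, abs_mul]
  have hpos : 0 ≤ δt * (M.area K i / M.dualVol K i s) :=
    mul_nonneg S.δt_pos.le (div_nonneg (M.area_pos K i).le hdv.le)
  rw [abs_of_nonneg hpos, abs_mul]
  calc _ ≤ 2 * B * h * (B * (B * B)) := by
        have := S.eta_le K i s L hn
        have := S.h_pos.le
        gcongr
    _ = _ := by ring

/-- All flux values around a cell are reduced to one density and one velocity vector: the
logarithmic mean is within the density jump of `ρ K`, the face velocity within `osc` of the upper
one, and the stabilisation is of order `h`. -/
lemma abs_massFlux_sub_le (S : StepBounds M δt B h η ρ ρ' u) (K : M.Cell) (i : Fin d) (s : Bool) :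
    |M.massFlux δt η ρ ρ' u K i s - M.area K i * (side s * (ρ K * u K i true))| ≤
      2 * B ^ 4 * M.area K i * (M.osc ρ u K + h) := by
  have hB := S.one_le
  have ho := osc_nonneg ρ u K
  have hh := S.h_pos
  have ha := M.area_pos K i
  have hB4 : B ≤ B ^ 4 := le_self_pow₀ hB (by norm_num)
  have huo := abs_true_sub_le_osc ρ u K i s
  cases hn : M.nbr K i s with
  | none =>
    -- On an external face the flux is zero, and so is the velocity; hence `u K i true` is itself
    -- bounded by the oscillation and the expected flux is admissible as an error.
    have h0 := S.velocity_mem.2 K i s hn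
    rw [h0, sub_zero] at huo
    have : M.massFlux δt η ρ ρ' u K i s = 0 := by simp [massFlux, h0, grad, hn]
    rw [this, zero_sub, abs_neg, abs_mul, abs_mul, abs_side, one_mul, abs_mul, abs_of_pos ha]
    calc M.area K i * (|ρ K| * |u K i true|) ≤ M.area K i * (B * M.osc ρ u K) := by
          gcongr; exact S.abs_density K
      _ ≤ M.area K i * (2 * B ^ 4 * (M.osc ρ u K + h)) := by
          gcongr <;> nlinarith
      _ = _ := by ring
  | some L =>
    have hst := S.abs_stabilisation_le hn
    have hd := abs_logMean_sub_le (S.density_pos K) (S.density_pos L)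
    have hd' := density_sub_le_osc ρ u K hn
    unfold massFlux
    rw [faceDensity_of_nbr hn, ← mul_sub, abs_mul, abs_of_pos ha]
    have e : logMean (ρ K) (ρ L) * (u K i s * side s) -
        η K i s * δt * (M.grad (fun J => Real.log (ρ' J)) K i s * side s) -
          side s * (ρ K * u K i true) =
        side s * ((logMean (ρ K) (ρ L) - ρ K) * u K i s - ρ K * (u K i true - u K i s)) -
        η K i s * δt * (M.grad (fun J => Real.log (ρ' J)) K i s * side s) := by ring
    rw [e]
    have h1 : |side s * ((logMean (ρ K) (ρ L) - ρ K) * u K i s - ρ K * (u K i true - u K i s))| ≤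
        M.osc ρ u K * B + B * M.osc ρ u K := by
      rw [abs_mul, abs_side, one_mul]
      refine (abs_sub _ _).trans ?_
      rw [abs_mul, abs_mul]
      have := S.velocity_le K i s
      have := S.abs_density K
      gcongr
      exact hd.trans hd'
    calc _ ≤ M.area K i * ((M.osc ρ u K * B + B * M.osc ρ u K) + 2 * B ^ 4 * h) := by
          gcongr
          exact (abs_sub _ _).trans (add_le_add h1 hst)
      _ ≤ M.area K i * (2 * B ^ 4 * M.osc ρ u K + 2 * B ^ 4 * h) := by gcongr; nlinarith
      _ = _ := by ring

/-- This crude bound is used where the flux multiplies a quantity that is already small. -/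
lemma abs_massFlux_le (S : StepBounds M δt B h η ρ ρ' u) (K : M.Cell) (i : Fin d) (s : Bool) :
    |M.massFlux δt η ρ ρ' u K i s| ≤ 3 * B ^ 4 * M.area K i := by
  have hB := S.one_le
  have hh := S.h_pos
  have ha := M.area_pos K i
  cases hn : M.nbr K i s with
  | none =>
    have h0 := S.velocity_mem.2 K i s hn
    have : M.massFlux δt η ρ ρ' u K i s = 0 := by simp [massFlux, h0, grad, hn]
    rw [this, abs_zero]
    positivity
  | some L =>
    have hst := S.abs_stabilisation_le hn
    have h1 := logMean_le (S.density_pos K) (S.density_pos L) (S.density_le K) (S.density_le L)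
    have h2 := logMean_pos (S.density_pos K) (S.density_pos L)
    unfold massFlux
    rw [faceDensity_of_nbr hn, abs_mul, abs_of_pos ha]
    calc _ ≤ M.area K i * (B * B + 2 * B ^ 4 * h) := by
          gcongr
          refine (abs_sub _ _).trans (add_le_add ?_ hst)
          rw [abs_mul, abs_mul, abs_side, mul_one, abs_of_pos h2]
          have := S.velocity_le K i s
          gcongr
      _ ≤ M.area K i * (B ^ 4 + 2 * B ^ 4 * 1) := by
          have := S.h_le_one
          gcongr
          nlinarith [pow_le_pow_right₀ hB (by norm_num : 2 ≤ 4)]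
      _ = _ := by ring

lemma isFlux (S : StepBounds M δt B h η ρ ρ' u)
    (hreg : interior (closure Ω) = Ω) : M.IsFlux (M.massFlux δt η ρ ρ' u) :=
  isFlux_massFlux hreg ρ ρ' S.eta_mem S.velocity_mem

/-- The weak form of the mass flux balance of one time step. -/
lemma abs_mass_step_le (S : StepBounds M δt B h η ρ ρ' u)
    (hreg : interior (closure Ω) = Ω) {c : M.CellField} {p : M.FaceField}
    {G : M.Cell → Fin d → ℝ} (hp : M.IsFaceField p)
    (hpc : ∀ K i s, |p K i s - c K - side s * (M.width K i / 2 * G K i)| ≤ B * h * M.width K i)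
    (hG : ∀ K i, |G K i| ≤ B) :
    |(∑ K, ∑ i, ∑ s, M.massFlux δt η ρ ρ' u K i s * c K) +
        ∑ K, ∑ i, M.vol K * (ρ K * u K i true * G K i)| ≤
      10 * d * B ^ 5 * ∑ K, M.vol K * (M.osc ρ u K + h) := by
  set F := M.massFlux δt η ρ ρ' u with hF
  have hB := S.one_le
  have hflux : M.IsFlux F := S.isFlux hreg
  -- Conservativity: the face values of the test function drop out, so the cell value `c K` may be
  -- replaced by `c K - p K i s`. The two faces orthogonal to `i` then contribute half of the volume
  -- term each.
  have h0 : ∑ K, ∑ i, ∑ s, F K i s * p K i s = 0 := by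
    rw [Finset.sum_comm]
    refine Finset.sum_eq_zero fun i _ => sum_eq_zero_of_antisymm hreg i _ ?_ ?_
    · intro K s L hn
      rw [hflux.nbr K i s L hn, hp K i s L hn]; ring
    · intro K s hn
      rw [hflux.ext K i s hn, zero_mul]
  have e : (∑ K, ∑ i, ∑ s, F K i s * c K) + ∑ K, ∑ i, M.vol K * (ρ K * u K i true * G K i) =
      -∑ K, ∑ i, ∑ s, (F K i s * (p K i s - c K) -
        M.area K i * M.width K i / 2 * (ρ K * u K i true * G K i)) := by
    have e1 : ∀ K i, M.vol K * (ρ K * u K i true * G K i) =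
        ∑ _s : Bool, M.area K i * M.width K i / 2 * (ρ K * u K i true * G K i) := by
      intro K i
      simp only [Fintype.sum_bool, M.area_mul_width]; ring
    simp only [e1, mul_sub, Finset.sum_sub_distrib, h0]
    ring
  rw [e, abs_neg, Finset.mul_sum]
  refine (Finset.abs_sum_le_sum_abs _ _).trans (Finset.sum_le_sum fun K _ => ?_)
  refine (Finset.abs_sum_le_sum_abs _ _).trans ?_
  have hterm : ∀ i ∈ Finset.univ, |∑ s, (F K i s * (p K i s - c K) -
        M.area K i * M.width K i / 2 * (ρ K * u K i true * G K i))| ≤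
      10 * B ^ 5 * (M.vol K * (M.osc ρ u K + h)) := by
    intro i _
    refine (Finset.abs_sum_le_sum_abs _ _).trans ?_
    have : ∀ s, |F K i s * (p K i s - c K) -
        M.area K i * M.width K i / 2 * (ρ K * u K i true * G K i)| ≤
        5 * B ^ 5 * (M.vol K * (M.osc ρ u K + h)) := by
      intro s
      have ho := osc_nonneg ρ u K
      have hX : |ρ K * u K i true| ≤ B ^ 3 := by
        rw [abs_mul]
        calc |ρ K| * |u K i true| ≤ B * B := by
              gcongr
              · exact S.abs_density K
              · exact S.velocity_le K i true
          _ ≤ B ^ 3 := by nlinarith [mul_pos (by linarith : 0 < B) (by linarith : 0 < B)]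
      have := abs_flux_mul_sub_le (side_mul_side s) (M.area_pos K i).le (M.width_pos K i).le hB
        S.h_pos.le S.h_le_one (by linarith : h ≤ M.osc ρ u K + h)
        (S.abs_massFlux_sub_le K i s) (hpc K i s) hX (hG K i)
      refine this.trans ?_
      rw [M.area_mul_width]
      have hv := M.vol_pos K
      have := S.h_pos
      gcongr
      nlinarith [pow_le_pow_right₀ hB (by norm_num : 4 ≤ 5)]
    rw [Fintype.sum_bool]
    linarith [this true, this false]
  refine (Finset.sum_le_sum hterm).trans ?_
  simp only [Finset.sum_const, Finset.card_univ, Fintype.card_fin, nsmul_eq_mul]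
  apply le_of_eq; ring

end StepBounds

end MACMesh

namespace MACMesh

variable {d : ℕ} {Ω : Set (Fin d → ℝ)} {M : MACMesh d Ω}

/-! ## The convection term -/

lemma sideVelocity_of_nbr_lower {K L K' : M.Cell} {i j : Fin d} {s : Bool} (u : M.FaceField)
    (h : M.nbr K j s = some K') : M.sideVelocity u K L i j s = u K' i true := by
  simp [sideVelocity, h]

/-- `sideVelocity` prefers the lower cell. If both lateral neighbours exist, they share a face by
`nbr_corner`, so the value read from the upper one is the same. -/
lemma sideVelocity_of_nbr_upper (hreg : interior (closure Ω) = Ω) {K L L' : M.Cell} {i j : Fin d}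
    {s : Bool} (hij : j ≠ i) {u : M.FaceField} (hu : M.IsFaceField u)
    (hL : M.nbr K i true = some L) (h : M.nbr L j s = some L') :
    M.sideVelocity u K L i j s = u L' i false := by
  cases hK : M.nbr K j s with
  | none => simp [sideVelocity, h, hK]
  | some K' =>
    rw [sideVelocity_of_nbr_lower u hK]
    exact (hu K' i true L' (nbr_corner hreg hij hL hK h)).symm

/-- Conservativity of the lateral dual fluxes: tested against values on the lateral dual faces they
sum up to zero. -/
lemma sum_lateral_eq_zero (hreg : interior (closure Ω) = Ω) {F u : M.FaceField} (hF : M.IsFlux F)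
    {i j : Fin d} (hij : j ≠ i) {e : M.Cell → Bool → Bool → ℝ}
    (he₁ : ∀ K r s L, M.nbr K i r = some L → e L (!r) s = e K r s)
    (he₂ : ∀ K r s L, M.nbr K j s = some L → e L r (!s) = e K r s)
    (he₃ : ∀ K r s, M.nbr K i r = none → e K r s = 0) :
    ∑ s, M.sumFaces i (fun K L =>
      upwind ((F K j s + F L j s) / 2) (u K i true) (M.sideVelocity u K L i j s) * e K true s) =
      0 := by
  unfold sumFaces
  rw [Finset.sum_comm]
  apply sum_eq_zero_of_antisymm hreg j
  · intro K s K' hK'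
    have hK := nbr_symm hreg hK'
    cases hL : M.nbr K i true with
    | none =>
      cases hX : M.nbr K' i true with
      | none => simp
      | some X =>
        simp only [Option.elim_some, Option.elim_none, neg_zero]
        -- Re-entrant corner: only `K'` has an internal upper face. The common edge also belongs to
        -- an external face of `K`, where the test value is zero.
        rw [he₂ K true s K' hK', he₃ K true s hL, mul_zero]
    | some L =>
      cases hL' : M.nbr L j s with
      | some L' =>
        rw [nbr_corner hreg hij hL hK' hL']
        simp only [Option.elim_some]
        rw [sideVelocity_of_nbr_lower u hK, sideVelocity_of_nbr_lower u hK', hF.nbr K j s K' hK',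
          hF.nbr L j s L' hL', he₂ K true s K' hK', ← neg_mul, ← upwind_neg]
        congr 2
        ring
      | none =>
        cases hX : M.nbr K' i true with
        | none =>
          simp only [Option.elim_some, Option.elim_none]
          rw [← he₂ K true s K' hK', he₃ K' true _ hX, mul_zero, neg_zero]
        | some X =>
          rw [nbr_corner hreg hij.symm hK' hL hX] at hL'
          cases hL'
  · intro K s hK
    cases hL : M.nbr K i true with
    | none => simp
    | some L =>
      simp only [Option.elim_some]
      cases hL' : M.nbr L j s with
      | none => rw [hF.ext K j s hK, hF.ext L j s hL', add_zero, zero_div, upwind_zero, zero_mul]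
      | some L' =>
        have hLK : M.nbr L i false = some K := nbr_symm hreg hL
        -- Only the half of the lateral face that belongs to `L` is internal. Then the face `(i,
        -- false)` of `L'` must be external, since otherwise `nbr_corner` would supply the missing
        -- neighbour of `K`; so the edge value vanishes again.
        cases hX : M.nbr L' i false with
        | none =>
          rw [← he₁ K true s L hL, ← he₂ L _ s L' hL', Bool.not_true, he₃ L' false _ hX, mul_zero]
        | some X =>
          rw [nbr_corner hreg hij.symm hL' hLK hX] at hK
          cases hK

/-- A cell has at most two internal faces orthogonal to a given direction. -/
lemma sumFaces_le_two_mul_sum (hreg : interior (closure Ω) = Ω) (i : Fin d) {E : M.Cell → ℝ}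
    (hE : ∀ K, 0 ≤ E K) : M.sumFaces i (fun K L => E K + E L) ≤ 2 * ∑ K, E K := by
  have h := sumFaces_eq hreg i (fun K s => (M.nbr K i s).elim 0 fun _ => E K)
    (fun K s hn => by simp [hn])
  rw [Finset.mul_sum]
  calc M.sumFaces i (fun K L => E K + E L)
      = M.sumFaces i (fun K L => ((M.nbr K i true).elim 0 fun _ => E K) +
          (M.nbr L i false).elim 0 fun _ => E L) := by
        apply sumFaces_congr
        intro K L hn
        rw [hn, show M.nbr L i false = some K from nbr_symm hreg hn]
        simp
    _ = _ := h
    _ ≤ _ := by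
        refine Finset.sum_le_sum fun K _ => ?_
        have : ∀ s, (M.nbr K i s).elim 0 (fun _ => E K) ≤ E K := by
          intro s; cases M.nbr K i s <;> simp [hE]
        rw [Fintype.sum_bool]
        linarith [this true, this false]

lemma abs_le_of_abs_sub_le {D w g h B : ℝ} {s : Bool} (hw : 0 ≤ w) (hB : 1 ≤ B) (hh1 : h ≤ 1)
    (hD : |D - side s * (w / 2 * g)| ≤ B * h * w) (hg : |g| ≤ B) : |D| ≤ 2 * B * w := by
  have h1 : |side s * (w / 2 * g)| ≤ w / 2 * B := by
    rw [abs_mul, abs_side, one_mul, abs_mul, abs_of_nonneg (by positivity : 0 ≤ w / 2)]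
    gcongr
  have h2 : |D| ≤ |D - side s * (w / 2 * g)| + |side s * (w / 2 * g)| := by
    simpa using abs_add_le (D - side s * (w / 2 * g)) (side s * (w / 2 * g))
  have h3 : B * w * h ≤ B * w * 1 := by gcongr
  have : 0 ≤ B * w := by positivity
  linarith

namespace StepBounds

variable {δt B h : ℝ} {η : M.FaceField} {ρ ρ' : M.CellField} {u : M.FaceField}

lemma abs_product_le (S : StepBounds M δt B h η ρ ρ' u)
    (K : M.Cell) (i j : Fin d) : |ρ K * u K j true * u K i true| ≤ B ^ 3 := by
  have hB := S.one_le
  rw [abs_mul, abs_mul]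
  calc _ ≤ B * B * B := by
        have := S.abs_density K
        have := S.velocity_le K j true
        have := S.velocity_le K i true
        gcongr
    _ = _ := by ring

/-- The contribution of the faces of the dual cells that are parallel to the primal face. -/
lemma abs_mid_step_le (S : StepBounds M δt B h η ρ ρ' u)
    (K : M.Cell) (i : Fin d) (s : Bool) {p c g : ℝ}
    (hpc : |p - c - side s * (M.width K i / 2 * g)| ≤ B * h * M.width K i) (hg : |g| ≤ B) :
    |upwind ((M.massFlux δt η ρ ρ' u K i (!s) - M.massFlux δt η ρ ρ' u K i s) / 2)
        (u K i s) (u K i (!s)) * (p - c) +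
      M.vol K / 2 * (ρ K * u K i true * u K i true * g)| ≤
      13 * B ^ 6 * (M.vol K * (M.osc ρ u K + h)) := by
  set F := M.massFlux δt η ρ ρ' u with hF
  have hB := S.one_le
  have hh := S.h_pos
  have ho := osc_nonneg ρ u K
  have ha := M.area_pos K i
  -- The flux out of the dual cell through the mid-section of `K` points opposite to the normal of
  -- its face `(i, s)`, so its expected value is minus the expected flux through that face.
  set q := (F K i (!s) - F K i s) / 2 with hq
  have hF1 := S.abs_massFlux_sub_le K i s
  have hF2 := S.abs_massFlux_sub_le K i (!s)
  have hF3 := S.abs_massFlux_le K i s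
  have hF4 := S.abs_massFlux_le K i (!s)
  rw [← hF] at hF1 hF2 hF3 hF4
  have hqle : |q| ≤ 3 * B ^ 4 * M.area K i := by
    rw [hq, abs_div, abs_two]
    have := abs_sub (F K i (!s)) (F K i s)
    linarith
  have hqsub : |q + M.area K i * (side s * (ρ K * u K i true))| ≤
      2 * B ^ 4 * M.area K i * (M.osc ρ u K + h) := by
    have e : q + M.area K i * (side s * (ρ K * u K i true)) =
        ((F K i (!s) - M.area K i * (side (!s) * (ρ K * u K i true))) -
          (F K i s - M.area K i * (side s * (ρ K * u K i true)))) / 2 := by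
      rw [hq, side_not]; ring
    rw [e, abs_div, abs_two]
    have := abs_sub (F K i (!s) - M.area K i * (side (!s) * (ρ K * u K i true)))
          (F K i s - M.area K i * (side s * (ρ K * u K i true)))
    linarith
  have hu1 : |u K i s - u K i (!s)| ≤ M.osc ρ u K := by
    cases s
    · rw [abs_sub_comm]; exact abs_true_sub_le_osc ρ u K i false
    · exact abs_true_sub_le_osc ρ u K i false
  have hu2 : |u K i true - u K i s| ≤ M.osc ρ u K := abs_true_sub_le_osc ρ u K i s
  have hup := abs_upwind_sub_le q (u K i s) (u K i (!s))
  have hρu : |ρ K * u K i true| ≤ B * B := by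
    rw [abs_mul]
    have := S.abs_density K
    have := S.velocity_le K i true
    gcongr
  have hf : |upwind q (u K i s) (u K i (!s)) -
      M.area K i * (side s * (-(ρ K * u K i true * u K i true)))| ≤
      6 * B ^ 5 * M.area K i * (M.osc ρ u K + h) := by
    have e : upwind q (u K i s) (u K i (!s)) -
        M.area K i * (side s * (-(ρ K * u K i true * u K i true))) =
        (upwind q (u K i s) (u K i (!s)) - q * u K i s) +
        ((q + M.area K i * (side s * (ρ K * u K i true))) * u K i s +
          M.area K i * (side s * (ρ K * u K i true)) * (u K i true - u K i s)) := by ring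
    rw [e]
    have h1 : |q| * |u K i s - u K i (!s)| ≤ 3 * B ^ 4 * M.area K i * (M.osc ρ u K + h) := by
      gcongr; linarith
    have h2 : |(q + M.area K i * (side s * (ρ K * u K i true))) * u K i s| ≤
        2 * B ^ 4 * M.area K i * (M.osc ρ u K + h) * B := by
      rw [abs_mul]
      have := S.velocity_le K i s
      gcongr
    have h3 : |M.area K i * (side s * (ρ K * u K i true)) * (u K i true - u K i s)| ≤
        M.area K i * (1 * (B * B)) * (M.osc ρ u K + h) := by
      rw [abs_mul, abs_mul, abs_mul, abs_side, abs_of_pos ha]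
      gcongr
      linarith
    have h4 := abs_add_le (upwind q (u K i s) (u K i (!s)) - q * u K i s)
      ((q + M.area K i * (side s * (ρ K * u K i true))) * u K i s +
          M.area K i * (side s * (ρ K * u K i true)) * (u K i true - u K i s))
    have h5 := abs_add_le ((q + M.area K i * (side s * (ρ K * u K i true))) * u K i s)
      (M.area K i * (side s * (ρ K * u K i true)) * (u K i true - u K i s))
    have h6 : 0 ≤ M.area K i * (M.osc ρ u K + h) := by positivity
    have h7 : 3 * B ^ 4 + 2 * B ^ 4 * B + B * B ≤ 6 * B ^ 5 := by
      have := pow_le_pow_right₀ hB (by norm_num : 4 ≤ 5)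
      have := pow_le_pow_right₀ hB (by norm_num : 2 ≤ 5)
      nlinarith
    have h8 := mul_le_mul_of_nonneg_right h7 h6
    linarith
  have hX : |-(ρ K * u K i true * u K i true)| ≤ B ^ 3 := by
    rw [abs_neg]; exact S.abs_product_le K i i
  have := abs_flux_mul_sub_le (side_mul_side s) ha.le (M.width_pos K i).le hB
    hh.le S.h_le_one (by linarith : h ≤ M.osc ρ u K + h) hf hpc hX hg
  rw [M.area_mul_width] at this
  have e : upwind q (u K i s) (u K i (!s)) * (p - c) +
      M.vol K / 2 * (ρ K * u K i true * u K i true * g) =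
      upwind q (u K i s) (u K i (!s)) * (p - c) -
      M.vol K / 2 * (-(ρ K * u K i true * u K i true) * g) := by ring
  rw [e]
  refine this.trans ?_
  have hv := M.vol_pos K
  gcongr
  have := pow_le_pow_right₀ hB (by norm_num : 4 ≤ 6)
  linarith [show 2 * B * (6 * B ^ 5) = 12 * B ^ 6 by ring]

/-- The contribution of half a lateral face of a dual cell. -/
lemma abs_lateral_half_le (S : StepBounds M δt B h η ρ ρ' u)
    (K : M.Cell) (i j : Fin d) (r s : Bool) {e p g : ℝ}
    (hep : |e - p - side s * (M.width K j / 2 * g)| ≤ B * h * M.width K j) (hg : |g| ≤ B) :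
    |M.massFlux δt η ρ ρ' u K j s / 2 * u K i r * (p - e) +
      M.vol K / 4 * (ρ K * u K j true * u K i true * g)| ≤
      6 * B ^ 6 * (M.vol K * (M.osc ρ u K + h)) := by
  set F := M.massFlux δt η ρ ρ' u with hF
  have hB := S.one_le
  have hh := S.h_pos
  have ho := osc_nonneg ρ u K
  have ha := M.area_pos K j
  have hF1 := S.abs_massFlux_sub_le K j s
  have hF3 := S.abs_massFlux_le K j s
  rw [← hF] at hF1 hF3
  have hu2 : |u K i true - u K i r| ≤ M.osc ρ u K := abs_true_sub_le_osc ρ u K i r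
  have hf : |F K j s * u K i r - M.area K j * (side s * (ρ K * u K j true * u K i true))| ≤
      5 * B ^ 5 * M.area K j * (M.osc ρ u K + h) := by
    have e : F K j s * u K i r - M.area K j * (side s * (ρ K * u K j true * u K i true)) =
        (F K j s - M.area K j * (side s * (ρ K * u K j true))) * u K i true -
          F K j s * (u K i true - u K i r) := by ring
    rw [e]
    have h1 : |(F K j s - M.area K j * (side s * (ρ K * u K j true))) * u K i true| ≤
        2 * B ^ 4 * M.area K j * (M.osc ρ u K + h) * B := by
      rw [abs_mul]
      have := S.velocity_le K i true
      gcongr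
    have h2 : |F K j s * (u K i true - u K i r)| ≤
        3 * B ^ 4 * M.area K j * (M.osc ρ u K + h) := by
      rw [abs_mul]; gcongr; linarith
    have h3 := abs_sub ((F K j s - M.area K j * (side s * (ρ K * u K j true))) * u K i true)
          (F K j s * (u K i true - u K i r))
    have h6 : 0 ≤ M.area K j * (M.osc ρ u K + h) := by positivity
    have h7 : 3 * B ^ 4 + 2 * B ^ 4 * B ≤ 5 * B ^ 5 := by
      have := pow_le_pow_right₀ hB (by norm_num : 4 ≤ 5)
      nlinarith
    have h8 := mul_le_mul_of_nonneg_right h7 h6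
    linarith
  have := abs_flux_mul_sub_le (side_mul_side s) ha.le (M.width_pos K j).le hB
    hh.le S.h_le_one (by linarith : h ≤ M.osc ρ u K + h) hf hep (S.abs_product_le K i j) hg
  rw [M.area_mul_width] at this
  have e' : F K j s / 2 * u K i r * (p - e) +
      M.vol K / 4 * (ρ K * u K j true * u K i true * g) =
      -(1 / 2) * (F K j s * u K i r * (e - p) -
      M.vol K / 2 * (ρ K * u K j true * u K i true * g)) := by ring
  rw [e', abs_mul]
  have hv := M.vol_pos K
  have h9 : (2 * B * (5 * B ^ 5) + B ^ 4) * (M.vol K * (M.osc ρ u K + h)) ≤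
      11 * B ^ 6 * (M.vol K * (M.osc ρ u K + h)) := by
    gcongr
    have := pow_le_pow_right₀ hB (by norm_num : 4 ≤ 6)
    linarith [show 2 * B * (5 * B ^ 5) = 10 * B ^ 6 by ring]
  have h10 : 0 ≤ B ^ 6 * (M.vol K * (M.osc ρ u K + h)) := by positivity
  rw [show |(-(1 / 2) : ℝ)| = 1 / 2 by norm_num [abs_of_neg]]
  linarith

/-- The lateral part of the weak form of the convection term of one time step. -/
lemma abs_lateral_step_le (S : StepBounds M δt B h η ρ ρ' u)
    (hreg : interior (closure Ω) = Ω) {i j : Fin d} (hij : j ≠ i)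
    {p : M.Cell → Bool → ℝ} {e : M.Cell → Bool → Bool → ℝ} {G : M.CellField}
    (hp₁ : ∀ K r L, M.nbr K i r = some L → p L (!r) = p K r)
    (he₁ : ∀ K r s L, M.nbr K i r = some L → e L (!r) s = e K r s)
    (he₂ : ∀ K r s L, M.nbr K j s = some L → e L r (!s) = e K r s)
    (he₃ : ∀ K r s, M.nbr K i r = none → e K r s = 0)
    (hep : ∀ K r s, |e K r s - p K r - side s * (M.width K j / 2 * G K)| ≤ B * h * M.width K j)
    (hG : ∀ K, |G K| ≤ B) :
    |(∑ s, M.sumFaces i (fun K L =>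
        upwind ((M.massFlux δt η ρ ρ' u K j s + M.massFlux δt η ρ ρ' u L j s) / 2) (u K i true)
          (M.sideVelocity u K L i j s) * p K true)) +
      ∑ K, M.vol K * (ρ K * u K j true * u K i true * G K)| ≤
      36 * B ^ 6 * ∑ K, M.vol K * (M.osc ρ u K + h) := by
  set F := M.massFlux δt η ρ ρ' u with hF
  have hB := S.one_le
  have hh := S.h_pos
  have hflux : M.IsFlux F := S.isFlux hreg
  have hzero := sum_lateral_eq_zero hreg (u := u) hflux hij he₁ he₂ he₃
  set up : Bool → M.Cell → M.Cell → ℝ := fun s K L =>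
    upwind ((F K j s + F L j s) / 2) (u K i true) (M.sideVelocity u K L i j s) with hup
  -- The centred part of half a lateral face, attributed to the cell that carries it. The upwind
  -- correction is estimated separately by `E`.
  let A : Bool → M.Cell → Bool → ℝ := fun s K r => F K j s / 2 * u K i r * (p K r - e K r s)
  let E : M.Cell → ℝ := fun K => 3 * B ^ 5 * (M.vol K * M.osc ρ u K)
  have hE : ∀ K, 0 ≤ E K := by
    intro K
    have := osc_nonneg ρ u K
    have := M.vol_pos K
    simp only [E]; positivity
  have hupw : ∀ s K L, M.nbr K i true = some L →
      |up s K L * p K true - up s K L * e K true s - (A s K true + A s L false)| ≤ E K + E L := by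
    intro s K L hL
    have hp' : p L false = p K true := hp₁ K true L hL
    have he' : e L false s = e K true s := he₁ K true s L hL
    have hu' : u L i false = u K i true := S.velocity_mem.1 K i true L hL
    have hw' : M.width L j = M.width K j := width_nbr hL hij
    have hw := M.width_pos K j
    have e1 : up s K L * p K true - up s K L * e K true s - (A s K true + A s L false) =
        (up s K L - (F K j s + F L j s) / 2 * u K i true) * (p K true - e K true s) := by
      simp only [A, hp', he', hu']; ring
    rw [e1, abs_mul]
    have h1 := abs_upwind_sub_le ((F K j s + F L j s) / 2) (u K i true)
      (M.sideVelocity u K L i j s)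
    have h2 : |p K true - e K true s| ≤ 2 * B * M.width K j := by
      rw [abs_sub_comm]
      exact abs_le_of_abs_sub_le hw.le hB S.h_le_one (hep K true s) (hG K)
    -- Each half flux is paired with the velocity jump seen from its own cell. If that half is
    -- external its flux vanishes, so no jump across a missing neighbour needs to be controlled.
    have hcase : ∀ X r, u X i r = u K i true →
        (∀ X', M.nbr X j s = some X' → M.sideVelocity u K L i j s = u X' i r) →
        |F X j s| * |u K i true - M.sideVelocity u K L i j s| ≤
          3 * B ^ 4 * M.area X j * M.osc ρ u X := by
      intro X r hXu hX
      have ho := osc_nonneg ρ u X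
      have ha := M.area_pos X j
      cases hn : M.nbr X j s with
      | none => rw [hflux.ext X j s hn, abs_zero, zero_mul]; positivity
      | some X' =>
        rw [hX X' hn, ← hXu, abs_sub_comm]
        have := velocity_sub_le_osc ρ u X i r hn
        have := S.abs_massFlux_le X j s
        gcongr
    have h3 := hcase K true rfl (fun K' hK' => sideVelocity_of_nbr_lower u hK')
    have h4 := hcase L false hu'
      (fun L' hL' => sideVelocity_of_nbr_upper hreg hij S.velocity_mem.1 hL hL')
    have h5 : |(F K j s + F L j s) / 2| ≤ (|F K j s| + |F L j s|) / 2 := by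
      rw [abs_div, abs_two]
      gcongr
      exact abs_add_le _ _
    calc _ ≤ ((|F K j s| + |F L j s|) / 2 * |u K i true - M.sideVelocity u K L i j s|) *
          (2 * B * M.width K j) := by
          gcongr
          exact h1.trans (by gcongr)
      _ ≤ ((3 * B ^ 4 * M.area K j * M.osc ρ u K + 3 * B ^ 4 * M.area L j * M.osc ρ u L) / 2) *
          (2 * B * M.width K j) := by
          gcongr
          linarith
      _ = 3 * B ^ 5 * ((M.area K j * M.width K j) * M.osc ρ u K) +
          3 * B ^ 5 * ((M.area L j * M.width L j) * M.osc ρ u L) := by rw [hw']; ring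
      _ = _ := by simp only [E, M.area_mul_width]
  have hA : ∀ s, M.sumFaces i (fun K L => A s K true + A s L false) = ∑ K, ∑ r, A s K r := by
    intro s
    apply sumFaces_eq hreg
    intro K r hn
    simp [A, S.velocity_mem.2 K i r hn]
  have hAsum : |∑ s, ∑ K, ∑ r, (A s K r + M.vol K / 4 * (ρ K * u K j true * u K i true * G K))| ≤
      24 * B ^ 6 * ∑ K, M.vol K * (M.osc ρ u K + h) := by
    have : ∀ s, |∑ K, ∑ r, (A s K r + M.vol K / 4 * (ρ K * u K j true * u K i true * G K))| ≤
        12 * B ^ 6 * ∑ K, M.vol K * (M.osc ρ u K + h) := by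
      intro s
      rw [Finset.mul_sum]
      refine (Finset.abs_sum_le_sum_abs _ _).trans (Finset.sum_le_sum fun K _ => ?_)
      refine (Finset.abs_sum_le_sum_abs _ _).trans ?_
      have h1 := fun r => S.abs_lateral_half_le K i j r s (hep K r s) (hG K)
      rw [Fintype.sum_bool]
      simp only [A]
      linarith [h1 true, h1 false]
    rw [Fintype.sum_bool]
    refine (abs_add_le _ _).trans ?_
    linarith [this true, this false]
  have hEsum : ∀ s, |M.sumFaces i (fun K L =>
      up s K L * p K true - up s K L * e K true s - (A s K true + A s L false))| ≤
      6 * B ^ 6 * ∑ K, M.vol K * (M.osc ρ u K + h) := by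
    intro s
    refine (abs_sumFaces_le (hupw s)).trans ((sumFaces_le_two_mul_sum hreg i hE).trans ?_)
    simp only [E]
    rw [← Finset.mul_sum]
    have : ∀ K, 0 ≤ M.vol K * (M.osc ρ u K + h) := fun K => by
      have := osc_nonneg ρ u K
      have := M.vol_pos K
      positivity
    have hle : ∑ K, M.vol K * M.osc ρ u K ≤ ∑ K, M.vol K * (M.osc ρ u K + h) := by
      refine Finset.sum_le_sum fun K _ => ?_
      have := M.vol_pos K
      gcongr
      linarith
    have hpow := pow_le_pow_right₀ hB (by norm_num : 5 ≤ 6)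
    have : 0 ≤ ∑ K, M.vol K * M.osc ρ u K := Finset.sum_nonneg fun K _ =>
      mul_nonneg (M.vol_pos K).le (osc_nonneg ρ u K)
    have := mul_le_mul hpow hle this (by positivity)
    linarith
  -- The edge values are inserted at no cost by `hzero`. The volume term is split into quarters
  -- according to the two lateral sides `s` and the two halves `r` of the cell.
  have e2 : (∑ s, M.sumFaces i (fun K L => up s K L * p K true)) +
      ∑ K, M.vol K * (ρ K * u K j true * u K i true * G K) =
      (∑ s, M.sumFaces i (fun K L =>
        up s K L * p K true - up s K L * e K true s - (A s K true + A s L false))) +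
      ∑ s, ∑ K, ∑ r, (A s K r + M.vol K / 4 * (ρ K * u K j true * u K i true * G K)) := by
    simp only [sumFaces_sub, Finset.sum_sub_distrib, hA, Finset.sum_add_distrib, hup] at hzero ⊢
    rw [hzero]
    have : ∑ _s : Bool, ∑ K, ∑ _r : Bool,
        M.vol K / 4 * (ρ K * u K j true * u K i true * G K) =
        ∑ K, M.vol K * (ρ K * u K j true * u K i true * G K) := by
      simp only [Fintype.sum_bool, ← Finset.sum_add_distrib]
      refine Finset.sum_congr rfl fun K _ => ?_
      ring
    rw [this]
    ring
  have e3 : (∑ s, M.sumFaces i (fun K L =>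
        upwind ((F K j s + F L j s) / 2) (u K i true)
          (M.sideVelocity u K L i j s) * p K true)) =
      ∑ s, M.sumFaces i (fun K L => up s K L * p K true) := rfl
  rw [e3, e2]
  refine (abs_add_le _ _).trans ?_
  have h7 : |∑ s, M.sumFaces i (fun K L =>
        up s K L * p K true - up s K L * e K true s - (A s K true + A s L false))| ≤
      12 * B ^ 6 * ∑ K, M.vol K * (M.osc ρ u K + h) := by
    rw [Fintype.sum_bool]
    refine (abs_add_le _ _).trans ?_
    linarith [hEsum true, hEsum false]
  linarith

/-- The weak form of the convection term of one time step. -/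
lemma abs_convection_step_le (S : StepBounds M δt B h η ρ ρ' u)
    (hreg : interior (closure Ω) = Ω) {i : Fin d} {c : M.CellField}
    {p : M.Cell → Bool → ℝ} {e : M.Cell → Bool → Fin d → Bool → ℝ} {G : M.Cell → Fin d → ℝ}
    (hp₁ : ∀ K r L, M.nbr K i r = some L → p L (!r) = p K r)
    (hp₃ : ∀ K r, M.nbr K i r = none → p K r = 0)
    (he₁ : ∀ K r j s L, j ≠ i → M.nbr K i r = some L → e L (!r) j s = e K r j s)
    (he₂ : ∀ K r j s L, j ≠ i → M.nbr K j s = some L → e L r j (!s) = e K r j s)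
    (he₃ : ∀ K r j s, j ≠ i → M.nbr K i r = none → e K r j s = 0)
    (hpc : ∀ K s, |p K s - c K - side s * (M.width K i / 2 * G K i)| ≤ B * h * M.width K i)
    (hep : ∀ K r j s, j ≠ i →
      |e K r j s - p K r - side s * (M.width K j / 2 * G K j)| ≤ B * h * M.width K j)
    (hG : ∀ K j, |G K j| ≤ B) :
    |M.sumFaces i (fun K L => M.convection (M.massFlux δt η ρ ρ' u) u K L i * p K true) +
      ∑ K, ∑ j, M.vol K * (ρ K * u K j true * u K i true * G K j)| ≤
      36 * d * B ^ 6 * ∑ K, M.vol K * (M.osc ρ u K + h) := by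
  set F := M.massFlux δt η ρ ρ' u with hF
  have hB := S.one_le
  have hh := S.h_pos
  -- The mid-section of `K` is common to the dual cells of its two faces, so its contributions
  -- cancel when summed over the sides; this permits subtracting `c K` from the test values.
  let A : M.Cell → Bool → ℝ := fun K s =>
    upwind ((F K i (!s) - F K i s) / 2) (u K i s) (u K i (!s))
  have hAsymm : ∀ K, A K true + A K false = 0 := by
    intro K
    have : (F K i true - F K i false) / 2 = -((F K i false - F K i true) / 2) := by ring
    simp only [A, Bool.not_true, Bool.not_false, this, upwind_neg]
    ring
  have hconv : M.sumFaces i (fun K L => M.convection F u K L i * p K true) =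
      (∑ K, ∑ s, A K s * p K s) +
      ∑ j ∈ Finset.univ.erase i, ∑ s, M.sumFaces i (fun K L =>
        upwind ((F K j s + F L j s) / 2) (u K i true) (M.sideVelocity u K L i j s) * p K true) := by
    rw [← sumFaces_eq hreg i (fun K s => A K s * p K s) (fun K s hn => by simp [hp₃ K s hn])]
    have e1 : ∑ j ∈ Finset.univ.erase i, ∑ s, M.sumFaces i (fun K L =>
        upwind ((F K j s + F L j s) / 2) (u K i true) (M.sideVelocity u K L i j s) * p K true) =
        M.sumFaces i (fun K L => (∑ j ∈ Finset.univ.erase i, ∑ s,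
          upwind ((F K j s + F L j s) / 2) (u K i true) (M.sideVelocity u K L i j s)) *
            p K true) := by
      unfold sumFaces
      rw [Finset.sum_congr rfl fun j _ => Finset.sum_comm, Finset.sum_comm]
      refine Finset.sum_congr rfl fun K _ => ?_
      cases M.nbr K i true <;> simp only [Option.elim_some, Option.elim_none,
        Finset.sum_const_zero, Finset.sum_mul]
    rw [e1, ← sumFaces_add]
    apply sumFaces_congr
    intro K L hL
    have hu' : u L i false = u K i true := S.velocity_mem.1 K i true L hL
    have hp' : p L false = p K true := hp₁ K true L hL
    simp only [convection, A, Bool.not_true, Bool.not_false, hu', hp']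
    ring
  have hmid : |(∑ K, ∑ s, A K s * p K s) +
      ∑ K, M.vol K * (ρ K * u K i true * u K i true * G K i)| ≤
      26 * B ^ 6 * ∑ K, M.vol K * (M.osc ρ u K + h) := by
    rw [← Finset.sum_add_distrib, Finset.mul_sum]
    refine (Finset.abs_sum_le_sum_abs _ _).trans (Finset.sum_le_sum fun K _ => ?_)
    have h1 := fun s => S.abs_mid_step_le K i s (hpc K s) (hG K i)
    have e1 : (∑ s, A K s * p K s) + M.vol K * (ρ K * u K i true * u K i true * G K i) =
        (A K true * (p K true - c K) + M.vol K / 2 * (ρ K * u K i true * u K i true * G K i)) +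
        (A K false * (p K false - c K) +
          M.vol K / 2 * (ρ K * u K i true * u K i true * G K i)) := by
      rw [Fintype.sum_bool]
      linear_combination c K * hAsymm K
    rw [e1]
    refine (abs_add_le _ _).trans ?_
    have h2 := h1 true
    have h3 := h1 false
    simp only [A]
    linarith
  have hlat : ∀ j ∈ Finset.univ.erase i, |(∑ s, M.sumFaces i (fun K L =>
        upwind ((F K j s + F L j s) / 2) (u K i true)
          (M.sideVelocity u K L i j s) * p K true)) +
      ∑ K, M.vol K * (ρ K * u K j true * u K i true * G K j)| ≤
      36 * B ^ 6 * ∑ K, M.vol K * (M.osc ρ u K + h) := by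
    intro j hj
    have hij := Finset.ne_of_mem_erase hj
    exact S.abs_lateral_step_le hreg hij (e := fun K r s => e K r j s) (G := fun K => G K j) hp₁
      (fun K r s L => he₁ K r j s L hij)
      (fun K r s L => he₂ K r j s L hij) (fun K r s => he₃ K r j s hij)
      (fun K r s => hep K r j s hij) (fun K => hG K j)
  have e2 : ∑ K, ∑ j, M.vol K * (ρ K * u K j true * u K i true * G K j) =
      (∑ K, M.vol K * (ρ K * u K i true * u K i true * G K i)) +
      ∑ j ∈ Finset.univ.erase i, ∑ K, M.vol K * (ρ K * u K j true * u K i true * G K j) := by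
    rw [Finset.sum_comm]
    exact (Finset.add_sum_erase _ (fun j => ∑ K, M.vol K * (ρ K * u K j true * u K i true * G K j))
      (Finset.mem_univ i)).symm
  rw [hconv, e2, add_add_add_comm]
  refine (abs_add_le _ _).trans ?_
  have h3 := (Finset.abs_sum_le_sum_abs _ _).trans (Finset.sum_le_sum hlat)
  -- The mid-sections cost 26 and each of the `d - 1` lateral directions costs 36, altogether at
  -- most `36 * d`.
  rw [Finset.sum_add_distrib, Finset.sum_const, Finset.card_erase_of_mem (Finset.mem_univ i), Finset.card_univ,
    Fintype.card_fin, nsmul_eq_mul] at h3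
  have hd : 1 ≤ d := i.pos
  rw [Nat.cast_sub hd, Nat.cast_one] at h3
  have h5 : 0 ≤ B ^ 6 * ∑ K, M.vol K * (M.osc ρ u K + h) := by
    have : ∀ K ∈ Finset.univ, 0 ≤ M.vol K * (M.osc ρ u K + h) := fun K _ => by
      have := osc_nonneg ρ u K
      have := M.vol_pos K
      positivity
    have := Finset.sum_nonneg this
    positivity
  linarith

end StepBounds

end MACMesh

namespace MACMesh

variable {d : ℕ} {Ω : Set (Fin d → ℝ)} {M : MACMesh d Ω}

/-! ## One time step of the momentum balance -/

/-- Summation by parts. -/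
lemma sumFaces_area_mul_sub (hreg : interior (closure Ω) = Ω) {i : Fin d} (q : M.CellField)
    {p : M.Cell → Bool → ℝ} (hp₁ : ∀ K r L, M.nbr K i r = some L → p L (!r) = p K r)
    (hp₃ : ∀ K r, M.nbr K i r = none → p K r = 0) :
    M.sumFaces i (fun K L => M.area K i * (q L - q K) * p K true) =
      -∑ K, q K * (M.area K i * (p K true - p K false)) := by
  have h := sumFaces_eq hreg i (fun K s => -(q K * (M.area K i * (side s * p K s))))
    (fun K s hn => by simp [hp₃ K s hn])
  have h1 : M.sumFaces i (fun K L => M.area K i * (q L - q K) * p K true) =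
      M.sumFaces i (fun K L => -(q K * (M.area K i * (side true * p K true))) +
        -(q L * (M.area L i * (side false * p L false)))) := by
    apply sumFaces_congr
    intro K L hL
    rw [area_nbr hL, show p L false = p K true from hp₁ K true L hL]
    simp only [side, if_true, Bool.false_eq_true, if_false]
    ring
  rw [h1, h, ← Finset.sum_neg_distrib]
  refine Finset.sum_congr rfl fun K _ => ?_
  simp only [Fintype.sum_bool, side, if_true, Bool.false_eq_true, if_false]
  ring

/-- The sum of `|σ| |ρ_L - ρ_K|` over the internal faces. -/
def bvSum (M : MACMesh d Ω) (ρ : M.CellField) : ℝ :=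
  ∑ i, M.sumFaces i fun K L => M.area K i * |ρ L - ρ K|

lemma sumFaces_nonneg {i : Fin d} {f : M.Cell → M.Cell → ℝ} (hf : ∀ K L, 0 ≤ f K L) :
    0 ≤ M.sumFaces i f := by
  refine Finset.sum_nonneg fun K _ => ?_
  cases M.nbr K i true <;> simp [hf]

lemma sumFaces_le_bvSum (ρ : M.CellField) (i : Fin d) :
    M.sumFaces i (fun K L => M.area K i * |ρ L - ρ K|) ≤ M.bvSum ρ :=
  Finset.single_le_sum (f := fun i => M.sumFaces i fun K L => M.area K i * |ρ L - ρ K|)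
    (fun i _ => sumFaces_nonneg fun K _ => mul_nonneg (M.area_pos K i).le (abs_nonneg _))
    (Finset.mem_univ i)

lemma bvSum_nonneg (ρ : M.CellField) : 0 ≤ M.bvSum ρ :=
  Finset.sum_nonneg fun i _ => sumFaces_nonneg fun K _ =>
    mul_nonneg (M.area_pos K i).le (abs_nonneg _)

namespace StepBounds

variable {δt B h : ℝ} {η : M.FaceField} {ρ ρ' : M.CellField} {u : M.FaceField}

/-- The mass balance expresses the increment as `δt / |K|` times the sum of the fluxes. The first
factor is bounded and each flux is of the order of an area, hence at most a multiple of `h`. No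
regularity of the density in time is needed. -/
lemma abs_density_sub_le (S : StepBounds M δt B h η ρ ρ' u)
    (hmass : ∀ K, (ρ' K - ρ K) / δt +
      (∑ i, ∑ s, M.massFlux δt η ρ ρ' u K i s) / M.vol K = 0) (K : M.Cell) :
    |ρ' K - ρ K| ≤ 6 * d * B ^ 5 * h := by
  have hB := S.one_le
  have hδ := S.δt_pos
  have hv := M.vol_pos K
  have h1 : ρ' K - ρ K = -(δt / M.vol K * ∑ i, ∑ s, M.massFlux δt η ρ ρ' u K i s) := by
    have := hmass K
    field_simp at this ⊢
    linarith
  have h2 : |∑ i, ∑ s, M.massFlux δt η ρ ρ' u K i s| ≤ d * (6 * B ^ 4 * h) := by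
    refine (Finset.abs_sum_le_sum_abs _ _).trans ?_
    have : ∀ i ∈ Finset.univ, |∑ s, M.massFlux δt η ρ ρ' u K i s| ≤ 6 * B ^ 4 * h := by
      intro i _
      rw [Fintype.sum_bool]
      refine (abs_add_le _ _).trans ?_
      have h3 := S.abs_massFlux_le K i true
      have h4 := S.abs_massFlux_le K i false
      have h5 : 3 * B ^ 4 * M.area K i ≤ 3 * B ^ 4 * h := by
        have := S.area_le K i
        gcongr
      linarith
    refine (Finset.sum_le_sum this).trans ?_
    simp
  have h3 : δt / M.vol K ≤ B := by
    rw [div_le_iff₀ hv]; exact S.δt_le_vol K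
  rw [h1, abs_neg, abs_mul, abs_of_pos (div_pos hδ hv)]
  calc _ ≤ B * (d * (6 * B ^ 4 * h)) := by gcongr
    _ = _ := by ring

/-- As for the density increment: dividing `δt` by the cell volume leaves a constant, and the areas
supply the factor `h`. -/
lemma abs_div_le (S : StepBounds M δt B h η ρ ρ' u)
    (K : M.Cell) : δt * |M.div u K| ≤ 2 * d * B ^ 2 * h := by
  have hB := S.one_le
  have hδ := S.δt_pos
  have hv := M.vol_pos K
  have h2 : |∑ i, ∑ s, M.area K i * (u K i s * side s)| ≤ d * (2 * (h * B)) := by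
    refine (Finset.abs_sum_le_sum_abs _ _).trans ?_
    have : ∀ i ∈ Finset.univ, |∑ s, M.area K i * (u K i s * side s)| ≤ 2 * (h * B) := by
      intro i _
      have h3 : ∀ s, |M.area K i * (u K i s * side s)| ≤ h * B := by
        intro s
        rw [abs_mul, abs_mul, abs_side, mul_one, abs_of_pos (M.area_pos K i)]
        have := S.area_le K i
        have := S.velocity_le K i s
        have := S.h_pos
        gcongr
      rw [Fintype.sum_bool]
      refine (abs_add_le _ _).trans ?_
      linarith [h3 true, h3 false]
    refine (Finset.sum_le_sum this).trans ?_
    simp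
  have h3 : δt / M.vol K ≤ B := by
    rw [div_le_iff₀ hv]; exact S.δt_le_vol K
  unfold div
  rw [abs_div, abs_of_pos hv]
  calc δt * (|∑ i, ∑ s, M.area K i * (u K i s * side s)| / M.vol K)
      = δt / M.vol K * |∑ i, ∑ s, M.area K i * (u K i s * side s)| := by ring
    _ ≤ B * (d * (2 * (h * B))) := by gcongr
    _ = _ := by ring

/-- The weak form of one time step of the momentum balance. -/
lemma abs_momentum_step_le (S : StepBounds M δt B h η ρ ρ' u)
    (hreg : interior (closure Ω) = Ω) {i : Fin d} {u' : M.FaceField}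
    (hu' : M.IsFaceField u')
    (hmass : ∀ K, (ρ' K - ρ K) / δt +
      (∑ i, ∑ s, M.massFlux δt η ρ ρ' u K i s) / M.vol K = 0)
    (hmom : ∀ K L, M.nbr K i true = some L →
      (M.dualAvg ρ' K i true * u' K i true - M.dualAvg ρ K i true * u K i true) / δt +
      M.convection (M.massFlux δt η ρ ρ' u) u K L i / M.dualVol K i true +
      (M.grad ρ' K i true - (M.faceDensity ρ' K i true - M.faceDensity ρ K i true) *
          M.grad (fun J => Real.log (ρ' J)) K i true -
        δt * M.grad (M.div u) K i true) = 0)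
    {c : M.CellField} {p : M.Cell → Bool → ℝ} {e : M.Cell → Bool → Fin d → Bool → ℝ}
    {G : M.Cell → Fin d → ℝ}
    (hp₁ : ∀ K r L, M.nbr K i r = some L → p L (!r) = p K r)
    (hp₃ : ∀ K r, M.nbr K i r = none → p K r = 0)
    (he₁ : ∀ K r j s L, j ≠ i → M.nbr K i r = some L → e L (!r) j s = e K r j s)
    (he₂ : ∀ K r j s L, j ≠ i → M.nbr K j s = some L → e L r j (!s) = e K r j s)
    (he₃ : ∀ K r j s, j ≠ i → M.nbr K i r = none → e K r j s = 0)
    (hpc : ∀ K s, |p K s - c K - side s * (M.width K i / 2 * G K i)| ≤ B * h * M.width K i)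
    (hep : ∀ K r j s, j ≠ i →
      |e K r j s - p K r - side s * (M.width K j / 2 * G K j)| ≤ B * h * M.width K j)
    (hG : ∀ K j, |G K j| ≤ B) (hpB : ∀ K s, |p K s| ≤ B) :
    |(∑ K, ∑ s, M.vol K / 2 * (ρ' K * u' K i s - ρ K * u K i s) * p K s) -
        δt * ((∑ K, ∑ j, M.vol K * (ρ K * u K j true * u K i true * G K j)) +
          ∑ K, M.vol K * (ρ K * G K i))| ≤
      δt * (60 * d * B ^ 9 * ((∑ K, M.vol K * (M.osc ρ u K + h)) + h * M.bvSum ρ')) := by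
  have hB := S.one_le
  have hδ := S.δt_pos
  have hh := S.h_pos
  have hd : (1 : ℝ) ≤ d := by exact_mod_cast i.pos
  set V := ∑ K, M.vol K with hV
  set O := ∑ K, M.vol K * (M.osc ρ u K + h) with hO
  have hV0 : 0 ≤ V := Finset.sum_nonneg fun K _ => (M.vol_pos K).le
  have hVO : h * V ≤ O := by
    rw [hV, hO, Finset.mul_sum]
    refine Finset.sum_le_sum fun K _ => ?_
    nlinarith [M.vol_pos K, osc_nonneg ρ u K]
  have hpp : ∀ K, |M.area K i * (p K true - p K false) - M.vol K * G K i| ≤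
      2 * B * h * M.vol K := by
    intro K
    have h1 := hpc K true
    have h2 := hpc K false
    have e1 : M.area K i * (p K true - p K false) - M.vol K * G K i =
        M.area K i * ((p K true - c K - side true * (M.width K i / 2 * G K i)) -
          (p K false - c K - side false * (M.width K i / 2 * G K i))) := by
      rw [← M.area_mul_width K i]
      simp only [side, if_true, Bool.false_eq_true, if_false]
      ring
    rw [e1, abs_mul, abs_of_pos (M.area_pos K i), ← M.area_mul_width K i]
    have ha := M.area_pos K i
    calc _ ≤ M.area K i * (B * h * M.width K i + B * h * M.width K i) := by
          gcongr
          exact (abs_sub _ _).trans (add_le_add h1 h2)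
      _ = _ := by ring
  have hpp' : ∀ K, |M.area K i * (p K true - p K false)| ≤ 3 * B * M.vol K := by
    intro K
    have hv := M.vol_pos K
    have h1 : |M.vol K * G K i| ≤ M.vol K * B := by
      rw [abs_mul, abs_of_pos hv]; gcongr; exact hG K i
    have h2 := abs_add_le (M.area K i * (p K true - p K false) - M.vol K * G K i) (M.vol K * G K i)
    rw [sub_add_cancel] at h2
    have h3 : B * M.vol K * h ≤ B * M.vol K * 1 := by
      have := S.h_le_one
      gcongr
    linarith [hpp K]
  have hconv := S.abs_convection_step_le hreg hp₁ hp₃ he₁ he₂ he₃ hpc hep hG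
  rw [← hO] at hconv
  set Cv := M.sumFaces i (fun K L => M.convection (M.massFlux δt η ρ ρ' u) u K L i * p K true)
    with hCv
  -- After summation by parts the new density stands against the discrete derivative of the test
  -- function; replacing it by the old one costs only the increment of order `h`.
  have hpres : |M.sumFaces i (fun K L => M.area K i * (ρ' L - ρ' K) * p K true) +
      ∑ K, M.vol K * (ρ K * G K i)| ≤ (2 * B ^ 2 + 6 * d * B ^ 6) * (h * V) := by
    rw [sumFaces_area_mul_sub hreg ρ' hp₁ hp₃, neg_add_eq_sub, ← Finset.sum_sub_distrib, hV,
      Finset.mul_sum, Finset.mul_sum]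
    refine (Finset.abs_sum_le_sum_abs _ _).trans (Finset.sum_le_sum fun K _ => ?_)
    have e1 : M.vol K * (ρ K * G K i) - ρ' K * (M.area K i * (p K true - p K false)) =
        -((ρ' K - ρ K) * (M.vol K * G K i)) -
          ρ' K * (M.area K i * (p K true - p K false) - M.vol K * G K i) := by ring
    have hv := M.vol_pos K
    rw [e1]
    refine (abs_sub _ _).trans ?_
    rw [abs_neg, abs_mul, abs_mul, abs_mul, abs_of_pos hv]
    calc _ ≤ 6 * d * B ^ 5 * h * (M.vol K * B) + B * (2 * B * h * M.vol K) := by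
          have := S.abs_density_sub_le hmass K
          have := S.abs_density' K
          have := hG K i
          have := hpp K
          gcongr
      _ = _ := by ring
  -- A product of a time increment, of order `h`, and a jump of the logarithm, controlled by the
  -- density jump. Only here is the BV sum at the new time level needed.
  have hstab : |M.sumFaces i (fun K L =>
      M.area K i * (M.faceDensity ρ' K i true - M.faceDensity ρ K i true) *
        (Real.log (ρ' L) - Real.log (ρ' K)) * p K true)| ≤
      12 * d * B ^ 9 * (h * M.bvSum ρ') := by
    have h1 : 12 * d * B ^ 9 * (h * M.sumFaces i (fun K L => M.area K i * |ρ' L - ρ' K|)) ≤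
        12 * d * B ^ 9 * (h * M.bvSum ρ') := by
      have := sumFaces_le_bvSum ρ' i
      gcongr
    refine le_trans ?_ h1
    rw [← sumFaces_mul_left, ← sumFaces_mul_left]
    apply abs_sumFaces_le
    intro K L hL
    have ha := M.area_pos K i
    rw [faceDensity_of_nbr hL, faceDensity_of_nbr hL, abs_mul, abs_mul, abs_mul, abs_of_pos ha]
    have h2 := abs_logMean_sub_logMean_le (S.density_pos' K) (S.density_pos' L) (S.density_pos K)
      (S.density_pos L) (S.density_le' K) (S.density_le' L) (S.density_le K) (S.density_le L)
      (S.density_inv' K) (S.density_inv' L) (S.density_inv K) (S.density_inv L)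
    have h3 := abs_log_sub_log_le (S.density_pos' L) (S.density_pos' K) (S.density_inv' L)
      (S.density_inv' K)
    have h4 := S.abs_density_sub_le hmass K
    have h5 := S.abs_density_sub_le hmass L
    have h6 := hpB K true
    calc _ ≤ M.area K i * (B * (B * (6 * d * B ^ 5 * h) + B * (6 * d * B ^ 5 * h))) *
          (B * |ρ' L - ρ' K|) * B := by
          gcongr
          exact h2.trans (by gcongr)
      _ = _ := by ring
  -- The discrete gradient is moved to the test function, where it is bounded; the remaining `δt *
  -- M.div u K` is of order `h` in every cell.
  have hdiv : |δt * M.sumFaces i (fun K L => M.area K i * (M.div u L - M.div u K) * p K true)| ≤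
      6 * d * B ^ 3 * (h * V) := by
    rw [sumFaces_area_mul_sub hreg _ hp₁ hp₃, mul_neg, abs_neg, Finset.mul_sum, hV,
      Finset.mul_sum, Finset.mul_sum]
    refine (Finset.abs_sum_le_sum_abs _ _).trans (Finset.sum_le_sum fun K _ => ?_)
    rw [← mul_assoc, abs_mul, abs_mul, abs_of_pos hδ]
    have h1 := S.abs_div_le K
    have h2 := hpp' K
    calc _ ≤ (2 * d * B ^ 2 * h) * (3 * B * M.vol K) := by gcongr
      _ = _ := by ring
  set P := M.sumFaces i (fun K L => M.area K i * (ρ' L - ρ' K) * p K true) with hP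
  set St := M.sumFaces i (fun K L =>
      M.area K i * (M.faceDensity ρ' K i true - M.faceDensity ρ K i true) *
        (Real.log (ρ' L) - Real.log (ρ' K)) * p K true) with hSt
  set Dv := M.sumFaces i (fun K L => M.area K i * (M.div u L - M.div u K) * p K true) with hDv
  -- The momentum equation is multiplied by the dual volume and by the test value. Splitting the
  -- dual cell into its two halves yields the cellwise sum on the left; external faces contribute
  -- nothing since the test values vanish there.
  have hsum : (∑ K, ∑ s, M.vol K / 2 * (ρ' K * u' K i s - ρ K * u K i s) * p K s) =
      -(δt * (Cv + P - St - δt * Dv)) := by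
    rw [← sumFaces_eq hreg i
      (fun K s => M.vol K / 2 * (ρ' K * u' K i s - ρ K * u K i s) * p K s)
      (fun K s hn => by simp [hp₃ K s hn]), hCv, hP, hSt, hDv, ← sumFaces_mul_left, ← sumFaces_add,
      ← sumFaces_sub, ← sumFaces_sub, ← mul_neg, ← neg_one_mul, ← sumFaces_mul_left,
      ← sumFaces_mul_left]
    apply sumFaces_congr
    intro K L hL
    have hD := dualVol_pos K i true
    have h1 := hmom K L hL
    rw [grad_of_nbr hL, grad_of_nbr hL, grad_of_nbr hL, dualAvg_of_nbr hL, dualAvg_of_nbr hL] at h1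
    rw [show p L false = p K true from hp₁ K true L hL,
      show u' L i false = u' K i true from hu' K i true L hL,
      show u L i false = u K i true from S.velocity_mem.1 K i true L hL]
    simp only [side, if_true, mul_one] at h1
    field_simp at h1
    linear_combination (p K true) / 2 * h1
  rw [hsum]
  have e2 : -(δt * (Cv + P - St - δt * Dv)) -
      δt * ((∑ K, ∑ j, M.vol K * (ρ K * u K j true * u K i true * G K j)) +
          ∑ K, M.vol K * (ρ K * G K i)) =
      -(δt * ((Cv + ∑ K, ∑ j, M.vol K * (ρ K * u K j true * u K i true * G K j)) +
        (P + ∑ K, M.vol K * (ρ K * G K i)) - (St + δt * Dv))) := by ring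
  rw [e2, abs_neg, abs_mul, abs_of_pos hδ]
  gcongr
  refine (abs_sub _ _).trans ((add_le_add (abs_add_le _ _) (abs_add_le _ _)).trans ?_)
  have hBV := bvSum_nonneg ρ'
  have p2 : B ^ 2 ≤ B ^ 9 := pow_le_pow_right₀ hB (by norm_num)
  have p3 : B ^ 3 ≤ B ^ 9 := pow_le_pow_right₀ hB (by norm_num)
  have p6 : B ^ 6 ≤ B ^ 9 := pow_le_pow_right₀ hB (by norm_num)
  have hO0 : 0 ≤ O := le_trans (by positivity) hVO
  have hdB : B ^ 9 ≤ d * B ^ 9 := le_mul_of_one_le_left (by positivity) hd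
  -- Convection, pressure and divergence contribute 36, 8 and 6, which fits under the constant 60;
  -- the stabilisation is absorbed separately by the BV term.
  have q1 : 36 * d * B ^ 6 * O ≤ 36 * (d * B ^ 9) * O := by
    rw [mul_assoc 36]
    gcongr
  have q2 : (2 * B ^ 2 + 6 * d * B ^ 6) * (h * V) ≤ 8 * (d * B ^ 9) * O := by
    gcongr
    have : d * B ^ 6 ≤ d * B ^ 9 := by gcongr
    linarith
  have q3 : 6 * d * B ^ 3 * (h * V) ≤ 6 * (d * B ^ 9) * O := by
    rw [mul_assoc 6]
    gcongr
  have q4 : 12 * d * B ^ 9 * (h * M.bvSum ρ') ≤ 60 * d * B ^ 9 * (h * M.bvSum ρ') := by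
    gcongr
    norm_num
  have q5 : 0 ≤ d * B ^ 9 * O := by positivity
  linarith

end StepBounds

end MACMesh

/-! ## Test functions -/

/-- Bounds on a function and on its first order Taylor expansions. -/
structure TaylorBound {E : Type*} [NormedAddCommGroup E] [NormedSpace ℝ E] (f : E → ℝ) (B : ℝ) :
    Prop where
  abs_le : ∀ z, |f z| ≤ B
  fderiv_le : ∀ z v, |fderiv ℝ f z v| ≤ B * ‖v‖
  taylor : ∀ z x y r, ‖x - z‖ ≤ r → ‖y - z‖ ≤ r →
    |f y - f x - fderiv ℝ f z (y - x)| ≤ B * r * ‖y - x‖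

lemma TaylorBound.mono {E : Type*} [NormedAddCommGroup E] [NormedSpace ℝ E] {f : E → ℝ}
    {B B' : ℝ} (h : TaylorBound f B) (hB : B ≤ B') : TaylorBound f B' where
  abs_le z := (h.abs_le z).trans hB
  fderiv_le z v := (h.fderiv_le z v).trans (by gcongr)
  taylor z x y r hx hy := (h.taylor z x y r hx hy).trans (by
    have : 0 ≤ r := (norm_nonneg _).trans hx
    gcongr)

/-- The derivative is smooth with compact support, hence Lipschitz; on the ball around `z` it
differs from its value at `z` by at most the Lipschitz constant times `r`, and the mean value
inequality gives the expansion. -/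
lemma exists_taylorBound {E : Type*} [NormedAddCommGroup E] [NormedSpace ℝ E] {f : E → ℝ}
    (hf : ContDiff ℝ ∞ f) (hc : HasCompactSupport f) : ∃ B, TaylorBound f B := by
  obtain ⟨C₀, h₀⟩ := hf.continuous.bounded_above_of_compact_support hc
  obtain ⟨C₁, h₁⟩ := (hf.continuous_fderiv (by simp)).bounded_above_of_compact_support
    (hc.fderiv (𝕜 := ℝ))
  obtain ⟨C₂, h₂⟩ := ContDiff.lipschitzWith_of_hasCompactSupport (hc.fderiv (𝕜 := ℝ))
    (hf.fderiv_right (m := ∞) (by rfl)) (by simp)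
  refine ⟨max C₀ (max C₁ C₂), fun z => ?_, fun z v => ?_, fun z x y r hx hy => ?_⟩
  · exact (h₀ z).trans (le_max_left _ _)
  · refine ((fderiv ℝ f z).le_opNorm v).trans ?_
    gcongr
    exact (h₁ z).trans ((le_max_left _ _).trans (le_max_right _ _))
  · have hr : 0 ≤ r := (norm_nonneg _).trans hx
    have hconv : Convex ℝ (Metric.closedBall z r) := convex_closedBall z r
    have hder : ∀ w ∈ Metric.closedBall z r,
        HasFDerivWithinAt f (fderiv ℝ f w) (Metric.closedBall z r) w := fun w _ =>
      ((hf.differentiable (by simp)) w).hasFDerivAt.hasFDerivWithinAt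
    have hbound : ∀ w ∈ Metric.closedBall z r, ‖fderiv ℝ f w - fderiv ℝ f z‖ ≤ C₂ * r := by
      intro w hw
      rw [← dist_eq_norm]
      refine (h₂.dist_le_mul w z).trans ?_
      gcongr
      exact hw
    have := hconv.norm_image_sub_le_of_norm_hasFDerivWithin_le' hder hbound
      (by simpa [dist_eq_norm] using hx) (by simpa [dist_eq_norm] using hy)
    rw [← Real.norm_eq_abs]
    refine this.trans ?_
    gcongr
    exact (le_max_right _ _).trans (le_max_right _ _)

lemma IsTestFunction.eq_zero {d : ℕ} {T : ℝ} {ψ : ℝ × (Fin d → ℝ) → ℝ} (hψ : IsTestFunction T ψ)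
    (x : Fin d → ℝ) : ψ (T, x) = 0 := by
  by_contra h
  have := hψ.support (subset_tsupport ψ h)
  simp at this

/-- Abel summation. -/
lemma sum_range_sub_mul (a b : ℕ → ℝ) (N : ℕ) :
    ∑ n ∈ Finset.range N, (a (n + 1) - a n) * b (n + 1) =
      a N * b N - a 0 * b 0 - ∑ n ∈ Finset.range N, a n * (b (n + 1) - b n) := by
  induction N with
  | zero => simp
  | succ N ih => rw [Finset.sum_range_succ, Finset.sum_range_succ, ih]; ring

namespace MACMesh

variable {d : ℕ} {Ω : Set (Fin d → ℝ)} {M : MACMesh d Ω}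

section sampling

variable {ψ : ℝ × (Fin d → ℝ) → ℝ} {B h δt t : ℝ}

lemma norm_prod_sub_le {t t' : ℝ} {x y : Fin d → ℝ} (hh : 0 ≤ h) (ht : |t' - t| ≤ h)
    (hx : ∀ j, |y j - x j| ≤ h) : ‖(t', y) - (t, x)‖ ≤ h := by
  rw [Prod.mk_sub_mk, Prod.norm_def]
  exact max_le ht ((pi_norm_le_iff_of_nonneg hh).2 fun j => hx j)

lemma abs_faceCenter_sub_le (hw : ∀ K i, M.width K i ≤ h) (hh : 0 ≤ h) (K : M.Cell) (i : Fin d)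
    (s : Bool) (j : Fin d) : |M.faceCenter K i s j - M.center K j| ≤ h := by
  have h1 := congrFun (M.faceCenter_sub_center K i s) j
  rw [Pi.sub_apply] at h1
  rw [h1]
  by_cases hj : j = i
  · subst hj
    have h2 := M.width_pos K j
    rw [Pi.single_eq_same, abs_mul, abs_side, one_mul, abs_of_pos (by linarith)]
    linarith [hw K j]
  · simpa [hj] using hh

lemma abs_edgeCenter_sub_le (hw : ∀ K i, M.width K i ≤ h) (hh : 0 ≤ h) (K : M.Cell) (i : Fin d)
    (r : Bool) (j : Fin d) (s : Bool) (k : Fin d) :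
    |M.edgeCenter K i r j s k - M.center K k| ≤ h := by
  by_cases hk : k = j
  · subst hk
    have h2 := M.width_pos K k
    rw [edgeCenter, Function.update_self, faceCoord_sub_center, abs_mul, abs_side, one_mul,
      abs_of_pos (by linarith)]
    linarith [hw K k]
  · rw [edgeCenter, Function.update_of_ne hk]
    exact abs_faceCenter_sub_le hw hh K i r k

/-- The difference is taken between two points at a time `t'`, the derivative at a third point and
another time `t`. This freedom is needed because test values live at the new time level on faces and
edges, while the Riemann sums use the old level and the cell centres. -/
lemma abs_sub_of_single (hψ : TaylorBound ψ B) (hB : 0 ≤ B) (hh : 0 ≤ h) {t t' : ℝ}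
    (ht : |t' - t| ≤ h) {x y y' : Fin d → ℝ} (hy : ∀ k, |y k - x k| ≤ h)
    (hy' : ∀ k, |y' k - x k| ≤ h) {i : Fin d} {s : Bool} {w : ℝ} (hw : 0 ≤ w)
    (hyy : y' - y = Pi.single i (side s * (w / 2))) :
    |ψ (t', y') - ψ (t', y) - side s * (w / 2 * dx i ψ (t, x))| ≤ B * h * w := by
  have h1 := hψ.taylor (t, x) (t', y) (t', y') h (norm_prod_sub_le hh ht hy)
    (norm_prod_sub_le hh ht hy')
  have e1 : ((t', y') : ℝ × (Fin d → ℝ)) - (t', y) =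
      (side s * (w / 2)) • ((0, Pi.single i 1) : ℝ × (Fin d → ℝ)) := by
    rw [Prod.mk_sub_mk, sub_self, hyy, Prod.smul_mk, smul_zero]
    congr 1
    rw [← Pi.single_smul, smul_eq_mul, mul_one]
  have e2 : ‖((t', y') : ℝ × (Fin d → ℝ)) - (t', y)‖ ≤ w := by
    rw [e1, norm_smul, Real.norm_eq_abs, abs_mul, abs_side, abs_of_nonneg (by linarith)]
    have : ‖((0, Pi.single i 1) : ℝ × (Fin d → ℝ))‖ ≤ 1 := by
      rw [Prod.norm_def, Pi.norm_single]
      simp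
    nlinarith
  rw [e1, map_smul, smul_eq_mul, ← e1] at h1
  rw [← mul_assoc]
  refine h1.trans ?_
  gcongr

lemma abs_time_sub_le (hψ : TaylorBound ψ B) (hB : 0 ≤ B) (hδ : 0 ≤ δt) (hδh : δt ≤ h)
    {x y : Fin d → ℝ} (hy : ∀ k, |y k - x k| ≤ h) :
    |ψ (t + δt, y) - ψ (t, y) - δt * dt ψ (t, x)| ≤ B * h * δt := by
  have hh : 0 ≤ h := hδ.trans hδh
  have h1 := hψ.taylor (t, x) (t, y) (t + δt, y) h (norm_prod_sub_le hh (by simpa using hh) hy)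
    (norm_prod_sub_le hh (by simpa [abs_of_nonneg hδ] using hδh) hy)
  have e1 : ((t + δt, y) : ℝ × (Fin d → ℝ)) - (t, y) = δt • ((1, 0) : ℝ × (Fin d → ℝ)) := by
    simp [Prod.mk_sub_mk]
  have e2 : ‖((t + δt, y) : ℝ × (Fin d → ℝ)) - (t, y)‖ ≤ δt := by
    rw [e1, norm_smul, Real.norm_eq_abs, abs_of_nonneg hδ]
    simp [Prod.norm_def]
  rw [e1, map_smul, smul_eq_mul, ← e1] at h1
  refine h1.trans ?_
  gcongr

lemma abs_dx_le (hψ : TaylorBound ψ B) (i : Fin d) (z : ℝ × (Fin d → ℝ)) : |dx i ψ z| ≤ B := by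
  have := hψ.fderiv_le z (0, Pi.single i 1)
  rw [Prod.norm_def, Pi.norm_single] at this
  simpa [dx] using this

lemma abs_dt_le (hψ : TaylorBound ψ B) (z : ℝ × (Fin d → ℝ)) : |dt ψ z| ≤ B := by
  have := hψ.fderiv_le z (1, 0)
  rw [Prod.norm_def] at this
  simpa [dt] using this

end sampling

/-! ## The weak form of the scheme -/

/-- The total consistency error. -/
def totalError (M : MACMesh d Ω) (δt h : ℝ) (N : ℕ) (ρ : ℕ → M.CellField) (u : ℕ → M.FaceField) :
    ℝ :=
  ∑ n ∈ Finset.range N,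
    δt * ((∑ K, M.vol K * (M.osc (ρ n) (u n) K + h)) + h * M.bvSum (ρ (n + 1)))

section weak

variable {δt B h T : ℝ} {N : ℕ} {ρ₀ : (Fin d → ℝ) → ℝ} {u₀ : (Fin d → ℝ) → Fin d → ℝ}
  {η : ℕ → M.FaceField} {ρ : ℕ → M.CellField} {u : ℕ → M.FaceField}

/-- Abel summation in time moves the increment onto the test function, and the mass balance replaces
the density increment by the fluxes. The error consists of the flux consistency error of each step
and the Taylor error in time. -/
lemma abs_weak_mass_le (hreg : interior (closure Ω) = Ω) (hT : N * δt = T)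
    (hsol : M.IsSchemeSolution δt N ρ₀ u₀ η ρ u)
    (S : ∀ n < N, StepBounds M δt B h (η n) (ρ n) (ρ (n + 1)) (u n))
    {ψ : ℝ × (Fin d → ℝ) → ℝ} (hψ : IsTestFunction T ψ) (hψB : TaylorBound ψ B) :
    |(∑ n ∈ Finset.range N, δt * ∑ K, M.vol K *
        (ρ n K * dt ψ (n * δt, M.center K) +
          ∑ i, ρ n K * u n K i true * dx i ψ (n * δt, M.center K))) +
      ∑ K, M.vol K * (ρ 0 K * ψ (0, M.center K))| ≤
      11 * (d + 1) * B ^ 5 * M.totalError δt h N ρ u := by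
  have habel : ∀ K, ∑ n ∈ Finset.range N,
      (ρ (n + 1) K - ρ n K) * ψ ((n + 1 : ℕ) * δt, M.center K) =
      -(ρ 0 K * ψ (0, M.center K)) - ∑ n ∈ Finset.range N, ρ n K *
        (ψ ((n + 1 : ℕ) * δt, M.center K) - ψ (n * δt, M.center K)) := by
    intro K
    have := sum_range_sub_mul (fun n => ρ n K) (fun n => ψ (n * δt, M.center K)) N
    simp only [hT, hψ.eq_zero] at this
    rw [this]
    simp
  have e1 : (∑ n ∈ Finset.range N, δt * ∑ K, M.vol K *
        (ρ n K * dt ψ (n * δt, M.center K) +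
          ∑ i, ρ n K * u n K i true * dx i ψ (n * δt, M.center K))) +
      ∑ K, M.vol K * (ρ 0 K * ψ (0, M.center K)) =
      ∑ n ∈ Finset.range N, ((δt * ∑ K, ∑ i, M.vol K *
          (ρ n K * u n K i true * dx i ψ (n * δt, M.center K))) -
        (∑ K, M.vol K * ((ρ (n + 1) K - ρ n K) * ψ ((n + 1 : ℕ) * δt, M.center K))) -
        ∑ K, M.vol K * (ρ n K * (ψ ((n + 1 : ℕ) * δt, M.center K) - ψ (n * δt, M.center K) -
          δt * dt ψ (n * δt, M.center K)))) := by
    have e2 : ∑ n ∈ Finset.range N,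
        (∑ K, M.vol K * ((ρ (n + 1) K - ρ n K) * ψ ((n + 1 : ℕ) * δt, M.center K))) =
        -(∑ K, M.vol K * (ρ 0 K * ψ (0, M.center K))) - ∑ n ∈ Finset.range N, ∑ K, M.vol K *
          (ρ n K * (ψ ((n + 1 : ℕ) * δt, M.center K) - ψ (n * δt, M.center K))) := by
      rw [Finset.sum_comm, Finset.sum_comm (s := Finset.range N), ← Finset.sum_neg_distrib,
        ← Finset.sum_sub_distrib]
      refine Finset.sum_congr rfl fun K _ => ?_
      rw [← Finset.mul_sum, habel K, ← Finset.mul_sum]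
      ring
    have e3 : ∀ n ∈ Finset.range N, δt * ∑ K, M.vol K *
        (ρ n K * dt ψ (n * δt, M.center K) +
          ∑ i, ρ n K * u n K i true * dx i ψ (n * δt, M.center K)) =
        (δt * ∑ K, ∑ i, M.vol K * (ρ n K * u n K i true * dx i ψ (n * δt, M.center K))) +
        ((∑ K, M.vol K * (ρ n K * (ψ ((n + 1 : ℕ) * δt, M.center K) - ψ (n * δt, M.center K)))) -
        ∑ K, M.vol K * (ρ n K * (ψ ((n + 1 : ℕ) * δt, M.center K) - ψ (n * δt, M.center K) -
          δt * dt ψ (n * δt, M.center K)))) := by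
      intro n _
      rw [Finset.mul_sum, Finset.mul_sum, ← Finset.sum_sub_distrib, ← Finset.sum_add_distrib]
      refine Finset.sum_congr rfl fun K _ => ?_
      rw [← Finset.mul_sum]
      ring
    rw [Finset.sum_congr rfl e3, Finset.sum_add_distrib, Finset.sum_sub_distrib,
      Finset.sum_sub_distrib, Finset.sum_sub_distrib, e2]
    ring
  rw [e1, totalError, Finset.mul_sum]
  refine (Finset.abs_sum_le_sum_abs _ _).trans (Finset.sum_le_sum fun n hn => ?_)
  rw [Finset.mem_range] at hn
  have S := S n hn
  have hB := S.one_le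
  have hδ := S.δt_pos
  have hh := S.h_pos
  have ht : ((n + 1 : ℕ) : ℝ) * δt = n * δt + δt := by push_cast; ring
  -- The increment is tested with `ψ` at the new time level, as Abel summation requires, but the
  -- derivative is taken at the old one; the shift is at most `δt ≤ h`.
  have hstep := S.abs_mass_step_le hreg (c := fun K => ψ ((n + 1 : ℕ) * δt, M.center K))
    (p := fun K i s => ψ ((n + 1 : ℕ) * δt, M.faceCenter K i s))
    (G := fun K i => dx i ψ (n * δt, M.center K))
    (fun K i s L hL => by simp only [faceCenter_nbr hL])
    (fun K i s => abs_sub_of_single hψB (by linarith) hh.le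
      (by rw [ht, add_sub_cancel_left, abs_of_pos hδ]; exact S.δt_le_h)
      (fun k => by simpa using hh.le) (abs_faceCenter_sub_le S.width_le hh.le K i s)
      (M.width_pos K i).le (M.faceCenter_sub_center K i s))
    (fun K i => abs_dx_le hψB i _)
  have hmass : ∑ K, M.vol K * ((ρ (n + 1) K - ρ n K) * ψ ((n + 1 : ℕ) * δt, M.center K)) =
      -(δt * ∑ K, ∑ i, ∑ s, M.massFlux δt (η n) (ρ n) (ρ (n + 1)) (u n) K i s *
        ψ ((n + 1 : ℕ) * δt, M.center K)) := by
    rw [Finset.mul_sum, ← Finset.sum_neg_distrib]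
    refine Finset.sum_congr rfl fun K _ => ?_
    have h1 := hsol.mass n hn K
    have hv := M.vol_pos K
    simp only [← Finset.sum_mul]
    field_simp at h1
    linear_combination ψ ((n + 1 : ℕ) * δt, M.center K) * h1
  have htime : |∑ K, M.vol K * (ρ n K * (ψ ((n + 1 : ℕ) * δt, M.center K) -
      ψ (n * δt, M.center K) - δt * dt ψ (n * δt, M.center K)))| ≤
      δt * (B ^ 2 * ∑ K, M.vol K * (M.osc (ρ n) (u n) K + h)) := by
    rw [Finset.mul_sum, Finset.mul_sum]
    refine (Finset.abs_sum_le_sum_abs _ _).trans (Finset.sum_le_sum fun K _ => ?_)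
    have hv := M.vol_pos K
    have h1 := abs_time_sub_le (t := n * δt) hψB (by linarith) hδ.le S.δt_le_h
      (x := M.center K) (y := M.center K) (fun k => by simpa using hh.le)
    rw [ht, abs_mul, abs_mul, abs_of_pos hv]
    calc _ ≤ M.vol K * (B * (B * h * δt)) := by
          have := S.abs_density K
          gcongr
      _ = δt * (B ^ 2 * (M.vol K * (0 + h))) := by ring
      _ ≤ _ := by
          have := osc_nonneg (ρ n) (u n) K
          gcongr
  rw [hmass]
  set O := ∑ K, M.vol K * (M.osc (ρ n) (u n) K + h)
  have hO : 0 ≤ O := Finset.sum_nonneg fun K _ =>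
    mul_nonneg (M.vol_pos K).le (add_nonneg (osc_nonneg _ _ K) hh.le)
  refine (abs_sub _ _).trans ?_
  rw [sub_neg_eq_add, ← mul_add, abs_mul, abs_of_pos hδ, add_comm (∑ K, ∑ i, _)]
  calc _ ≤ δt * (10 * d * B ^ 5 * O) + δt * (B ^ 2 * O) := by gcongr
    _ = δt * ((10 * d * B ^ 5 + B ^ 2) * O) := by ring
    _ ≤ δt * ((11 * (d + 1) * B ^ 5) * O) := by
        have p2 : B ^ 2 ≤ B ^ 5 := pow_le_pow_right₀ hB (by norm_num)
        have : 0 ≤ d * B ^ 5 := by positivity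
        gcongr
        linarith [pow_pos (by linarith : 0 < B) 5]
    _ ≤ _ := by
        have := bvSum_nonneg (ρ (n + 1))
        have h3 : O ≤ O + h * M.bvSum (ρ (n + 1)) := by
          have := mul_nonneg hh.le this
          linarith
        calc _ ≤ δt * (11 * (d + 1) * B ^ 5 * (O + h * M.bvSum (ρ (n + 1)))) := by gcongr
          _ = _ := by ring

/-- Same scheme as for the mass, with the momentum of a cell split into two half cells that carry
their own face velocities and face-centre test values. The Riemann sum uses the upper face velocity
only; the discrepancy is absorbed in the oscillation. -/
lemma abs_weak_momentum_le (hreg : interior (closure Ω) = Ω) (hT : N * δt = T)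
    (hsol : M.IsSchemeSolution δt N ρ₀ u₀ η ρ u)
    (S : ∀ n < N, StepBounds M δt B h (η n) (ρ n) (ρ (n + 1)) (u n)) (i : Fin d)
    {ψ : ℝ × (Fin d → ℝ) → ℝ} (hψ : IsTestFunction T ψ) (hψB : TaylorBound ψ B)
    (htan : ∀ x, HasAxisNormal Ω i x → ∀ t ∈ Ico 0 T, ψ (t, x) = 0) :
    |(∑ n ∈ Finset.range N, δt * ∑ K, M.vol K *
        (ρ n K * u n K i true * dt ψ (n * δt, M.center K) +
          (∑ j, ρ n K * u n K i true * u n K j true * dx j ψ (n * δt, M.center K)) +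
          ρ n K * dx i ψ (n * δt, M.center K))) +
      ∑ K, ∑ s, M.vol K / 2 * (ρ 0 K * u 0 K i s) * ψ (0, M.faceCenter K i s)| ≤
      61 * d * B ^ 9 * M.totalError δt h N ρ u := by
  -- Tangency is available only for times below `T`. At the last level `n + 1 = N` the test function
  -- vanishes altogether because of its support.
  have hext : ∀ n < N, ∀ K r, M.nbr K i r = none → ∀ x ∈ boxFace (M.lo K) (M.hi K) i r,
      ψ ((n + 1 : ℕ) * δt, x) = 0 := by
    intro n hn K r hK x hx
    have hδ := (S n hn).δt_pos
    rcases Nat.lt_or_ge (n + 1) N with h1 | h1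
    · refine eq_zero_on_external hreg hK (f := fun x => ψ ((n + 1 : ℕ) * δt, x))
        (hψ.smooth.continuous.comp (by fun_prop)) (fun x hx => ?_) hx
      refine htan x hx _ ⟨by positivity, ?_⟩
      rw [← hT]
      gcongr
    · rw [show n + 1 = N by omega, hT]
      exact hψ.eq_zero x
  have habel : ∀ K s, ∑ n ∈ Finset.range N,
      (ρ (n + 1) K * u (n + 1) K i s - ρ n K * u n K i s) *
        ψ ((n + 1 : ℕ) * δt, M.faceCenter K i s) =
      -(ρ 0 K * u 0 K i s * ψ (0, M.faceCenter K i s)) -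
        ∑ n ∈ Finset.range N, ρ n K * u n K i s *
        (ψ ((n + 1 : ℕ) * δt, M.faceCenter K i s) - ψ (n * δt, M.faceCenter K i s)) := by
    intro K s
    have := sum_range_sub_mul (fun n => ρ n K * u n K i s)
      (fun n => ψ (n * δt, M.faceCenter K i s)) N
    simp only [hT, hψ.eq_zero] at this
    rw [this]
    simp
  have e1 : (∑ n ∈ Finset.range N, δt * ∑ K, M.vol K *
        (ρ n K * u n K i true * dt ψ (n * δt, M.center K) +
          (∑ j, ρ n K * u n K i true * u n K j true * dx j ψ (n * δt, M.center K)) +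
          ρ n K * dx i ψ (n * δt, M.center K))) +
      ∑ K, ∑ s, M.vol K / 2 * (ρ 0 K * u 0 K i s) * ψ (0, M.faceCenter K i s) =
      ∑ n ∈ Finset.range N, (-((∑ K, ∑ s, M.vol K / 2 *
          (ρ (n + 1) K * u (n + 1) K i s - ρ n K * u n K i s) *
            ψ ((n + 1 : ℕ) * δt, M.faceCenter K i s)) -
        δt * ((∑ K, ∑ j, M.vol K * (ρ n K * u n K j true * u n K i true *
            dx j ψ (n * δt, M.center K))) +
          ∑ K, M.vol K * (ρ n K * dx i ψ (n * δt, M.center K)))) -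
        ∑ K, ∑ s, M.vol K / 2 * (ρ n K * u n K i s *
          (ψ ((n + 1 : ℕ) * δt, M.faceCenter K i s) - ψ (n * δt, M.faceCenter K i s)) -
          ρ n K * u n K i true * (δt * dt ψ (n * δt, M.center K)))) := by
    have e2 : ∑ n ∈ Finset.range N, (∑ K, ∑ s, M.vol K / 2 *
          (ρ (n + 1) K * u (n + 1) K i s - ρ n K * u n K i s) *
            ψ ((n + 1 : ℕ) * δt, M.faceCenter K i s)) =
        -(∑ K, ∑ s, M.vol K / 2 * (ρ 0 K * u 0 K i s) * ψ (0, M.faceCenter K i s)) -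
        ∑ n ∈ Finset.range N, ∑ K, ∑ s, M.vol K / 2 * (ρ n K * u n K i s *
          (ψ ((n + 1 : ℕ) * δt, M.faceCenter K i s) - ψ (n * δt, M.faceCenter K i s))) := by
      rw [Finset.sum_comm, Finset.sum_comm (s := Finset.range N), ← Finset.sum_neg_distrib,
        ← Finset.sum_sub_distrib]
      refine Finset.sum_congr rfl fun K _ => ?_
      rw [Finset.sum_comm, Finset.sum_comm (s := Finset.range N), ← Finset.sum_neg_distrib,
        ← Finset.sum_sub_distrib]
      refine Finset.sum_congr rfl fun s _ => ?_
      simp only [mul_assoc (M.vol K / 2)]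
      rw [← Finset.mul_sum, habel K s, ← Finset.mul_sum]
      ring
    have e3 : ∀ n ∈ Finset.range N, δt * ∑ K, M.vol K *
        (ρ n K * u n K i true * dt ψ (n * δt, M.center K) +
          (∑ j, ρ n K * u n K i true * u n K j true * dx j ψ (n * δt, M.center K)) +
          ρ n K * dx i ψ (n * δt, M.center K)) =
        δt * ((∑ K, ∑ j, M.vol K * (ρ n K * u n K j true * u n K i true *
            dx j ψ (n * δt, M.center K))) +
          ∑ K, M.vol K * (ρ n K * dx i ψ (n * δt, M.center K))) +
        ((∑ K, ∑ s, M.vol K / 2 * (ρ n K * u n K i s *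
          (ψ ((n + 1 : ℕ) * δt, M.faceCenter K i s) - ψ (n * δt, M.faceCenter K i s)))) -
        ∑ K, ∑ s, M.vol K / 2 * (ρ n K * u n K i s *
          (ψ ((n + 1 : ℕ) * δt, M.faceCenter K i s) - ψ (n * δt, M.faceCenter K i s)) -
          ρ n K * u n K i true * (δt * dt ψ (n * δt, M.center K)))) := by
      intro n _
      rw [← Finset.sum_add_distrib, Finset.mul_sum, Finset.mul_sum, ← Finset.sum_sub_distrib,
        ← Finset.sum_add_distrib]
      refine Finset.sum_congr rfl fun K _ => ?_
      rw [← Finset.mul_sum, Fintype.sum_bool, Fintype.sum_bool]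
      have : ∑ j, ρ n K * u n K j true * u n K i true * dx j ψ (n * δt, M.center K) =
          ∑ j, ρ n K * u n K i true * u n K j true * dx j ψ (n * δt, M.center K) :=
        Finset.sum_congr rfl fun j _ => by ring
      rw [this]
      ring
    rw [Finset.sum_congr rfl e3, Finset.sum_add_distrib, Finset.sum_sub_distrib,
      Finset.sum_sub_distrib, Finset.sum_neg_distrib, Finset.sum_sub_distrib, e2]
    ring
  rw [e1, totalError, Finset.mul_sum]
  refine (Finset.abs_sum_le_sum_abs _ _).trans (Finset.sum_le_sum fun n hn => ?_)
  rw [Finset.mem_range] at hn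
  have S := S n hn
  have hB := S.one_le
  have hδ := S.δt_pos
  have hh := S.h_pos
  have hd : (1 : ℝ) ≤ d := by exact_mod_cast i.pos
  have ht : ((n + 1 : ℕ) : ℝ) * δt = n * δt + δt := by push_cast; ring
  have htime : |((n + 1 : ℕ) : ℝ) * δt - n * δt| ≤ h := by
    rw [ht, add_sub_cancel_left, abs_of_pos hδ]; exact S.δt_le_h
  have hstep := S.abs_momentum_step_le hreg (i := i) (hsol.velocity_mem (n + 1) hn).1 (hsol.mass n hn)
    (fun K L hL => hsol.momentum n hn K i L hL)
    (c := fun K => ψ ((n + 1 : ℕ) * δt, M.center K))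
    (p := fun K s => ψ ((n + 1 : ℕ) * δt, M.faceCenter K i s))
    (e := fun K r j s => ψ ((n + 1 : ℕ) * δt, M.edgeCenter K i r j s))
    (G := fun K j => dx j ψ (n * δt, M.center K))
    (fun K r L hL => by simp only [faceCenter_nbr hL])
    (fun K r hK => hext n hn K r hK _ (faceCenter_mem_boxFace K i r))
    (fun K r j s L hj hL => by simp only [edgeCenter_nbr_left hL hj])
    (fun K r j s L hj hL => by simp only [edgeCenter_nbr_right hL hj])
    (fun K r j s hj hK => hext n hn K r hK _ (edgeCenter_mem_boxFace K hj r s))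
    (fun K s => abs_sub_of_single hψB (by linarith) hh.le htime
      (fun k => by simpa using hh.le) (abs_faceCenter_sub_le S.width_le hh.le K i s)
      (M.width_pos K i).le (M.faceCenter_sub_center K i s))
    (fun K r j s hj => abs_sub_of_single hψB (by linarith) hh.le htime
      (abs_faceCenter_sub_le S.width_le hh.le K i r)
      (abs_edgeCenter_sub_le S.width_le hh.le K i r j s)
      (M.width_pos K j).le (M.edgeCenter_sub_faceCenter K hj r s))
    (fun K j => abs_dx_le hψB j _) (fun K s => hψB.abs_le _)
  have htime : |∑ K, ∑ s, M.vol K / 2 * (ρ n K * u n K i s *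
          (ψ ((n + 1 : ℕ) * δt, M.faceCenter K i s) - ψ (n * δt, M.faceCenter K i s)) -
          ρ n K * u n K i true * (δt * dt ψ (n * δt, M.center K)))| ≤
      δt * (B ^ 3 * ∑ K, M.vol K * (M.osc (ρ n) (u n) K + h)) := by
    rw [Finset.mul_sum, Finset.mul_sum]
    refine (Finset.abs_sum_le_sum_abs _ _).trans (Finset.sum_le_sum fun K _ => ?_)
    have hv := M.vol_pos K
    have hterm : ∀ s, |M.vol K / 2 * (ρ n K * u n K i s *
          (ψ ((n + 1 : ℕ) * δt, M.faceCenter K i s) - ψ (n * δt, M.faceCenter K i s)) -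
          ρ n K * u n K i true * (δt * dt ψ (n * δt, M.center K)))| ≤
        M.vol K / 2 * (δt * (B ^ 3 * (M.osc (ρ n) (u n) K + h))) := by
      intro s
      have h1 := abs_time_sub_le (t := n * δt) hψB (by linarith) hδ.le S.δt_le_h
        (abs_faceCenter_sub_le S.width_le hh.le K i s)
      have h2 := abs_true_sub_le_osc (ρ n) (u n) K i s
      have h3 := S.abs_density K
      have h4 := S.velocity_le K i s
      have h5 := abs_dt_le hψB (n * δt, M.center K)
      have ho := osc_nonneg (ρ n) (u n) K
      rw [ht, abs_mul, abs_of_pos (by linarith : 0 < M.vol K / 2)]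
      gcongr
      -- The first part is the Taylor error in time, the second the replacement of the face velocity
      -- by the upper one.
      have e4 : ρ n K * u n K i s *
          (ψ (n * δt + δt, M.faceCenter K i s) - ψ (n * δt, M.faceCenter K i s)) -
          ρ n K * u n K i true * (δt * dt ψ (n * δt, M.center K)) =
          ρ n K * u n K i s *
          (ψ (n * δt + δt, M.faceCenter K i s) - ψ (n * δt, M.faceCenter K i s) -
            δt * dt ψ (n * δt, M.center K)) -
          ρ n K * (u n K i true - u n K i s) * (δt * dt ψ (n * δt, M.center K)) := by ring
      rw [e4]
      refine (abs_sub _ _).trans ?_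
      rw [abs_mul, abs_mul, abs_mul, abs_mul, abs_mul, abs_of_pos hδ]
      calc _ ≤ B * B * (B * h * δt) + B * M.osc (ρ n) (u n) K * (δt * B) := by gcongr
        _ = δt * (B ^ 2 * M.osc (ρ n) (u n) K + B ^ 3 * h) := by ring
        _ ≤ δt * (B ^ 3 * M.osc (ρ n) (u n) K + B ^ 3 * h) := by
            gcongr
            · norm_num
        _ = _ := by ring
    refine (Finset.abs_sum_le_sum_abs _ _).trans ?_
    rw [Fintype.sum_bool]
    linarith [hterm true, hterm false]
  set O := ∑ K, M.vol K * (M.osc (ρ n) (u n) K + h)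
  have hO : 0 ≤ O := Finset.sum_nonneg fun K _ =>
    mul_nonneg (M.vol_pos K).le (add_nonneg (osc_nonneg _ _ K) hh.le)
  have hbv := bvSum_nonneg (ρ (n + 1))
  refine (abs_sub _ _).trans ?_
  rw [abs_neg]
  have h6 : B ^ 3 ≤ d * B ^ 9 :=
    (pow_le_pow_right₀ hB (by norm_num)).trans (le_mul_of_one_le_left (by positivity) hd)
  calc _ ≤ δt * (60 * d * B ^ 9 * (O + h * M.bvSum (ρ (n + 1)))) + δt * (B ^ 3 * O) :=
        add_le_add hstep htime
    _ ≤ δt * (60 * d * B ^ 9 * (O + h * M.bvSum (ρ (n + 1)))) +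
        δt * (d * B ^ 9 * (O + h * M.bvSum (ρ (n + 1)))) := by
        gcongr
        have := mul_nonneg hh.le hbv
        linarith
    _ = _ := by ring

end weak

end MACMesh

namespace MACMesh

variable {d : ℕ} {Ω : Set (Fin d → ℝ)} {M : MACMesh d Ω}

/-! ## Integration over the cells -/

lemma halfCell_eq_openBox (K : M.Cell) (i : Fin d) (s : Bool) :
    M.halfCell K i s = openBox
      (Function.update (M.lo K) i (if s then M.center K i else M.lo K i))
      (Function.update (M.hi K) i (if s then M.hi K i else M.center K i)) := by
  have hc := M.center_mem_Icc K i
  have hc' : M.center K i = (M.lo K i + M.hi K i) / 2 := rfl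
  ext x
  simp only [halfCell, Set.mem_ofPred_eq, openBox_mem_iff, ← hc']
  constructor
  · rintro ⟨h1, h2⟩ j
    by_cases hj : j = i
    · subst hj
      have := h1 j
      cases s <;> simp at h2 ⊢ <;> constructor <;> linarith
    · simpa [hj] using h1 j
  · intro h
    have hi := h i
    refine ⟨fun j => ?_, ?_⟩
    · by_cases hj : j = i
      · subst hj
        cases s <;> simp at hi ⊢ <;> constructor <;> linarith
      · simpa [hj] using h j
    · cases s <;> simp at hi ⊢ <;> linarith

lemma measurableSet_openBox (lo hi : Fin d → ℝ) : MeasurableSet (openBox lo hi) :=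
  (isOpen_openBox lo hi).measurableSet

lemma measurableSet_halfCell (K : M.Cell) (i : Fin d) (s : Bool) :
    MeasurableSet (M.halfCell K i s) := by
  rw [halfCell_eq_openBox]; exact measurableSet_openBox _ _

lemma volume_real_openBox {lo hi : Fin d → ℝ} (h : lo ≤ hi) :
    (volume (openBox lo hi)).toReal = ∏ i, (hi i - lo i) := by
  unfold openBox
  exact Real.volume_pi_Ioo_toReal h

lemma volume_real_halfCell (K : M.Cell) (i : Fin d) (s : Bool) :
    (volume (M.halfCell K i s)).toReal = M.vol K / 2 := by
  have hc := M.center_mem_Icc K i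
  rw [halfCell_eq_openBox, volume_real_openBox, ← Finset.mul_prod_erase _ _ (Finset.mem_univ i),
    ← M.area_mul_width K i, area]
  · have : ∀ j ∈ Finset.univ.erase i,
        Function.update (M.hi K) i (if s then M.hi K i else M.center K i) j -
          Function.update (M.lo K) i (if s then M.center K i else M.lo K i) j = M.width K j := by
      intro j hj
      simp [Finset.ne_of_mem_erase hj, width]
    rw [Finset.prod_congr rfl this, Function.update_self, Function.update_self,
      show M.width K i = M.hi K i - M.lo K i from rfl]
    cases s <;> simp [center] <;> ring
  · intro j
    by_cases hj : j = i
    · subst hj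
      cases s <;> simp [hc.1.le, hc.2.le]
    · simp [hj, (M.lo_lt_hi K j).le]

lemma halfCell_subset_openBox (K : M.Cell) (i : Fin d) (s : Bool) :
    M.halfCell K i s ⊆ openBox (M.lo K) (M.hi K) := fun _ hx => hx.1

lemma disjoint_halfCell (i : Fin d) {p q : M.Cell × Bool} (h : p ≠ q) :
    Disjoint (M.halfCell p.1 i p.2) (M.halfCell q.1 i q.2) := by
  rcases p with ⟨K, s⟩
  rcases q with ⟨L, r⟩
  by_cases hKL : K = L
  · subst hKL
    have hsr : s ≠ r := fun h' => h (by rw [h'])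
    rw [Set.disjoint_left]
    rintro x ⟨_, h1⟩ ⟨_, h2⟩
    cases s <;> cases r <;> simp at h1 h2 hsr <;> linarith
  · exact (M.disjoint K L hKL).mono (halfCell_subset_openBox K i s) (halfCell_subset_openBox L i r)

lemma volume_hyperplane (j : Fin d) (c : ℝ) : volume {x : Fin d → ℝ | x j = c} = 0 :=
  by rw [volume_pi]; exact Measure.pi_hyperplane (fun _ : Fin d => (volume : Measure ℝ)) j c

/-- The closed cells cover `Ω`, and the points missed by the open half cells lie on finitely many
coordinate hyperplanes. -/
lemma ae_exists_mem_halfCell (M : MACMesh d Ω) (i : Fin d) :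
    ∀ᵐ x : Fin d → ℝ, x ∈ Ω → ∃ p : M.Cell × Bool, x ∈ M.halfCell p.1 i p.2 := by
  have h : ∀ᵐ x : Fin d → ℝ, ∀ K : M.Cell, ∀ j,
      x j ≠ M.lo K j ∧ x j ≠ M.hi K j ∧ x j ≠ M.center K j := by
    rw [ae_all_iff]
    intro K
    rw [ae_all_iff]
    intro j
    have h' : ∀ c : ℝ, ∀ᵐ x : Fin d → ℝ, x j ≠ c := fun c => by
      rw [ae_iff]
      simpa using volume_hyperplane j c
    filter_upwards [h' (M.lo K j), h' (M.hi K j), h' (M.center K j)] with x h1 h2 h3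
    exact ⟨h1, h2, h3⟩
  filter_upwards [h] with x hx hxΩ
  have hx' : x ∈ closure Ω := subset_closure hxΩ
  rw [← M.cover, Set.mem_iUnion] at hx'
  obtain ⟨K, hK⟩ := hx'
  have hbox : x ∈ openBox (M.lo K) (M.hi K) := by
    rw [openBox_mem_iff]
    exact fun j => ⟨lt_of_le_of_ne (hK.1 j) (hx K j).1.symm, lt_of_le_of_ne (hK.2 j) (hx K j).2.1⟩
  rcases lt_or_gt_of_ne (hx K i).2.2 with h | h
  · exact ⟨(K, false), hbox, by simpa [center] using h⟩
  · exact ⟨(K, true), hbox, by simpa [center] using h⟩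

lemma iUnion_halfCell_ae_eq (M : MACMesh d Ω) (hreg : interior (closure Ω) = Ω) (i : Fin d) :
    (⋃ p : M.Cell × Bool, M.halfCell p.1 i p.2) =ᵐ[volume] Ω := by
  filter_upwards [ae_exists_mem_halfCell M i] with x hx
  apply propext
  constructor
  · intro h
    obtain ⟨p, hp⟩ := Set.mem_iUnion.1 h
    exact M.openBox_subset hreg p.1 (halfCell_subset_openBox _ _ _ hp)
  · exact fun h => Set.mem_iUnion.2 (hx h)

lemma setIntegral_eq_sum_halfCell (M : MACMesh d Ω) (hreg : interior (closure Ω) = Ω) (i : Fin d)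
    {f : (Fin d → ℝ) → ℝ} (hf : IntegrableOn f Ω) :
    ∫ x in Ω, f x = ∑ K, ∑ s, ∫ x in M.halfCell K i s, f x := by
  rw [← setIntegral_congr_set (iUnion_halfCell_ae_eq M hreg i), integral_iUnion_fintype
    (fun p => measurableSet_halfCell p.1 i p.2) (fun p q h => disjoint_halfCell i h)]
  · exact Fintype.sum_prod_type _
  · exact fun p => hf.mono_set
      ((halfCell_subset_openBox _ _ _).trans (M.openBox_subset hreg p.1))

lemma setIntegral_openBox_eq (M : MACMesh d Ω) (K : M.Cell) (i : Fin d)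
    {f : (Fin d → ℝ) → ℝ} (hf : IntegrableOn f (openBox (M.lo K) (M.hi K))) :
    ∫ x in openBox (M.lo K) (M.hi K), f x = ∑ s, ∫ x in M.halfCell K i s, f x := by
  have h : (⋃ s : Bool, M.halfCell K i s) =ᵐ[volume] openBox (M.lo K) (M.hi K) := by
    have h' : ∀ᵐ x : Fin d → ℝ, x i ≠ M.center K i := by
      rw [ae_iff]
      simpa using volume_hyperplane i (M.center K i)
    filter_upwards [h'] with x hx
    apply propext
    constructor
    · intro h
      obtain ⟨s, hs⟩ := Set.mem_iUnion.1 h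
      exact halfCell_subset_openBox _ _ _ hs
    · intro hbox
      apply Set.mem_iUnion.2
      rcases lt_or_gt_of_ne hx with h | h
      · exact ⟨false, hbox, by simpa [center] using h⟩
      · exact ⟨true, hbox, by simpa [center] using h⟩
  rw [← setIntegral_congr_set h, integral_iUnion_fintype (fun s => measurableSet_halfCell K i s)]
  · intro s r hsr
    exact disjoint_halfCell i (p := (K, s)) (q := (K, r)) (by simpa using hsr)
  · exact fun s => hf.mono_set (halfCell_subset_openBox _ _ _)

lemma volume_lt_top (hbdd : Bornology.IsBounded Ω) : volume Ω < ⊤ := hbdd.measure_lt_top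

lemma sum_vol (M : MACMesh d Ω) (hreg : interior (closure Ω) = Ω) (hbdd : Bornology.IsBounded Ω)
    (i : Fin d) : ∑ K, M.vol K = (volume Ω).toReal := by
  have hint : IntegrableOn (fun _ : Fin d → ℝ => (1 : ℝ)) Ω :=
    integrableOn_const (volume_lt_top hbdd).ne
  have h := setIntegral_eq_sum_halfCell M hreg i hint
  simp only [setIntegral_const, smul_eq_mul, mul_one, Measure.real, volume_real_halfCell,
    Fintype.sum_bool, add_halves] at h
  exact h.symm

/-! ## Space-time cells -/

/-- The product of the `n`-th time interval and a half cell. -/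
def timeCell (M : MACMesh d Ω) (δt : ℝ) (i : Fin d) (n : ℕ) (K : M.Cell) (s : Bool) :
    Set (ℝ × (Fin d → ℝ)) :=
  Ioo (n * δt) ((n + 1 : ℕ) * δt) ×ˢ M.halfCell K i s

section timeCell

variable {δt T : ℝ} {N : ℕ} {i : Fin d}

lemma measurableSet_timeCell (n : ℕ) (K : M.Cell) (s : Bool) :
    MeasurableSet (M.timeCell δt i n K s) :=
  measurableSet_Ioo.prod (measurableSet_halfCell K i s)

lemma volume_real_timeCell (hδ : 0 < δt) (n : ℕ) (K : M.Cell) (s : Bool) :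
    (volume (M.timeCell δt i n K s)).toReal = δt * (M.vol K / 2) := by
  rw [timeCell, Measure.volume_eq_prod, Measure.prod_prod, ENNReal.toReal_mul,
    volume_real_halfCell, Real.volume_Ioo, ENNReal.toReal_ofReal (by push_cast; linarith)]
  push_cast
  ring

lemma floor_of_mem_timeCell (hδ : 0 < δt) {n : ℕ} {K : M.Cell} {s : Bool}
    {z : ℝ × (Fin d → ℝ)} (hz : z ∈ M.timeCell δt i n K s) : ⌊z.1 / δt⌋₊ = n := by
  obtain ⟨⟨h1, h2⟩, _⟩ := hz
  have h0 : (0 : ℝ) ≤ n * δt := by positivity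
  rw [Nat.floor_eq_iff (div_nonneg (by linarith) hδ.le), le_div_iff₀ hδ, div_lt_iff₀ hδ]
  push_cast at h2
  exact ⟨h1.le, h2⟩

lemma disjoint_timeCell (hδ : 0 < δt) {p q : Fin N × M.Cell × Bool} (h : p ≠ q) :
    Disjoint (M.timeCell δt i p.1 p.2.1 p.2.2) (M.timeCell δt i q.1 q.2.1 q.2.2) := by
  rw [Set.disjoint_left]
  intro z hz hz'
  have h1 := floor_of_mem_timeCell hδ hz
  have h2 := floor_of_mem_timeCell hδ hz'
  have h3 : p.1 = q.1 := Fin.ext (h1.symm.trans h2)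
  have h4 : p.2 ≠ q.2 := fun h' => h (Prod.ext h3 h')
  exact Set.disjoint_left.1 (disjoint_halfCell i h4) hz.2 hz'.2

lemma timeCell_subset (hreg : interior (closure Ω) = Ω) (hδ : 0 < δt) (hT : N * δt = T) {n : ℕ}
    (hn : n < N) (K : M.Cell) (s : Bool) : M.timeCell δt i n K s ⊆ spaceTime T Ω := by
  rintro z ⟨⟨h1, h2⟩, h3⟩
  refine ⟨⟨?_, ?_⟩, M.openBox_subset hreg K (halfCell_subset_openBox _ _ _ h3)⟩
  · exact lt_of_le_of_lt (by positivity) h1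
  · rw [← hT]
    refine h2.trans_le ?_
    gcongr
    exact hn

lemma ae_exists_mem_timeCell (M : MACMesh d Ω) (i : Fin d) (hδ : 0 < δt) (hT : N * δt = T) :
    ∀ᵐ z : ℝ × (Fin d → ℝ), z ∈ spaceTime T Ω →
      ∃ p : Fin N × M.Cell × Bool, z ∈ M.timeCell δt i p.1 p.2.1 p.2.2 := by
  have h1 : ∀ᵐ z : ℝ × (Fin d → ℝ), z.2 ∈ Ω → ∃ p : M.Cell × Bool, z.2 ∈ M.halfCell p.1 i p.2 :=
    Measure.quasiMeasurePreserving_snd.ae (ae_exists_mem_halfCell M i)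
  have h2 : ∀ᵐ z : ℝ × (Fin d → ℝ), ∀ n : ℕ, z.1 ≠ n * δt := by
    rw [ae_all_iff]
    intro n
    have : ∀ᵐ t : ℝ, t ≠ n * δt := by
      rw [ae_iff]; simp
    exact Measure.quasiMeasurePreserving_fst.ae this
  filter_upwards [h1, h2] with z hz1 hz2 hz
  obtain ⟨p, hp⟩ := hz1 hz.2
  have hpos : 0 ≤ z.1 / δt := div_nonneg hz.1.1.le hδ.le
  have hfl := Nat.floor_le hpos
  have hfl' := Nat.lt_floor_add_one (z.1 / δt)
  rw [le_div_iff₀ hδ] at hfl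
  rw [div_lt_iff₀ hδ] at hfl'
  have hlt : ⌊z.1 / δt⌋₊ < N := by
    rw [Nat.floor_lt hpos, div_lt_iff₀ hδ, hT]
    exact hz.1.2
  exact ⟨(⟨⌊z.1 / δt⌋₊, hlt⟩, p), ⟨⟨lt_of_le_of_ne hfl (hz2 _).symm, by push_cast; exact hfl'⟩, hp⟩⟩

lemma setIntegral_spaceTime_eq_sum (M : MACMesh d Ω) (hreg : interior (closure Ω) = Ω) (i : Fin d)
    (hδ : 0 < δt) (hT : N * δt = T) {f : ℝ × (Fin d → ℝ) → ℝ}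
    (hf : IntegrableOn f (spaceTime T Ω)) :
    ∫ z in spaceTime T Ω, f z =
      ∑ n ∈ Finset.range N, ∑ K, ∑ s, ∫ z in M.timeCell δt i n K s, f z := by
  have h : (⋃ p : Fin N × M.Cell × Bool, M.timeCell δt i p.1 p.2.1 p.2.2) =ᵐ[volume]
      spaceTime T Ω := by
    filter_upwards [ae_exists_mem_timeCell M i hδ hT] with z hz
    apply propext
    constructor
    · intro h
      obtain ⟨p, hp⟩ := Set.mem_iUnion.1 h
      exact timeCell_subset hreg hδ hT p.1.2 _ _ hp
    · exact fun h => Set.mem_iUnion.2 (hz h)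
  rw [← setIntegral_congr_set h, integral_iUnion_fintype
    (fun p => measurableSet_timeCell _ _ _) (fun p q h => disjoint_timeCell hδ h)]
  · rw [Fintype.sum_prod_type, Finset.sum_range fun n => ∑ K, ∑ s, ∫ z in M.timeCell δt i n K s, f z]
    refine Finset.sum_congr rfl fun n _ => Fintype.sum_prod_type _
  · exact fun p => hf.mono_set (timeCell_subset hreg hδ hT p.1.2 _ _)

/-- Together with its counterpart for upper bounds this replaces an explicit computation of
integrals of piecewise constant functions: only pointwise comparison on each space-time cell is
needed. -/
lemma sum_le_setIntegral_spaceTime (hreg : interior (closure Ω) = Ω)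
    (hδ : 0 < δt) (hT : N * δt = T) {f : ℝ × (Fin d → ℝ) → ℝ}
    (hf : IntegrableOn f (spaceTime T Ω)) {a : ℕ → M.Cell → Bool → ℝ}
    (h : ∀ n < N, ∀ K s, ∀ z ∈ M.timeCell δt i n K s, a n K s ≤ f z) :
    ∑ n ∈ Finset.range N, ∑ K, ∑ s, δt * (M.vol K / 2) * a n K s ≤ ∫ z in spaceTime T Ω, f z := by
  rw [setIntegral_spaceTime_eq_sum M hreg i hδ hT hf]
  refine Finset.sum_le_sum fun n hn => Finset.sum_le_sum fun K _ => Finset.sum_le_sum fun s _ => ?_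
  rw [Finset.mem_range] at hn
  have hvol := volume_real_timeCell (i := i) hδ n K s
  have hpos : 0 < δt * (M.vol K / 2) := by have := M.vol_pos K; positivity
  have hfin : volume (M.timeCell δt i n K s) ≠ ⊤ := by
    intro h; rw [h, ENNReal.toReal_top] at hvol; linarith
  calc δt * (M.vol K / 2) * a n K s = ∫ _z in M.timeCell δt i n K s, a n K s := by
        rw [setIntegral_const, smul_eq_mul, Measure.real, hvol]
    _ ≤ _ := setIntegral_mono_on (integrableOn_const hfin)
        (hf.mono_set (timeCell_subset hreg hδ hT hn K s)) (measurableSet_timeCell n K s)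
        (h n hn K s)

lemma setIntegral_spaceTime_le_sum (hreg : interior (closure Ω) = Ω)
    (hδ : 0 < δt) (hT : N * δt = T) {f : ℝ × (Fin d → ℝ) → ℝ}
    (hf : IntegrableOn f (spaceTime T Ω)) {a : ℕ → M.Cell → Bool → ℝ}
    (h : ∀ n < N, ∀ K s, ∀ z ∈ M.timeCell δt i n K s, f z ≤ a n K s) :
    ∫ z in spaceTime T Ω, f z ≤ ∑ n ∈ Finset.range N, ∑ K, ∑ s, δt * (M.vol K / 2) * a n K s := by
  have := sum_le_setIntegral_spaceTime hreg hδ hT hf.neg (a := fun n K s => -a n K s)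
    (fun n hn K s z hz => neg_le_neg (h n hn K s z hz))
  simp only [mul_neg, Finset.sum_neg_distrib, Pi.neg_apply, integral_neg] at this
  linarith

lemma cellFun_of_mem (hδ : 0 < δt) (a : ℕ → M.CellField) {n : ℕ} {K : M.Cell} {s : Bool}
    {z : ℝ × (Fin d → ℝ)} (hz : z ∈ M.timeCell δt i n K s) : M.cellFun δt a z = a n K := by
  have hK := halfCell_subset_openBox K i s hz.2
  unfold cellFun
  rw [floor_of_mem_timeCell hδ hz, Finset.sum_eq_single K]
  · exact Set.indicator_of_mem hK _
  · intro L _ hL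
    exact Set.indicator_of_notMem (fun h => Set.disjoint_left.1 (M.disjoint L K hL) h hK) _
  · simp

lemma faceFun_of_mem (hδ : 0 < δt) (u : ℕ → M.FaceField) {n : ℕ} {K : M.Cell} {s : Bool}
    {z : ℝ × (Fin d → ℝ)} (hz : z ∈ M.timeCell δt i n K s) : M.faceFun δt u z i = u n K i s := by
  unfold faceFun
  rw [floor_of_mem_timeCell hδ hz, ← Fintype.sum_prod_type' (f := fun L r =>
    (M.halfCell L i r).indicator (fun _ => u n L i r) z.2), Finset.sum_eq_single (K, s)]
  · exact Set.indicator_of_mem hz.2 _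
  · intro p _ hp
    exact Set.indicator_of_notMem (fun h => Set.disjoint_left.1 (disjoint_halfCell i hp) h hz.2) _
  · simp

lemma measurable_cellFun (δt : ℝ) (a : ℕ → M.CellField) : Measurable (M.cellFun δt a) := by
  unfold cellFun
  refine Finset.measurable_sum _ fun K _ => ?_
  have h1 : Measurable fun z : ℝ × (Fin d → ℝ) => a ⌊z.1 / δt⌋₊ K :=
    (measurable_of_countable fun n : ℕ => a n K).comp
      (Nat.measurable_floor.comp (measurable_fst.div_const δt))
  exact h1.indicator (measurable_snd (measurableSet_openBox (M.lo K) (M.hi K)))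

lemma measurable_faceFun (δt : ℝ) (u : ℕ → M.FaceField) (i : Fin d) :
    Measurable fun z => M.faceFun δt u z i := by
  unfold faceFun
  refine Finset.measurable_sum _ fun K _ => Finset.measurable_sum _ fun s _ => ?_
  have h1 : Measurable fun z : ℝ × (Fin d → ℝ) => u ⌊z.1 / δt⌋₊ K i s :=
    (measurable_of_countable fun n : ℕ => u n K i s).comp
      (Nat.measurable_floor.comp (measurable_fst.div_const δt))
  exact h1.indicator (measurable_snd (measurableSet_halfCell K i s))

/-- Points of a space-time cell are close to its lower base centre. -/
lemma norm_sub_le_of_mem_timeCell {h : ℝ} (hh : 0 ≤ h) (hw : ∀ K i, M.width K i ≤ h)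
    (hδh : δt ≤ h) {n : ℕ} {K : M.Cell} {s : Bool} {z : ℝ × (Fin d → ℝ)}
    (hz : z ∈ M.timeCell δt i n K s) : ‖z - ((n * δt, M.center K) : ℝ × (Fin d → ℝ))‖ ≤ h := by
  obtain ⟨⟨h1, h2⟩, h3⟩ := hz
  push_cast at h2
  refine norm_prod_sub_le hh ?_ fun j => ?_
  · rw [abs_le]; constructor <;> linarith
  · have h4 := (openBox_mem_iff _ _ _).1 (halfCell_subset_openBox _ _ _ h3) j
    have h5 := hw K j
    simp only [width] at h5
    rw [abs_le, center]
    constructor <;> linarith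

end timeCell

end MACMesh

lemma tendsto_zero_of_forall_eventually_le {f : ℕ → ℝ} {C : ℝ} (hC : 0 ≤ C)
    (h : ∀ ε > 0, ∀ᶠ m in atTop, |f m| ≤ C * ε) : Tendsto f atTop (𝓝 0) := by
  rw [Metric.tendsto_nhds]
  intro ε hε
  filter_upwards [h (ε / (C + 1)) (by positivity)] with m hm
  rw [Real.dist_eq, sub_zero]
  refine hm.trans_lt ?_
  rw [← mul_div_assoc, div_lt_iff₀ (by positivity)]
  nlinarith

namespace MACMesh

variable {d : ℕ} {Ω : Set (Fin d → ℝ)} {M : MACMesh d Ω}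

/-! ## The consistency error tends to zero -/

/-- A cell is the neighbour of at most two others in a given direction. -/
lemma sum_elim_le (hreg : interior (closure Ω) = Ω) (j : Fin d) {f : M.Cell → ℝ}
    (hf : ∀ K, 0 ≤ f K) : ∑ K, ∑ s, (M.nbr K j s).elim 0 f ≤ 2 * ∑ K, f K := by
  have h := sum_otherName hreg j (fun K _ => f K)
  calc ∑ K, ∑ s, (M.nbr K j s).elim 0 f ≤ ∑ K, ∑ s, (M.nbr K j s).elim (f K) f := by
        refine Finset.sum_le_sum fun K _ => Finset.sum_le_sum fun s _ => ?_
        cases M.nbr K j s <;> simp [hf]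
    _ = ∑ K, ∑ _s : Bool, f K := h
    _ = _ := by simp [Finset.mul_sum]

/-- Differences of neighbouring values are controlled by the distance to a slowly varying field. -/
lemma sum_vol_mul_translate_le (hreg : interior (closure Ω) = Ω) (j : Fin d) {B κ : ℝ} (hB : 0 ≤ B)
    (hvol : ∀ K s L, M.nbr K j s = some L → M.vol K ≤ B * M.vol L) {c r : M.CellField}
    (hκ : 0 ≤ κ) (hr : ∀ K s L, M.nbr K j s = some L → |r L - r K| ≤ κ) :
    ∑ K, ∑ s, M.vol K * (M.nbr K j s).elim 0 (fun L => |c L - c K|) ≤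
      2 * (1 + B) * (∑ K, M.vol K * |c K - r K|) + 2 * κ * ∑ K, M.vol K := by
  have h1 := sum_elim_le hreg j (f := fun L => B * (M.vol L * |c L - r L|)) (fun L => by
    have := M.vol_pos L
    positivity)
  have h2 : ∀ K s, M.vol K * (M.nbr K j s).elim 0 (fun L => |c L - c K|) ≤
      (M.vol K * |c K - r K| + κ * M.vol K) +
        (M.nbr K j s).elim 0 (fun L => B * (M.vol L * |c L - r L|)) := by
    intro K s
    have hv := M.vol_pos K
    cases hn : M.nbr K j s with
    | none => simp only [Option.elim_none, mul_zero, add_zero]; positivity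
    | some L =>
      simp only [Option.elim_some]
      have h3 : |c L - c K| ≤ |c L - r L| + κ + |c K - r K| := by
        have e : c L - c K = (c L - r L) + (r L - r K) - (c K - r K) := by ring
        rw [e]
        exact (abs_sub _ _).trans (add_le_add ((abs_add_le _ _).trans
          (add_le_add le_rfl (hr K s L hn))) le_rfl)
      have h4 := mul_le_mul_of_nonneg_right (hvol K s L hn) (abs_nonneg (c L - r L))
      nlinarith
  refine (Finset.sum_le_sum fun K _ => Finset.sum_le_sum fun s _ => h2 K s).trans ?_
  simp only [Finset.sum_add_distrib] at h1 ⊢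
  simp only [Finset.sum_const, Finset.card_univ, Fintype.card_bool, nsmul_eq_mul,
    ← Finset.mul_sum] at h1 ⊢
  push_cast
  linarith

/-- A cell volume is an area times a width, and the width supplies a factor `h` in front of the BV
sum. Every internal face is met from both sides, whence the factor two. -/
lemma sum_density_jump_le (hreg : interior (closure Ω) = Ω) {h : ℝ}
    (hw : ∀ K i, M.width K i ≤ h) (ρ : M.CellField) :
    ∑ K, M.vol K * (∑ i, ∑ s, (M.nbr K i s).elim 0 fun L => |ρ L - ρ K|) ≤ 2 * h * M.bvSum ρ := by
  simp only [Finset.mul_sum, bvSum]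
  rw [Finset.sum_comm]
  refine Finset.sum_le_sum fun i _ => ?_
  have h1 := sumFaces_eq hreg i
    (fun K s => (M.nbr K i s).elim 0 fun L => M.area K i * |ρ L - ρ K|)
    (fun K s hn => by simp [hn])
  have h2 : M.sumFaces i (fun K L =>
      ((M.nbr K i true).elim 0 fun L => M.area K i * |ρ L - ρ K|) +
      (M.nbr L i false).elim 0 fun K => M.area L i * |ρ K - ρ L|) =
      2 * M.sumFaces i (fun K L => M.area K i * |ρ L - ρ K|) := by
    rw [← sumFaces_mul_left]
    apply sumFaces_congr
    intro K L hL
    rw [hL, show M.nbr L i false = some K from nbr_symm hreg hL]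
    simp only [Option.elim_some]
    rw [area_nbr hL, abs_sub_comm (ρ K)]
    ring
  rw [h2] at h1
  calc _ ≤ ∑ K, ∑ s, h * (M.nbr K i s).elim 0 fun L => M.area K i * |ρ L - ρ K| := by
        refine Finset.sum_le_sum fun K _ => Finset.sum_le_sum fun s _ => ?_
        cases M.nbr K i s with
        | none => simp
        | some L =>
          simp only [Option.elim_some]
          rw [← M.area_mul_width K i]
          have := hw K i
          have := M.area_pos K i
          calc _ = M.width K i * (M.area K i * |ρ L - ρ K|) := by ring
            _ ≤ _ := by gcongr
    _ = h * (2 * M.sumFaces i (fun K L => M.area K i * |ρ L - ρ K|)) := by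
        rw [h1]; simp only [Finset.mul_sum]
    _ = _ := by ring

/-- The density part of the oscillation is bounded by the BV sum. The velocity parts are compared
with fields `r i` that vary by at most `κ` between neighbours: within a cell by the triangle
inequality, across faces by `sum_vol_mul_translate_le`. -/
lemma sum_vol_mul_osc_le (hreg : interior (closure Ω) = Ω) {B h κ : ℝ} (hB : 0 ≤ B)
    (hw : ∀ K i, M.width K i ≤ h)
    (hvol : ∀ K j s L, M.nbr K j s = some L → M.vol K ≤ B * M.vol L) (ρ : M.CellField)
    (u : M.FaceField) {r : Fin d → M.CellField} (hκ : 0 ≤ κ)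
    (hr : ∀ i K j s L, M.nbr K j s = some L → |r i L - r i K| ≤ κ) :
    ∑ K, M.vol K * M.osc ρ u K ≤
      (1 + 2 * d * (1 + B)) * (∑ i, ∑ K, ∑ s, M.vol K * |u K i s - r i K|) +
        4 * d ^ 2 * κ * (∑ K, M.vol K) + 2 * h * M.bvSum ρ := by
  have h1 : ∑ K, M.vol K * (∑ i, ∑ s, |u K i true - u K i s|) ≤
      ∑ i, ∑ K, ∑ s, M.vol K * |u K i s - r i K| := by
    simp only [Finset.mul_sum]
    rw [Finset.sum_comm]
    refine Finset.sum_le_sum fun i _ => Finset.sum_le_sum fun K _ => ?_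
    have hv := M.vol_pos K
    simp only [Fintype.sum_bool, sub_self, abs_zero, mul_zero, zero_add, ← mul_add]
    gcongr
    rw [abs_sub_comm (u K i false)]
    exact abs_sub_le _ _ _
  have h3 : ∑ K, M.vol K * (∑ i, ∑ q, ∑ j, ∑ s,
      (M.nbr K j s).elim 0 fun L => |u L i q - u K i q|) ≤
      2 * d * (1 + B) * (∑ i, ∑ K, ∑ s, M.vol K * |u K i s - r i K|) +
        4 * d ^ 2 * κ * (∑ K, M.vol K) := by
    have e1 : ∑ K, M.vol K * (∑ i, ∑ q, ∑ j, ∑ s,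
        (M.nbr K j s).elim 0 fun L => |u L i q - u K i q|) =
        ∑ i, ∑ q, ∑ j, ∑ K, ∑ s, M.vol K *
          (M.nbr K j s).elim 0 fun L => |u L i q - u K i q| := by
      simp only [Finset.mul_sum]
      rw [Finset.sum_comm]
      refine Finset.sum_congr rfl fun i _ => ?_
      rw [Finset.sum_comm]
      refine Finset.sum_congr rfl fun q _ => ?_
      rw [Finset.sum_comm]
    rw [e1]
    have e2 : ∀ i ∈ Finset.univ, ∀ q ∈ Finset.univ, ∀ j ∈ Finset.univ, ∑ K, ∑ s, M.vol K *
          ((M.nbr K j s).elim 0 fun L => |u L i q - u K i q|) ≤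
        2 * (1 + B) * (∑ K, M.vol K * |u K i q - r i K|) + 2 * κ * ∑ K, M.vol K :=
      fun i _ q _ j _ => sum_vol_mul_translate_le hreg j hB (fun K s L => hvol K j s L)
        (c := fun K => u K i q) hκ (fun K s L => hr i K j s L)
    refine (Finset.sum_le_sum fun i hi => Finset.sum_le_sum fun q hq =>
      Finset.sum_le_sum fun j hj => e2 i hi q hq j hj).trans ?_
    apply le_of_eq
    have e3 : ∀ i, ∑ q, ∑ K, M.vol K * |u K i q - r i K| =
        ∑ K, ∑ s, M.vol K * |u K i s - r i K| := fun i => Finset.sum_comm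
    simp only [Finset.sum_const, Finset.card_univ, Fintype.card_fin, nsmul_eq_mul,
      Finset.sum_add_distrib, ← Finset.mul_sum, Fintype.card_bool, e3]
    push_cast
    ring
  have h2 := sum_density_jump_le hreg hw ρ
  simp only [osc, mul_add, Finset.sum_add_distrib] at h1 h2 h3 ⊢
  linarith

lemma abs_center_sub_le {h : ℝ} (hw : ∀ K i, M.width K i ≤ h) (hh : 0 ≤ h) {K L : M.Cell}
    {i : Fin d} {s : Bool} (hn : M.nbr K i s = some L) (j : Fin d) :
    |M.center L j - M.center K j| ≤ h := by
  by_cases hj : j = i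
  · subst hj
    have h1 := M.faceCoord_sub_center K j s
    have h2 := M.faceCoord_sub_center L j (!s)
    rw [faceCoord_nbr hn, side_not] at h2
    have e : M.center L j - M.center K j = side s * (M.width K j / 2 + M.width L j / 2) := by
      linarith
    have hK := M.width_pos K j
    have hL := M.width_pos L j
    rw [e, abs_mul, abs_side, one_mul, abs_of_pos (by linarith)]
    linarith [hw K j, hw L j]
  · rw [center_nbr hn hj]; simpa using hh

lemma discreteBV_eq (δt : ℝ) (N : ℕ) (ρ : ℕ → M.CellField) :
    M.discreteBV δt N ρ = ∑ n ∈ Finset.range (N + 1), δt * M.bvSum (ρ n) := by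
  unfold discreteBV bvSum sumFaces
  refine Finset.sum_congr rfl fun n _ => ?_
  congr 1
  rw [Finset.sum_comm]
  refine Finset.sum_congr rfl fun i _ => Finset.sum_congr rfl fun K _ => ?_
  cases M.nbr K i true <;> rfl

lemma sum_bvSum_le {δt : ℝ} (hδ : 0 ≤ δt) (N : ℕ) (ρ : ℕ → M.CellField) :
    ∑ n ∈ Finset.range N, δt * M.bvSum (ρ n) ≤ M.discreteBV δt N ρ ∧
    ∑ n ∈ Finset.range N, δt * M.bvSum (ρ (n + 1)) ≤ M.discreteBV δt N ρ := by
  have h := fun n => mul_nonneg hδ (bvSum_nonneg (ρ n))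
  rw [discreteBV_eq]
  constructor
  · rw [Finset.sum_range_succ]; linarith [h N]
  · rw [Finset.sum_range_succ']; linarith [h 0]

section

variable {δt T B h : ℝ} {N : ℕ}

lemma measure_spaceTime_ne_top (hbdd : Bornology.IsBounded Ω) :
    volume (spaceTime T Ω) ≠ ⊤ := by
  rw [spaceTime, Measure.volume_eq_prod, Measure.prod_prod]
  exact ENNReal.mul_ne_top (by simp) (volume_lt_top hbdd).ne

lemma ae_of_forall_timeCell (M : MACMesh d Ω) (i : Fin d) (hδ : 0 < δt) (hT : N * δt = T)
    (hΩ : MeasurableSet Ω) {p : ℝ × (Fin d → ℝ) → Prop}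
    (hp : ∀ n < N, ∀ K s, ∀ z ∈ M.timeCell δt i n K s, p z) :
    ∀ᵐ z ∂volume.restrict (spaceTime T Ω), p z := by
  have hm : MeasurableSet (spaceTime T Ω) := measurableSet_Ioo.prod hΩ
  rw [ae_restrict_iff' hm]
  filter_upwards [ae_exists_mem_timeCell M i hδ hT] with z hz hzS
  obtain ⟨q, hq⟩ := hz hzS
  exact hp _ q.1.2 _ _ z hq

lemma ae_abs_le_of_timeCell (M : MACMesh d Ω) (i : Fin d) (hδ : 0 < δt) (hT : N * δt = T)
    (hΩ : MeasurableSet Ω) {F : ℝ × (Fin d → ℝ) → ℝ}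
    (hF : ∀ n < N, ∀ K s, ∀ z ∈ M.timeCell δt i n K s, |F z| ≤ B) :
    ∀ᵐ z ∂volume.restrict (spaceTime T Ω), |F z| ≤ B :=
  ae_of_forall_timeCell M i hδ hT hΩ hF

lemma sum_time_vol (hT : N * δt = T) (c : ℝ) :
    ∑ _n ∈ Finset.range N, δt * (c * ∑ K, M.vol K) = T * (c * ∑ K, M.vol K) := by
  rw [Finset.sum_const, Finset.card_range, nsmul_eq_mul, ← mul_assoc, hT]

/-- The distance of a discrete velocity to a slowly varying function. -/
lemma sum_abs_sub_le (hreg : interior (closure Ω) = Ω) (hδ : 0 < δt) (hT : N * δt = T) {i : Fin d}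
    {u : ℕ → M.FaceField} {φ : ℝ × (Fin d → ℝ) → ℝ} {κ : ℝ}
    (hint : IntegrableOn (fun z => M.faceFun δt u z i - φ z) (spaceTime T Ω))
    (hφ : ∀ n < N, ∀ K s, ∀ z ∈ M.timeCell δt i n K s, |φ z - φ (n * δt, M.center K)| ≤ κ) :
    ∑ n ∈ Finset.range N, δt * ∑ K, ∑ s, M.vol K * |u n K i s - φ (n * δt, M.center K)| ≤
      2 * ((∫ z in spaceTime T Ω, |M.faceFun δt u z i - φ z|) + T * (κ * ∑ K, M.vol K)) := by
  have h1 := sum_le_setIntegral_spaceTime hreg hδ hT (i := i) hint.abs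
    (a := fun n K s => |u n K i s - φ (n * δt, M.center K)| - κ) (fun n hn K s z hz => by
      rw [faceFun_of_mem hδ u hz]
      have h2 := hφ n hn K s z hz
      have h3 := abs_sub_le (u n K i s) (φ z) (φ (n * δt, M.center K))
      linarith)
  -- The factor two arises because full cell volumes are attached to both sides, whereas each
  -- space-time cell only has half of that volume.
  have h2 : ∑ n ∈ Finset.range N, δt * ∑ K, ∑ s,
      M.vol K * |u n K i s - φ (n * δt, M.center K)| =
      2 * (∑ n ∈ Finset.range N, ∑ K, ∑ s, δt * (M.vol K / 2) *
        (|u n K i s - φ (n * δt, M.center K)| - κ)) + 2 * (T * (κ * ∑ K, M.vol K)) := by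
    rw [← sum_time_vol hT, Finset.mul_sum, Finset.mul_sum, ← Finset.sum_add_distrib]
    refine Finset.sum_congr rfl fun n _ => ?_
    simp only [Finset.mul_sum, ← Finset.sum_add_distrib]
    refine Finset.sum_congr rfl fun K _ => ?_
    simp only [Fintype.sum_bool]
    ring
  linarith

end

end MACMesh

section limit

variable {d : ℕ} {Ω : Set (Fin d → ℝ)} {M : ℕ → MACMesh d Ω} {δt h : ℕ → ℝ} {N : ℕ → ℕ} {T B C : ℝ}
  {η : ∀ m, ℕ → (M m).FaceField} {ρ : ∀ m, ℕ → (M m).CellField} {u : ∀ m, ℕ → (M m).FaceField}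

open MACMesh

/-- The velocity oscillation is handled by approximation: the limit velocity is replaced by a
continuous compactly supported function `φ`, which varies by at most `ε` over distances of order
`h`, and the discrete velocity is close to it in `L¹`. The BV terms carry an explicit factor `h`. -/
lemma tendsto_totalError (hreg : interior (closure Ω) = Ω) (hbdd : Bornology.IsBounded Ω)
    (hd : 0 < d) (hT0 : 0 < T) (hδ : ∀ m, 0 < δt m) (hT : ∀ m, N m * δt m = T)
    (hh : Tendsto h atTop (𝓝 0)) (hB : 0 ≤ B)
    (hS : ∀ᶠ m in atTop, ∀ n < N m,
      StepBounds (M m) (δt m) B (h m) (η m n) (ρ m n) (ρ m (n + 1)) (u m n))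
    (hvol : ∀ m K j s L, (M m).nbr K j s = some L → (M m).vol K ≤ B * (M m).vol L)
    (hBV : ∀ m, (M m).discreteBV (δt m) (N m) (ρ m) ≤ C)
    {U : ℝ × (Fin d → ℝ) → Fin d → ℝ}
    (hU : ∀ i, IntegrableOn (fun z => U z i) (spaceTime T Ω))
    (hint : ∀ᶠ m in atTop, ∀ i, IntegrableOn (fun z => (M m).faceFun (δt m) (u m) z i)
      (spaceTime T Ω))
    (hconv : ∀ i, Tendsto (fun m => ∫ z in spaceTime T Ω,
      |(M m).faceFun (δt m) (u m) z i - U z i|) atTop (𝓝 0)) :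
    Tendsto (fun m => (M m).totalError (δt m) (h m) (N m) (ρ m) (u m)) atTop (𝓝 0) := by
  set V := (volume Ω).toReal with hV
  have hsum : ∀ m, ∑ K, (M m).vol K = V := fun m => sum_vol (M m) hreg hbdd ⟨0, hd⟩
  have hV0 : 0 ≤ V := ENNReal.toReal_nonneg
  -- The constant collects the coefficients of `ε`: the distance of the velocity to `φ`, the
  -- variation of `φ` between neighbours, two BV terms from the oscillation and one from the
  -- pressure correction, and finally the plain term `h`.
  refine tendsto_zero_of_forall_eventually_le
    (C := (1 + 2 * d * (1 + B)) * (d * (2 * (2 + T * V))) + 4 * d ^ 2 * (T * V) + 3 * |C| + T * V)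
    (by positivity) ?_
  intro ε hε
  have hφ : ∀ i, ∃ g : ℝ × (Fin d → ℝ) → ℝ, HasCompactSupport g ∧
      ∫ z in spaceTime T Ω, ‖U z i - g z‖ ≤ ε ∧ Continuous g ∧
      Integrable g (volume.restrict (spaceTime T Ω)) := fun i =>
    (hU i).exists_hasCompactSupport_integral_sub_le hε
  choose φ hφc hφU hφcont hφint using hφ
  have hunif : ∀ i, ∃ r > 0, ∀ x y, ‖x - y‖ < r → |φ i x - φ i y| ≤ ε := by
    intro i
    obtain ⟨r, hr, hr'⟩ := Metric.uniformContinuous_iff.1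
      ((hφc i).uniformContinuous_of_continuous (hφcont i)) ε hε
    refine ⟨r, hr, fun x y hxy => ?_⟩
    have := hr' (by rwa [dist_eq_norm] : dist x y < r)
    rw [Real.dist_eq] at this
    exact this.le
  choose r hr hrφ using hunif
  have hhr : ∀ᶠ m in atTop, ∀ i, h m < r i := eventually_all.2 fun i =>
    hh.eventually (gt_mem_nhds (hr i))
  have hhε : ∀ᶠ m in atTop, h m < ε := hh.eventually (gt_mem_nhds hε)
  have hcε : ∀ᶠ m in atTop, ∀ i, ∫ z in spaceTime T Ω,
      |(M m).faceFun (δt m) (u m) z i - U z i| < ε := eventually_all.2 fun i =>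
    (hconv i).eventually (gt_mem_nhds hε)
  filter_upwards [hS, hint, hhr, hhε, hcε] with m hS hint hhr hhε hcε
  have hN : 0 < N m := by
    rcases Nat.eq_zero_or_pos (N m) with h0 | h0
    · have := hT m; rw [h0] at this; simp at this; linarith
    · exact h0
  have S0 := hS 0 hN
  have hh0 := S0.h_pos
  have hw := S0.width_le
  have hδm := hδ m
  have hosc : ∀ n ∈ Finset.range (N m), δt m * ∑ K, (M m).vol K * (M m).osc (ρ m n) (u m n) K ≤
      δt m * ((1 + 2 * d * (1 + B)) * (∑ i, ∑ K, ∑ s,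
        (M m).vol K * |u m n K i s - φ i (n * δt m, (M m).center K)|) +
        4 * d ^ 2 * ε * (∑ K, (M m).vol K) + 2 * h m * (M m).bvSum (ρ m n)) := by
    intro n _
    gcongr
    refine sum_vol_mul_osc_le hreg hB hw (hvol m) (ρ m n) (u m n)
      (r := fun i K => φ i (n * δt m, (M m).center K)) hε.le ?_
    intro i K j s L hL
    apply hrφ
    refine lt_of_le_of_lt (norm_prod_sub_le hh0.le (by simpa using hh0.le) ?_) (hhr i)
    exact fun k => abs_center_sub_le hw hh0.le hL k
  have hR : ∀ i ∈ Finset.univ, ∑ n ∈ Finset.range (N m), δt m * ∑ K, ∑ s,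
      (M m).vol K * |u m n K i s - φ i (n * δt m, (M m).center K)| ≤ 2 * (2 + T * V) * ε := by
    intro i _
    have h1 := sum_abs_sub_le (M := M m) hreg hδm (hT m) (i := i) (u := u m) (φ := φ i) (κ := ε)
      ((hint i).sub (hφint i)) (fun n hn K s z hz => hrφ i _ _ (lt_of_le_of_lt
        (norm_sub_le_of_mem_timeCell hh0.le hw S0.δt_le_h hz) (hhr i)))
    rw [hsum m] at h1
    have h2 : ∫ z in spaceTime T Ω, |(M m).faceFun (δt m) (u m) z i - φ i z| ≤
        (∫ z in spaceTime T Ω, |(M m).faceFun (δt m) (u m) z i - U z i|) +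
          ∫ z in spaceTime T Ω, ‖U z i - φ i z‖ := by
      have i1 : IntegrableOn (fun z => |(M m).faceFun (δt m) (u m) z i - U z i|)
          (spaceTime T Ω) := ((hint i).sub (hU i)).abs
      have i2 : IntegrableOn (fun z => ‖U z i - φ i z‖) (spaceTime T Ω) :=
        ((hU i).sub (hφint i)).norm
      rw [← integral_add i1 i2]
      apply integral_mono_of_nonneg (Eventually.of_forall fun z => abs_nonneg _) (i1.add i2)
      exact Eventually.of_forall fun z => abs_sub_le _ _ _
    have h3 := hφU i
    have h4 := hcε i
    nlinarith
  obtain ⟨hbv1, hbv2⟩ := sum_bvSum_le hδm.le (N m) (ρ m)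
  have hCm := (hBV m).trans (le_abs_self C)
  have hnonneg : 0 ≤ (M m).totalError (δt m) (h m) (N m) (ρ m) (u m) := by
    refine Finset.sum_nonneg fun n _ => mul_nonneg hδm.le (add_nonneg ?_ ?_)
    · exact Finset.sum_nonneg fun K _ => mul_nonneg ((M m).vol_pos K).le
        (add_nonneg (osc_nonneg _ _ K) hh0.le)
    · exact mul_nonneg hh0.le (bvSum_nonneg _)
  rw [abs_of_nonneg hnonneg]
  have e1 : (M m).totalError (δt m) (h m) (N m) (ρ m) (u m) =
      (∑ n ∈ Finset.range (N m), δt m * ∑ K, (M m).vol K * (M m).osc (ρ m n) (u m n) K) +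
      T * (h m * V) + h m * ∑ n ∈ Finset.range (N m), δt m * (M m).bvSum (ρ m (n + 1)) := by
    rw [← hsum m, ← sum_time_vol (hT m), totalError, Finset.mul_sum (Finset.range (N m)), ← Finset.sum_add_distrib,
      ← Finset.sum_add_distrib]
    refine Finset.sum_congr rfl fun n _ => ?_
    simp only [mul_add, Finset.sum_add_distrib, ← Finset.sum_mul]
    ring
  have e2 : ∑ n ∈ Finset.range (N m), δt m * ((1 + 2 * d * (1 + B)) * (∑ i, ∑ K, ∑ s,
        (M m).vol K * |u m n K i s - φ i (n * δt m, (M m).center K)|) +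
        4 * d ^ 2 * ε * (∑ K, (M m).vol K) + 2 * h m * (M m).bvSum (ρ m n)) =
      (1 + 2 * d * (1 + B)) * (∑ i, ∑ n ∈ Finset.range (N m), δt m * ∑ K, ∑ s,
        (M m).vol K * |u m n K i s - φ i (n * δt m, (M m).center K)|) +
      T * (4 * d ^ 2 * ε * V) +
      2 * h m * ∑ n ∈ Finset.range (N m), δt m * (M m).bvSum (ρ m n) := by
    rw [Finset.sum_comm, ← hsum m, ← sum_time_vol (hT m), Finset.mul_sum (Finset.range (N m)),
      Finset.mul_sum (Finset.range (N m)),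
      ← Finset.sum_add_distrib, ← Finset.sum_add_distrib]
    refine Finset.sum_congr rfl fun n _ => ?_
    rw [← Finset.mul_sum]
    ring
  rw [e1]
  have h1 := Finset.sum_le_sum hosc
  rw [e2] at h1
  have h2 := Finset.sum_le_sum hR
  rw [Finset.sum_const, Finset.card_univ, Fintype.card_fin, nsmul_eq_mul] at h2
  have h3 : (1 + 2 * d * (1 + B)) * (∑ i, ∑ n ∈ Finset.range (N m), δt m * ∑ K, ∑ s,
        (M m).vol K * |u m n K i s - φ i (n * δt m, (M m).center K)|) ≤
      (1 + 2 * d * (1 + B)) * (d * (2 * (2 + T * V) * ε)) := by gcongr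
  have h4 : 2 * h m * ∑ n ∈ Finset.range (N m), δt m * (M m).bvSum (ρ m n) ≤ 2 * ε * |C| := by
    have : 0 ≤ ∑ n ∈ Finset.range (N m), δt m * (M m).bvSum (ρ m n) :=
      Finset.sum_nonneg fun n _ => mul_nonneg hδm.le (bvSum_nonneg _)
    gcongr
    exact hbv1.trans hCm
  have h5 : h m * ∑ n ∈ Finset.range (N m), δt m * (M m).bvSum (ρ m (n + 1)) ≤ ε * |C| := by
    have : 0 ≤ ∑ n ∈ Finset.range (N m), δt m * (M m).bvSum (ρ m (n + 1)) :=
      Finset.sum_nonneg fun n _ => mul_nonneg hδm.le (bvSum_nonneg _)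
    gcongr
    exact hbv2.trans hCm
  have h6 : T * (h m * V) ≤ T * (ε * V) := by gcongr
  linarith

end limit

/-! ## Bounded sequences converging in `L¹` -/

/-- Convergence in `L¹` of a uniformly bounded sequence of functions. -/
structure BoundedL1Limit {α : Type*} [MeasurableSpace α] (μ : Measure α) (f : ℕ → α → ℝ)
    (g : α → ℝ) : Prop where
  meas : ∀ m, AEStronglyMeasurable (f m) μ
  meas_lim : AEStronglyMeasurable g μ
  bound : ∃ B, (∀ m, ∀ᵐ z ∂μ, |f m z| ≤ B) ∧ ∀ᵐ z ∂μ, |g z| ≤ B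
  lim : Tendsto (fun m => ∫ z, |f m z - g z| ∂μ) atTop (𝓝 0)

namespace BoundedL1Limit

variable {α : Type*} [MeasurableSpace α] {μ : Measure α} {f f' : ℕ → α → ℝ}
  {g g' : α → ℝ}

lemma const (hg : AEStronglyMeasurable g μ) {B : ℝ} (hB : ∀ z, |g z| ≤ B) :
    BoundedL1Limit μ (fun _ => g) g where
  meas _ := hg
  meas_lim := hg
  bound := ⟨B, fun _ => Eventually.of_forall hB, Eventually.of_forall hB⟩
  lim := by simp

variable [IsFiniteMeasure μ]

lemma integrable (h : BoundedL1Limit μ f g) (m : ℕ) : Integrable (f m) μ := by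
  obtain ⟨B, hB, _⟩ := h.bound
  exact Integrable.of_bound (h.meas m) B (hB m)

lemma integrable_lim (h : BoundedL1Limit μ f g) : Integrable g μ := by
  obtain ⟨B, _, hB⟩ := h.bound
  exact Integrable.of_bound h.meas_lim B hB

/-- In `f f' - g g' = f (f' - g') + g' (f - g)` one factor of each summand is bounded uniformly in
`m`, so `L¹` convergence is stable under products. -/
lemma mul (h : BoundedL1Limit μ f g) (h' : BoundedL1Limit μ f' g') :
    BoundedL1Limit μ (fun m z => f m z * f' m z) (fun z => g z * g' z) := by
  obtain ⟨B, hB, hBg⟩ := h.bound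
  obtain ⟨B', hB', hBg'⟩ := h'.bound
  refine ⟨fun m => (h.meas m).mul (h'.meas m), h.meas_lim.mul h'.meas_lim, ⟨|B| * |B'|, ?_, ?_⟩, ?_⟩
  · intro m
    filter_upwards [hB m, hB' m] with z h1 h2
    rw [abs_mul]
    exact mul_le_mul (h1.trans (le_abs_self B)) (h2.trans (le_abs_self B')) (abs_nonneg _)
      (abs_nonneg _)
  · filter_upwards [hBg, hBg'] with z h1 h2
    rw [abs_mul]
    exact mul_le_mul (h1.trans (le_abs_self B)) (h2.trans (le_abs_self B')) (abs_nonneg _)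
      (abs_nonneg _)
  · have hlim : Tendsto (fun m => |B| * (∫ z, |f' m z - g' z| ∂μ) +
        |B'| * ∫ z, |f m z - g z| ∂μ) atTop (𝓝 0) := by
      simpa using (h'.lim.const_mul |B|).add (h.lim.const_mul |B'|)
    refine squeeze_zero (fun m => integral_nonneg fun z => abs_nonneg _) (fun m => ?_) hlim
    have i1 : Integrable (fun z => |f' m z - g' z|) μ := ((h'.integrable m).sub h'.integrable_lim).abs
    have i2 : Integrable (fun z => |f m z - g z|) μ := ((h.integrable m).sub h.integrable_lim).abs
    rw [← integral_const_mul, ← integral_const_mul, ← integral_add (i1.const_mul _) (i2.const_mul _)]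
    refine integral_mono_of_nonneg (Eventually.of_forall fun z => abs_nonneg _)
      ((i1.const_mul _).add (i2.const_mul _)) ?_
    filter_upwards [hB m, hBg'] with z h1 h2
    have e : f m z * f' m z - g z * g' z = f m z * (f' m z - g' z) + g' z * (f m z - g z) := by ring
    rw [e]
    refine (abs_add_le _ _).trans ?_
    rw [abs_mul, abs_mul]
    exact add_le_add
      (mul_le_mul_of_nonneg_right (h1.trans (le_abs_self B)) (abs_nonneg _))
      (mul_le_mul_of_nonneg_right (h2.trans (le_abs_self B')) (abs_nonneg _))

lemma tendsto_integral (h : BoundedL1Limit μ f g) :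
    Tendsto (fun m => ∫ z, f m z ∂μ) atTop (𝓝 (∫ z, g z ∂μ)) := by
  rw [tendsto_iff_dist_tendsto_zero]
  refine squeeze_zero (fun m => dist_nonneg) (fun m => ?_) h.lim
  rw [Real.dist_eq, ← integral_sub (h.integrable m) h.integrable_lim]
  exact abs_integral_le_integral_abs

end BoundedL1Limit

/-! ### Essential bounds, `L¹` norms and moduli of continuity -/

lemma exists_ae_abs_le {α : Type*} [MeasurableSpace α] {μ : Measure α} {f : α → ℝ}
    (hf : MemLp f ⊤ μ) : ∃ B, ∀ᵐ z ∂μ, |f z| ≤ B := by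
  refine ⟨(eLpNormEssSup f μ).toReal, ?_⟩
  have hfin : eLpNormEssSup f μ ≠ ⊤ := by
    have := hf.2; rw [eLpNorm_exponent_top] at this; exact this.ne
  filter_upwards [ae_le_eLpNormEssSup (f := f) (μ := μ)] with z hz
  have := (ENNReal.toReal_le_toReal (by simp) hfin).2 hz
  simpa using this

lemma tendsto_integral_abs_of_eLpNorm {α : Type*} [MeasurableSpace α] {μ : Measure α}
    {f : ℕ → α → ℝ} (hf : ∀ m, AEStronglyMeasurable (f m) μ)
    (h : Tendsto (fun m => eLpNorm (f m) 1 μ) atTop (𝓝 0)) :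
    Tendsto (fun m => ∫ z, |f m z| ∂μ) atTop (𝓝 0) := by
  have h1 : ∀ m, ∫ z, |f m z| ∂μ = (eLpNorm (f m) 1 μ).toReal := by
    intro m
    rw [eLpNorm_one_eq_lintegral_enorm]
    simpa only [Real.norm_eq_abs] using integral_norm_eq_lintegral_enorm (hf m)
  simp only [h1]
  simpa [Function.comp_def] using (ENNReal.tendsto_toReal ENNReal.zero_ne_top).comp h

lemma exists_modulus {E : Type*} [NormedAddCommGroup E] {g : E → ℝ} (hg : Continuous g)
    (hc : HasCompactSupport g) {ε : ℝ} (hε : 0 < ε) :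
    ∃ r > 0, ∀ x y, ‖x - y‖ < r → |g x - g y| ≤ ε := by
  obtain ⟨r, hr, hr'⟩ := Metric.uniformContinuous_iff.1
    (hc.uniformContinuous_of_continuous hg) ε hε
  refine ⟨r, hr, fun x y hxy => ?_⟩
  have := hr' (by rwa [dist_eq_norm] : dist x y < r)
  rw [Real.dist_eq] at this
  exact this.le

namespace MACMesh

variable {d : ℕ} {Ω : Set (Fin d → ℝ)}

/-! ## Passage to the limit in discrete sums -/

/-- On each space-time cell `F` is constant and `g` is within `κ` of its sampled value. The
direction `i` merely selects the way in which the cells are halved. -/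
lemma abs_sum_sub_integral_le {M : MACMesh d Ω} {δt T B κ : ℝ} {N : ℕ}
    (hreg : interior (closure Ω) = Ω) (i : Fin d) (hδ : 0 < δt) (hT : N * δt = T)
    {a : ℕ → M.CellField} {F g : ℝ × (Fin d → ℝ) → ℝ} (ha : ∀ n < N, ∀ K, |a n K| ≤ B)
    (hF : ∀ n < N, ∀ K s, ∀ z ∈ M.timeCell δt i n K s, F z = a n K)
    (hg : ∀ n < N, ∀ K s, ∀ z ∈ M.timeCell δt i n K s, |g z - g (n * δt, M.center K)| ≤ κ)
    (hint : IntegrableOn (fun z => F z * g z) (spaceTime T Ω)) :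
    |(∑ n ∈ Finset.range N, δt * ∑ K, M.vol K * (a n K * g (n * δt, M.center K))) -
      ∫ z in spaceTime T Ω, F z * g z| ≤ T * (B * κ * ∑ K, M.vol K) := by
  have key : ∀ n < N, ∀ K s, ∀ z ∈ M.timeCell δt i n K s,
      |F z * g z - a n K * g (n * δt, M.center K)| ≤ B * κ := by
    intro n hn K s z hz
    rw [hF n hn K s z hz, ← mul_sub, abs_mul]
    have h1 := ha n hn K
    have h2 := hg n hn K s z hz
    have : 0 ≤ B := (abs_nonneg _).trans h1
    gcongr
  have h1 := sum_le_setIntegral_spaceTime hreg (i := i) hδ hT hint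
    (a := fun n K _ => a n K * g (n * δt, M.center K) - B * κ) (fun n hn K s z hz => by
      have := (abs_le.1 (key n hn K s z hz)).1
      linarith)
  have h2 := setIntegral_spaceTime_le_sum hreg (i := i) hδ hT hint
    (a := fun n K _ => a n K * g (n * δt, M.center K) + B * κ) (fun n hn K s z hz => by
      have := (abs_le.1 (key n hn K s z hz)).2
      linarith)
  have e : ∀ c : ℝ, ∑ n ∈ Finset.range N, ∑ K, ∑ _s : Bool, δt * (M.vol K / 2) *
      (a n K * g (n * δt, M.center K) + c) =
      (∑ n ∈ Finset.range N, δt * ∑ K, M.vol K * (a n K * g (n * δt, M.center K))) +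
        T * (c * ∑ K, M.vol K) := by
    intro c
    rw [← sum_time_vol hT, ← Finset.sum_add_distrib]
    refine Finset.sum_congr rfl fun n _ => ?_
    simp only [Finset.mul_sum, ← Finset.sum_add_distrib, Fintype.sum_bool]
    refine Finset.sum_congr rfl fun K _ => ?_
    ring
  simp only [sub_eq_add_neg (_ * _) (B * κ), e] at h1 h2
  rw [abs_le]
  constructor <;> linarith

/-- Two limits are combined: sampling `g` at the base points is harmless by uniform continuity and
the uniform bound on `a`, and the integrals converge by the `L¹` convergence of the bounded
functions `F m`. -/
lemma tendsto_discrete_sum {M : ℕ → MACMesh d Ω} {δt h : ℕ → ℝ} {N : ℕ → ℕ} {T B : ℝ}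
    (hreg : interior (closure Ω) = Ω) (hbdd : Bornology.IsBounded Ω) (hd : 0 < d)
    (hδ : ∀ m, 0 < δt m) (hT : ∀ m, N m * δt m = T) (hδh : ∀ m, δt m ≤ h m)
    (hw : ∀ m K i, (M m).width K i ≤ h m) (hh : Tendsto h atTop (𝓝 0))
    {a : ∀ m, ℕ → (M m).CellField} (ha : ∀ m, ∀ n < N m, ∀ K, |a m n K| ≤ B)
    {F : ℕ → ℝ × (Fin d → ℝ) → ℝ} {f g : ℝ × (Fin d → ℝ) → ℝ}
    (hF : ∀ m, ∀ n < N m, ∀ i K s, ∀ z ∈ (M m).timeCell (δt m) i n K s, F m z = a m n K)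
    (hlim : BoundedL1Limit (volume.restrict (spaceTime T Ω)) F f)
    (hg : Continuous g) (hgc : HasCompactSupport g) :
    Tendsto (fun m => ∑ n ∈ Finset.range (N m), δt m * ∑ K, (M m).vol K *
      (a m n K * g (n * δt m, (M m).center K))) atTop (𝓝 (∫ z in spaceTime T Ω, f z * g z)) := by
  have : IsFiniteMeasure (volume.restrict (spaceTime T Ω)) :=
    isFiniteMeasure_restrict.2 (measure_spaceTime_ne_top hbdd)
  obtain ⟨Cg, hCg⟩ := hg.bounded_above_of_compact_support hgc
  have hFg := hlim.mul (BoundedL1Limit.const hg.aestronglyMeasurable hCg)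
  have h1 := hFg.tendsto_integral
  set V := (volume Ω).toReal with hV
  have hsum : ∀ m, ∑ K, (M m).vol K = V := fun m => sum_vol (M m) hreg hbdd ⟨0, hd⟩
  have h2 : Tendsto (fun m => (∑ n ∈ Finset.range (N m), δt m * ∑ K, (M m).vol K *
      (a m n K * g (n * δt m, (M m).center K))) - ∫ z in spaceTime T Ω, F m z * g z)
      atTop (𝓝 0) := by
    have hT0 : 0 ≤ T := by rw [← hT 0]; have := hδ 0; positivity
    have hV0 : 0 ≤ V := ENNReal.toReal_nonneg
    refine tendsto_zero_of_forall_eventually_le (C := T * (|B| * V)) (by positivity) ?_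
    intro ε hε
    obtain ⟨r, hr, hrg⟩ := exists_modulus hg hgc hε
    filter_upwards [hh.eventually (gt_mem_nhds hr)] with m hm
    have := abs_sum_sub_integral_le hreg ⟨0, hd⟩ (hδ m) (hT m) (B := |B|) (κ := ε) (F := F m)
      (g := g) (fun n hn K => (ha m n hn K).trans (le_abs_self B))
      (fun n hn K s z hz => hF m n hn _ K s z hz)
      (fun n hn K s z hz => hrg _ _ ((norm_sub_le_of_mem_timeCell
        ((hδ m).le.trans (hδh m)) (hw m) (hδh m) hz).trans_lt hm)) (hFg.integrable m)
    rw [hsum m] at this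
    linarith
  have := h2.add h1
  simpa using this

/-! ## Initial data -/

lemma abs_sum_setIntegral_sub_le {M : MACMesh d Ω} {κ : ℝ} (hreg : interior (closure Ω) = Ω)
    (i : Fin d) {f χ : (Fin d → ℝ) → ℝ} {p : M.Cell → Bool → ℝ} (hf : IntegrableOn f Ω)
    (hfχ : IntegrableOn (fun x => f x * χ x) Ω)
    (hp : ∀ K s, ∀ x ∈ M.halfCell K i s, |χ x - p K s| ≤ κ) :
    |(∑ K, ∑ s, p K s * ∫ x in M.halfCell K i s, f x) - ∫ x in Ω, f x * χ x| ≤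
      κ * ∫ x in Ω, |f x| := by
  rw [setIntegral_eq_sum_halfCell M hreg i hfχ, setIntegral_eq_sum_halfCell M hreg i hf.abs,
    ← Finset.sum_sub_distrib, Finset.mul_sum]
  refine (Finset.abs_sum_le_sum_abs _ _).trans (Finset.sum_le_sum fun K _ => ?_)
  rw [← Finset.sum_sub_distrib, Finset.mul_sum]
  refine (Finset.abs_sum_le_sum_abs _ _).trans (Finset.sum_le_sum fun s _ => ?_)
  have hsub : M.halfCell K i s ⊆ Ω :=
    (halfCell_subset_openBox K i s).trans (M.openBox_subset hreg K)
  have i1 := hf.mono_set hsub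
  have i2 := hfχ.mono_set hsub
  rw [← integral_const_mul, ← integral_sub (i1.const_mul _) i2, ← integral_const_mul]
  refine abs_integral_le_integral_abs.trans ?_
  refine setIntegral_mono_on ((i1.const_mul _).sub i2).abs (i1.abs.const_mul _)
    (measurableSet_halfCell K i s) fun x hx => ?_
  have e : p K s * f x - f x * χ x = -((χ x - p K s) * f x) := by ring
  rw [e, abs_neg, abs_mul]
  have := hp K s x hx
  gcongr

lemma norm_sub_le_of_mem_openBox {M : MACMesh d Ω} {h : ℝ} (hw : ∀ K i, M.width K i ≤ h)
    (hh : 0 ≤ h) {K : M.Cell} {x y : Fin d → ℝ} (hx : x ∈ Icc (M.lo K) (M.hi K))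
    (hy : y ∈ Icc (M.lo K) (M.hi K)) : ‖x - y‖ ≤ h := by
  rw [pi_norm_le_iff_of_nonneg hh]
  intro j
  have h1 := hx.1 j
  have h2 := hx.2 j
  have h3 := hy.1 j
  have h4 := hy.2 j
  have h5 := hw K j
  simp only [width] at h5
  rw [Pi.sub_apply, Real.norm_eq_abs, abs_le]
  constructor <;> linarith

lemma openBox_subset_Icc (lo hi : Fin d → ℝ) : openBox lo hi ⊆ Icc lo hi := by
  intro x hx
  rw [openBox_mem_iff] at hx
  exact ⟨fun j => (hx j).1.le, fun j => (hx j).2.le⟩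

lemma center_mem_closedBox {M : MACMesh d Ω} (K : M.Cell) :
    M.center K ∈ Icc (M.lo K) (M.hi K) :=
  ⟨fun j => (M.center_mem_Icc K j).1.le, fun j => (M.center_mem_Icc K j).2.le⟩

/-- A cell average times the volume is the exact integral of `ρ₀`, so the only error is the
variation of `χ` inside a cell. -/
lemma tendsto_initial_mass {M : ℕ → MACMesh d Ω} {h : ℕ → ℝ}
    (hreg : interior (closure Ω) = Ω) (hd : 0 < d) (hh0 : ∀ m, 0 ≤ h m)
    (hw : ∀ m K i, (M m).width K i ≤ h m) (hh : Tendsto h atTop (𝓝 0))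
    {ρ₀ χ : (Fin d → ℝ) → ℝ} (hρ₀ : IntegrableOn ρ₀ Ω) (hχ : Continuous χ)
    (hχc : HasCompactSupport χ) {ρ : ∀ m, (M m).CellField}
    (hρ : ∀ m K, ρ m K = (∫ x in openBox ((M m).lo K) ((M m).hi K), ρ₀ x) / (M m).vol K) :
    Tendsto (fun m => ∑ K, (M m).vol K * (ρ m K * χ ((M m).center K))) atTop
      (𝓝 (∫ x in Ω, ρ₀ x * χ x)) := by
  let i : Fin d := ⟨0, hd⟩
  obtain ⟨Cg, hCg⟩ := hχ.bounded_above_of_compact_support hχc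
  have hint : IntegrableOn (fun x => ρ₀ x * χ x) Ω :=
    hρ₀.mul_bdd (c := Cg) hχ.aestronglyMeasurable (Eventually.of_forall hCg)
  have e : ∀ m, ∑ K, (M m).vol K * (ρ m K * χ ((M m).center K)) =
      ∑ K, ∑ s, χ ((M m).center K) * ∫ x in (M m).halfCell K i s, ρ₀ x := by
    intro m
    refine Finset.sum_congr rfl fun K _ => ?_
    have hv := (M m).vol_pos K
    rw [← Finset.mul_sum, ← setIntegral_openBox_eq (M m) K i
      (hρ₀.mono_set ((M m).openBox_subset hreg K)), hρ m K]
    field_simp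
  simp only [e]
  rw [← tendsto_sub_nhds_zero_iff]
  refine tendsto_zero_of_forall_eventually_le (C := ∫ x in Ω, |ρ₀ x|)
    (integral_nonneg fun x => abs_nonneg _) ?_
  intro ε hε
  obtain ⟨r, hr, hrg⟩ := exists_modulus hχ hχc hε
  filter_upwards [hh.eventually (gt_mem_nhds hr)] with m hm
  have := abs_sum_setIntegral_sub_le (M := M m) hreg i (χ := χ)
    (p := fun K _ => χ ((M m).center K)) hρ₀ hint (κ := ε) (fun K s x hx =>
      hrg _ _ ((norm_sub_le_of_mem_openBox (hw m) (hh0 m)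
        (openBox_subset_Icc _ _ (halfCell_subset_openBox K i s hx))
        (center_mem_closedBox K)).trans_lt hm))
  linarith

/-- The averages of an integrable function over the cells are close to a slowly varying
approximation of it. -/
lemma sum_vol_mul_abs_average_sub_le {M : MACMesh d Ω} {κ : ℝ} (hreg : interior (closure Ω) = Ω)
    (hbdd : Bornology.IsBounded Ω) (i : Fin d) {f φ : (Fin d → ℝ) → ℝ}
    (hf : IntegrableOn f Ω) (hφ : IntegrableOn φ Ω) {p : M.Cell → Bool → ℝ}
    (hp : ∀ K s, ∀ x ∈ openBox (M.lo K) (M.hi K), |φ x - p K s| ≤ κ) :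
    ∑ K, ∑ s, M.vol K / 2 *
        |(∫ x in openBox (M.lo K) (M.hi K), f x) / M.vol K - p K s| ≤
      (∫ x in Ω, |f x - φ x|) + κ * (volume Ω).toReal := by
  have i0 : IntegrableOn (fun x => |f x - φ x|) Ω := (hf.sub hφ).abs
  rw [← sum_vol M hreg hbdd i, setIntegral_eq_sum_halfCell M hreg i i0, Finset.mul_sum,
    ← Finset.sum_add_distrib]
  refine Finset.sum_le_sum fun K _ => ?_
  have hsub := M.openBox_subset hreg K
  rw [← setIntegral_openBox_eq M K i (i0.mono_set hsub)]
  have hv := M.vol_pos K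
  have hvol : (volume (openBox (M.lo K) (M.hi K))).toReal = M.vol K :=
    volume_real_openBox fun j => (M.lo_lt_hi K j).le
  have hfin : volume (openBox (M.lo K) (M.hi K)) ≠ ⊤ := by
    intro h; rw [h, ENNReal.toReal_top] at hvol; linarith
  have key : ∀ s, M.vol K * |(∫ x in openBox (M.lo K) (M.hi K), f x) / M.vol K - p K s| ≤
      (∫ x in openBox (M.lo K) (M.hi K), |f x - φ x|) + κ * M.vol K := by
    intro s
    have i1 := hf.mono_set hsub
    have i2 := i0.mono_set hsub
    have ic : ∀ c : ℝ, IntegrableOn (fun _ => c) (openBox (M.lo K) (M.hi K)) := fun c =>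
      integrableOn_const hfin
    have e1 : M.vol K * |(∫ x in openBox (M.lo K) (M.hi K), f x) / M.vol K - p K s| =
        |∫ x in openBox (M.lo K) (M.hi K), (f x - p K s)| := by
      rw [integral_sub i1 (ic _), setIntegral_const, smul_eq_mul, Measure.real, hvol,
        ← abs_of_pos hv, ← abs_mul, abs_of_pos hv]
      congr 1
      field_simp
    have e2 : κ * M.vol K = ∫ _x in openBox (M.lo K) (M.hi K), κ := by
      rw [setIntegral_const, smul_eq_mul, Measure.real, hvol, mul_comm]
    rw [e1, e2, ← integral_add i2 (ic _)]
    refine abs_integral_le_integral_abs.trans ?_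
    refine setIntegral_mono_on (i1.sub (ic _)).abs (i2.add (ic _)) (measurableSet_openBox _ _)
      fun x hx => ?_
    have h1 := hp K s x hx
    have h2 := abs_sub_le (f x) (φ x) (p K s)
    linarith
  rw [Fintype.sum_bool]
  linarith [key true, key false]

/-- The averages of `ρ₀` and `u₀` are taken over different sets, so their product is not an average.
A continuous `φ` close to `ρ₀` in `L¹` is substituted for the density average; the remaining
velocity average is then integrated exactly over the dual cells, and `φ` is finally replaced by
`ρ₀`. -/
lemma tendsto_initial_momentum {M : ℕ → MACMesh d Ω} {h : ℕ → ℝ} {B : ℝ}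
    (hreg : interior (closure Ω) = Ω) (hbdd : Bornology.IsBounded Ω) (hh0 : ∀ m, 0 ≤ h m)
    (hw : ∀ m K i, (M m).width K i ≤ h m) (hh : Tendsto h atTop (𝓝 0)) (i : Fin d)
    {ρ₀ u₀ χ : (Fin d → ℝ) → ℝ} (hρ₀ : MemLp ρ₀ ⊤ (volume.restrict Ω))
    (hu₀ : MemLp u₀ ⊤ (volume.restrict Ω)) (hχ : Continuous χ) (hχc : HasCompactSupport χ)
    (hχtan : ∀ x, HasAxisNormal Ω i x → χ x = 0)
    {ρ : ∀ m, (M m).CellField} {u : ∀ m, (M m).FaceField}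
    (hρ : ∀ m K, ρ m K = (∫ x in openBox ((M m).lo K) ((M m).hi K), ρ₀ x) / (M m).vol K)
    (huB : ∀ m K s, |u m K i s| ≤ B) (huf : ∀ m, (M m).IsFaceField (u m))
    (hu : ∀ m K L, (M m).nbr K i true = some L →
      u m K i true = ((∫ x in (M m).halfCell K i true, u₀ x) +
        ∫ x in (M m).halfCell L i false, u₀ x) / (M m).dualVol K i true) :
    Tendsto (fun m => ∑ K, ∑ s, (M m).vol K / 2 * (ρ m K * u m K i s) *
      χ ((M m).faceCenter K i s)) atTop (𝓝 (∫ x in Ω, ρ₀ x * u₀ x * χ x)) := by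
  have : IsFiniteMeasure (volume.restrict Ω) :=
    isFiniteMeasure_restrict.2 (volume_lt_top hbdd).ne
  have hρi : IntegrableOn ρ₀ Ω := hρ₀.integrable le_top
  have hui : IntegrableOn u₀ Ω := hu₀.integrable le_top
  obtain ⟨Cχ, hCχ⟩ := hχ.bounded_above_of_compact_support hχc
  obtain ⟨Cu, hCu⟩ := exists_ae_abs_le hu₀
  obtain ⟨Cρ, hCρ⟩ := exists_ae_abs_le hρ₀
  set V := (volume Ω).toReal with hV
  have hV0 : 0 ≤ V := ENNReal.toReal_nonneg
  rw [← tendsto_sub_nhds_zero_iff]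
  refine tendsto_zero_of_forall_eventually_le
    (C := |B| * |Cχ| * (1 + V) + (∫ x in Ω, |u₀ x|) + |Cu| * |Cχ|) ?_ ?_
  · have : 0 ≤ ∫ x in Ω, |u₀ x| := integral_nonneg fun x => abs_nonneg _
    positivity
  intro ε hε
  obtain ⟨φ, hφc, hφρ, hφ, hφi⟩ := hρi.exists_hasCompactSupport_integral_sub_le hε
  obtain ⟨Cφ, hCφ⟩ := hφ.bounded_above_of_compact_support hφc
  obtain ⟨r₁, hr₁, hr₁φ⟩ := exists_modulus hφ hφc hε
  obtain ⟨r₂, hr₂, hr₂φ⟩ := exists_modulus (hφ.mul hχ) (hχc.mul_left (f := φ)) hε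
  filter_upwards [hh.eventually (gt_mem_nhds hr₁), hh.eventually (gt_mem_nhds hr₂)] with m hm₁ hm₂
  have hface : ∀ K s, (M m).faceCenter K i s ∈ Icc ((M m).lo K) ((M m).hi K) := fun K s =>
    (faceCenter_mem_boxFace K i s).1
  have hχe : ∀ K s, (M m).nbr K i s = none → χ ((M m).faceCenter K i s) = 0 := fun K s hn =>
    eq_zero_on_external hreg hn hχ hχtan (faceCenter_mem_boxFace K i s)
  -- Replaces the cell average of the density by the value of `φ` at the face centre, using the
  -- bound on the discrete velocity.
  have s1 : |(∑ K, ∑ s, (M m).vol K / 2 * (ρ m K * u m K i s) * χ ((M m).faceCenter K i s)) -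
      ∑ K, ∑ s, (M m).vol K / 2 * u m K i s *
        (φ ((M m).faceCenter K i s) * χ ((M m).faceCenter K i s))| ≤
      |B| * |Cχ| * ((1 + V) * ε) := by
    have h1 := sum_vol_mul_abs_average_sub_le (M := M m) hreg hbdd i hρi hφi (κ := ε)
      (p := fun K s => φ ((M m).faceCenter K i s)) (fun K s x hx => hr₁φ _ _
        ((norm_sub_le_of_mem_openBox (hw m) (hh0 m) (openBox_subset_Icc _ _ hx)
          (hface K s)).trans_lt hm₁))
    have h2 : (∑ K, ∑ s, (M m).vol K / 2 *
        |(∫ x in openBox ((M m).lo K) ((M m).hi K), ρ₀ x) / (M m).vol K -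
          φ ((M m).faceCenter K i s)|) ≤ (1 + V) * ε := by
      simp only [Real.norm_eq_abs] at hφρ
      linarith
    refine le_trans ?_ (mul_le_mul_of_nonneg_left h2 (by positivity))
    rw [← Finset.sum_sub_distrib, Finset.mul_sum]
    refine (Finset.abs_sum_le_sum_abs _ _).trans (Finset.sum_le_sum fun K _ => ?_)
    rw [← Finset.sum_sub_distrib, Finset.mul_sum]
    refine (Finset.abs_sum_le_sum_abs _ _).trans (Finset.sum_le_sum fun s _ => ?_)
    have hv := (M m).vol_pos K
    have e : (M m).vol K / 2 * (ρ m K * u m K i s) * χ ((M m).faceCenter K i s) -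
        (M m).vol K / 2 * u m K i s *
        (φ ((M m).faceCenter K i s) * χ ((M m).faceCenter K i s)) =
        u m K i s * χ ((M m).faceCenter K i s) *
          ((M m).vol K / 2 * (ρ m K - φ ((M m).faceCenter K i s))) := by ring
    rw [e, abs_mul, abs_mul, abs_mul, abs_of_pos (by linarith : 0 < (M m).vol K / 2), hρ m K]
    exact mul_le_mul_of_nonneg_right (mul_le_mul ((huB m K s).trans (le_abs_self B))
      ((hCχ _).trans (le_abs_self Cχ)) (abs_nonneg _) (abs_nonneg _)) (by positivity)
  -- The weight `φ χ` has one value per face, so the two halves of a dual cell recombine and the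
  -- mean over the dual cell becomes an integral. External faces drop out because `χ` vanishes
  -- there.
  have s2 : ∑ K, ∑ s, (M m).vol K / 2 * u m K i s *
        (φ ((M m).faceCenter K i s) * χ ((M m).faceCenter K i s)) =
      ∑ K, ∑ s, (φ ((M m).faceCenter K i s) * χ ((M m).faceCenter K i s)) *
        ∫ x in (M m).halfCell K i s, u₀ x := by
    rw [← sumFaces_eq hreg i (fun K s => (M m).vol K / 2 * u m K i s *
        (φ ((M m).faceCenter K i s) * χ ((M m).faceCenter K i s)))
        (fun K s hn => by simp only [hχe K s hn, mul_zero]),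
      ← sumFaces_eq hreg i (fun K s => (φ ((M m).faceCenter K i s) *
        χ ((M m).faceCenter K i s)) * ∫ x in (M m).halfCell K i s, u₀ x)
        (fun K s hn => by simp only [hχe K s hn, mul_zero, zero_mul])]
    apply sumFaces_congr
    intro K L hL
    rw [show u m L i false = u m K i true from huf m K i true L hL,
      show (M m).faceCenter L i false = (M m).faceCenter K i true from faceCenter_nbr hL, hu m K L hL]
    have hD := dualVol_pos K i true
    have hD' := dualVol_of_nbr hL
    have e1 : (M m).vol K / 2 = (M m).dualVol K i true - (M m).vol L / 2 := by linarith
    rw [e1]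
    field_simp
    ring
  have s3 := abs_sum_setIntegral_sub_le (M := M m) hreg i (χ := fun x => φ x * χ x)
    (p := fun K s => φ ((M m).faceCenter K i s) * χ ((M m).faceCenter K i s)) hui
    (hui.mul_bdd (c := |Cφ| * |Cχ|) (hφ.mul hχ).aestronglyMeasurable (Eventually.of_forall fun x => by
      rw [norm_mul]
      exact mul_le_mul ((hCφ x).trans (le_abs_self _)) ((hCχ x).trans (le_abs_self _))
        (norm_nonneg _) (abs_nonneg _))) (κ := ε) (fun K s x hx => hr₂φ _ _
        ((norm_sub_le_of_mem_openBox (hw m) (hh0 m)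
          (openBox_subset_Icc _ _ (halfCell_subset_openBox K i s hx)) (hface K s)).trans_lt hm₂))
  have hρu : IntegrableOn (fun x => ρ₀ x * u₀ x) Ω :=
    hρi.mul_bdd (c := Cu) hu₀.1 hCu
  have hφu : IntegrableOn (fun x => φ x * u₀ x) Ω :=
    hφi.mul_bdd (c := Cu) hu₀.1 hCu
  have i1 : IntegrableOn (fun x => ρ₀ x * u₀ x * χ x) Ω :=
    hρu.mul_bdd (c := Cχ) hχ.aestronglyMeasurable (Eventually.of_forall hCχ)
  have i2 : IntegrableOn (fun x => u₀ x * (φ x * χ x)) Ω := by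
    have : IntegrableOn (fun x => φ x * u₀ x * χ x) Ω :=
      hφu.mul_bdd (c := Cχ) hχ.aestronglyMeasurable (Eventually.of_forall hCχ)
    refine this.congr (Eventually.of_forall fun x => ?_)
    simp only; ring
  -- Returns from `φ` to `ρ₀` with the essential bound on `u₀`.
  have s4 : |(∫ x in Ω, u₀ x * (φ x * χ x)) - ∫ x in Ω, ρ₀ x * u₀ x * χ x| ≤
      |Cu| * |Cχ| * ε := by
    refine le_trans ?_ (mul_le_mul_of_nonneg_left hφρ (by positivity))
    rw [← integral_sub i2 i1, ← integral_const_mul]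
    refine abs_integral_le_integral_abs.trans ?_
    refine integral_mono_ae (i2.sub i1).abs ((hρi.sub hφi).norm.const_mul _) ?_
    filter_upwards [hCu] with x hx
    have e : u₀ x * (φ x * χ x) - ρ₀ x * u₀ x * χ x = -(u₀ x * χ x * (ρ₀ x - φ x)) := by ring
    rw [e, abs_neg, abs_mul, abs_mul]
    simp only [Real.norm_eq_abs]
    exact mul_le_mul_of_nonneg_right (mul_le_mul (hx.trans (le_abs_self Cu))
      ((hCχ x).trans (le_abs_self Cχ)) (abs_nonneg _) (abs_nonneg _)) (abs_nonneg _)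
  rw [s2] at s1
  have t1 := abs_sub_le (∑ K, ∑ s, (M m).vol K / 2 * (ρ m K * u m K i s) *
      χ ((M m).faceCenter K i s)) (∑ K, ∑ s, (φ ((M m).faceCenter K i s) *
        χ ((M m).faceCenter K i s)) * ∫ x in (M m).halfCell K i s, u₀ x)
      (∫ x in Ω, ρ₀ x * u₀ x * χ x)
  have t2 := abs_sub_le (∑ K, ∑ s, (φ ((M m).faceCenter K i s) *
        χ ((M m).faceCenter K i s)) * ∫ x in (M m).halfCell K i s, u₀ x)
      (∫ x in Ω, u₀ x * (φ x * χ x)) (∫ x in Ω, ρ₀ x * u₀ x * χ x)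
  linarith

end MACMesh

/-! ### Derivatives and initial traces of test functions -/

namespace IsTestFunction

variable {d : ℕ} {T : ℝ} {ψ : ℝ × (Fin d → ℝ) → ℝ}

lemma continuous_dt (hψ : IsTestFunction T ψ) : Continuous (dt ψ) :=
  (hψ.smooth.continuous_fderiv (by simp)).clm_apply continuous_const

lemma continuous_dx (hψ : IsTestFunction T ψ) (i : Fin d) : Continuous (dx i ψ) :=
  (hψ.smooth.continuous_fderiv (by simp)).clm_apply continuous_const

lemma hasCompactSupport_dt (hψ : IsTestFunction T ψ) : HasCompactSupport (dt ψ) :=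
  hψ.compact.fderiv_apply (𝕜 := ℝ) _

lemma hasCompactSupport_dx (hψ : IsTestFunction T ψ) (i : Fin d) : HasCompactSupport (dx i ψ) :=
  hψ.compact.fderiv_apply (𝕜 := ℝ) _

lemma continuous_initial (hψ : IsTestFunction T ψ) : Continuous fun x => ψ (0, x) :=
  hψ.smooth.continuous.comp (by fun_prop)

lemma hasCompactSupport_initial (hψ : IsTestFunction T ψ) :
    HasCompactSupport fun x => ψ (0, x) :=
  hψ.compact.comp_isClosedEmbedding (g := fun x : Fin d → ℝ => ((0 : ℝ), x))
    (Function.LeftInverse.isClosedEmbedding (f := Prod.snd) (fun _ => rfl) continuous_snd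
      (by fun_prop))

end IsTestFunction

namespace MACMesh

variable {d : ℕ} {Ω : Set (Fin d → ℝ)}

/-! ## Mesh sizes and uniform bounds -/

lemma diam_le_meshSize (M : MACMesh d Ω) (K : M.Cell) : M.diam K ≤ M.meshSize :=
  le_ciSup (Set.finite_range M.diam).bddAbove K

lemma meshSize_nonneg (M : MACMesh d Ω) : 0 ≤ M.meshSize :=
  Real.iSup_nonneg fun _ => Real.sqrt_nonneg _

lemma width_le_meshSize (M : MACMesh d Ω) (K : M.Cell) (i : Fin d) : M.width K i ≤ M.meshSize := by
  refine le_trans (Real.le_sqrt_of_sq_le ?_) (M.diam_le_meshSize K)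
  exact Finset.single_le_sum (f := fun i => M.width K i ^ 2) (fun j _ => sq_nonneg _)
    (Finset.mem_univ i)

/-- A face has at least one edge because `d ≥ 2`; this edge is at most `h` and the others are at
most one. -/
lemma area_le_of_width_le {M : MACMesh d Ω} (hd : 1 < d) {h : ℝ} (hh : h ≤ 1)
    (hw : ∀ K i, M.width K i ≤ h) (K : M.Cell) (i : Fin d) : M.area K i ≤ h := by
  have : Nontrivial (Fin d) := Fin.nontrivial_iff_two_le.2 hd
  obtain ⟨j, hj⟩ := exists_ne i
  have hj' : j ∈ Finset.univ.erase i := by simp [hj]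
  rw [area, ← Finset.mul_prod_erase _ _ hj']
  have h1 : ∏ k ∈ (Finset.univ.erase i).erase j, M.width K k ≤ 1 :=
    Finset.prod_le_one (fun k _ => (M.width_pos K k).le) fun k _ => (hw K k).trans hh
  exact (mul_le_of_le_one_right (M.width_pos K j).le h1).trans (hw K j)

lemma vol_le_of_nbr {M : MACMesh d Ω} (hreg : interior (closure Ω) = Ω) {θ : ℝ}
    (hθ : ∀ K i s, M.dualVol K i s / M.vol K ≤ θ) {K L : M.Cell} {i : Fin d} {s : Bool}
    (h : M.nbr K i s = some L) : M.vol K ≤ 2 * θ * M.vol L := by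
  have h1 := hθ L i (!s)
  rw [div_le_iff₀ (M.vol_pos L), dualVol_of_nbr (nbr_symm hreg h)] at h1
  have := M.vol_pos L
  linarith

/-- Turns the upper bound on the stabilisation parameters into a bound on their absolute values. -/
lemma IsSchemeSolution.eta_pos {M : MACMesh d Ω} {δt : ℝ} {N : ℕ} {ρ₀ : (Fin d → ℝ) → ℝ}
    {u₀ : (Fin d → ℝ) → Fin d → ℝ} {η : ℕ → M.FaceField} {ρ : ℕ → M.CellField}
    {u : ℕ → M.FaceField} (hsol : M.IsSchemeSolution δt N ρ₀ u₀ η ρ u) {n : ℕ} (hn : n < N)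
    {K L : M.Cell} {i : Fin d} {s : Bool} (h : M.nbr K i s = some L) : 0 < η n K i s := by
  refine lt_of_le_of_lt ?_ (hsol.eta_gt n hn K i s L h)
  have h1 := hsol.density_pos n hn.le K
  have h2 := hsol.density_pos n hn.le L
  have h3 := M.vol_pos K
  have h4 := M.vol_pos L
  have h5 := dualVol_pos K i s
  rw [dualAvg_of_nbr h]
  positivity

lemma IsSchemeSolution.stepBounds {M : MACMesh d Ω} {δt : ℝ} {N : ℕ} {ρ₀ : (Fin d → ℝ) → ℝ}
    {u₀ : (Fin d → ℝ) → Fin d → ℝ} {η : ℕ → M.FaceField} {ρ : ℕ → M.CellField}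
    {u : ℕ → M.FaceField} (hsol : M.IsSchemeSolution δt N ρ₀ u₀ η ρ u) (hd : 1 < d) {B : ℝ}
    (hB : 1 ≤ B) (hδ : 0 < δt) (hh : M.meshSize + δt ≤ 1)
    (hδB : ∀ K, δt ≤ B * M.vol K) (hρB : ∀ n ≤ N, ∀ K, ρ n K ≤ B ∧ 1 ≤ B * ρ n K)
    (huB : ∀ n ≤ N, ∀ K i s, |u n K i s| ≤ B)
    (hη : ∀ n < N, ∀ K i s L, M.nbr K i s = some L → η n K i s ≤ B) {n : ℕ} (hn : n < N) :
    StepBounds M δt B (M.meshSize + δt) (η n) (ρ n) (ρ (n + 1)) (u n) := by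
  have hw : ∀ K i, M.width K i ≤ M.meshSize + δt := fun K i =>
    (M.width_le_meshSize K i).trans (by linarith)
  exact
  { one_le := hB
    δt_pos := hδ
    δt_le_h := by linarith [M.meshSize_nonneg]
    h_le_one := hh
    width_le := hw
    area_le := area_le_of_width_le hd hh hw
    δt_le_vol := hδB
    density_pos := hsol.density_pos n hn.le
    density_le := fun K => (hρB n hn.le K).1
    density_inv := fun K => (hρB n hn.le K).2
    density_pos' := hsol.density_pos (n + 1) hn
    density_le' := fun K => (hρB (n + 1) hn K).1
    density_inv' := fun K => (hρB (n + 1) hn K).2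
    velocity_le := huB n hn.le
    velocity_mem := hsol.velocity_mem n hn.le
    eta_mem := hsol.eta_mem n hn
    eta_le := fun K i s L h => by
      rw [abs_of_pos (hsol.eta_pos hn h)]; exact hη n hn K i s L h }

/-! ## Convergence of the reconstructions -/

/-- Reading all velocity components from upper faces makes them cell fields, which can be multiplied
with the density cell by cell. The price is a part of the oscillation that is already contained in
`totalError`. -/
lemma integral_abs_cellFun_sub_faceFun_le {M : MACMesh d Ω} {δt h T B : ℝ} {N : ℕ}
    (hreg : interior (closure Ω) = Ω) (hΩ : MeasurableSet Ω) (hbdd : Bornology.IsBounded Ω)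
    (hδ : 0 < δt) (hT : N * δt = T) (hh : 0 ≤ h) (ρ : ℕ → M.CellField) {u : ℕ → M.FaceField}
    (huB : ∀ n < N, ∀ K i s, |u n K i s| ≤ B) (i : Fin d) :
    ∫ z in spaceTime T Ω, |M.cellFun δt (fun n K => u n K i true) z - M.faceFun δt u z i| ≤
      M.totalError δt h N ρ u := by
  have : IsFiniteMeasure (volume.restrict (spaceTime T Ω)) :=
    isFiniteMeasure_restrict.2 (measure_spaceTime_ne_top hbdd)
  have i1 : IntegrableOn (M.cellFun δt fun n K => u n K i true) (spaceTime T Ω) :=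
    Integrable.of_bound (measurable_cellFun _ _).aestronglyMeasurable B
      (ae_abs_le_of_timeCell M i hδ hT hΩ fun n hn K s z hz => by
        rw [cellFun_of_mem hδ _ hz]; exact huB n hn K i true)
  have i2 : IntegrableOn (fun z => M.faceFun δt u z i) (spaceTime T Ω) :=
    Integrable.of_bound (measurable_faceFun _ _ i).aestronglyMeasurable B
      (ae_abs_le_of_timeCell M i hδ hT hΩ fun n hn K s z hz => by
        rw [faceFun_of_mem hδ _ hz]; exact huB n hn K i s)
  refine (setIntegral_spaceTime_le_sum hreg (i := i) hδ hT (i1.sub i2).abs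
    (a := fun n K s => |u n K i true - u n K i s|) fun n hn K s z hz => ?_).trans ?_
  · simp only [Pi.sub_apply]
    rw [cellFun_of_mem hδ _ hz, faceFun_of_mem hδ _ hz]
  refine Finset.sum_le_sum fun n _ => ?_
  have h1 : 0 ≤ h * M.bvSum (ρ (n + 1)) := mul_nonneg hh (bvSum_nonneg _)
  have h2 : ∑ K, ∑ s, δt * (M.vol K / 2) * |u n K i true - u n K i s| ≤
      δt * ∑ K, M.vol K * (M.osc (ρ n) (u n) K + h) := by
    rw [Finset.mul_sum]
    refine Finset.sum_le_sum fun K _ => ?_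
    have hv := M.vol_pos K
    have h3 := fun s => abs_true_sub_le_osc (ρ n) (u n) K i s
    calc ∑ s, δt * (M.vol K / 2) * |u n K i true - u n K i s|
        ≤ ∑ _s : Bool, δt * (M.vol K / 2) * (M.osc (ρ n) (u n) K + h) :=
          Finset.sum_le_sum fun s _ =>
            mul_le_mul_of_nonneg_left ((h3 s).trans (by linarith)) (by positivity)
      _ = δt * (M.vol K * (M.osc (ρ n) (u n) K + h)) := by
          rw [Fintype.sum_bool]; ring
  rw [mul_add]
  have := mul_nonneg hδ.le h1
  linarith

section limit

variable {M : ℕ → MACMesh d Ω} {δt h : ℕ → ℝ} {N : ℕ → ℕ} {T B : ℝ}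
  {ρ : ∀ m, ℕ → (M m).CellField} {u : ∀ m, ℕ → (M m).FaceField}

lemma boundedL1Limit_cellFun (hΩ : MeasurableSet Ω) (hd : 0 < d) (hδ : ∀ m, 0 < δt m) (hT : ∀ m, N m * δt m = T)
    (hρB : ∀ m, ∀ n < N m, ∀ K, |ρ m n K| ≤ B) {f : ℝ × (Fin d → ℝ) → ℝ}
    (hf : MemLp f ⊤ (volume.restrict (spaceTime T Ω)))
    (hlim : Tendsto (fun m => ∫ z in spaceTime T Ω, |(M m).cellFun (δt m) (ρ m) z - f z|)
      atTop (𝓝 0)) :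
    BoundedL1Limit (volume.restrict (spaceTime T Ω)) (fun m => (M m).cellFun (δt m) (ρ m)) f where
  meas m := (measurable_cellFun _ _).aestronglyMeasurable
  meas_lim := hf.1
  bound := by
    obtain ⟨C, hC⟩ := exists_ae_abs_le hf
    refine ⟨max B C, fun m => ?_, ?_⟩
    · refine ae_abs_le_of_timeCell (M m) ⟨0, hd⟩ (hδ m) (hT m) hΩ fun n hn K s z hz => ?_
      rw [cellFun_of_mem (hδ m) _ hz]
      exact (hρB m n hn K).trans (le_max_left _ _)
    · filter_upwards [hC] with z hz using hz.trans (le_max_right _ _)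
  lim := hlim

/-- Almost everywhere the positive part of `c - g` is at most `|f m - g|`, so its integral is
bounded by a null sequence. -/
lemma ae_le_of_boundedL1Limit {α : Type*} [MeasurableSpace α] {μ : Measure α} [IsFiniteMeasure μ]
    {f : ℕ → α → ℝ} {g : α → ℝ} (hlim : BoundedL1Limit μ f g) {c : ℝ}
    (hc : ∀ m, ∀ᵐ z ∂μ, c ≤ f m z) : ∀ᵐ z ∂μ, c ≤ g z := by
  have i0 : Integrable (fun z => max (c - g z) 0) μ :=
    ((integrable_const c).sub hlim.integrable_lim).pos_part
  have h1 : ∫ z, max (c - g z) 0 ∂μ ≤ 0 := by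
    refine ge_of_tendsto' hlim.lim fun m => ?_
    refine integral_mono_ae i0 ((hlim.integrable m).sub hlim.integrable_lim).abs ?_
    filter_upwards [hc m] with z hz
    exact max_le ((by linarith : c - g z ≤ f m z - g z).trans (le_abs_self _)) (abs_nonneg _)
  have h2 : ∫ z, max (c - g z) 0 ∂μ = 0 :=
    le_antisymm h1 (integral_nonneg fun z => le_max_right _ _)
  filter_upwards [(integral_eq_zero_iff_of_nonneg (f := fun z => max (c - g z) 0)
    (fun z => le_max_right _ _) i0).1 h2] with z hz
  have := le_max_left (c - g z) 0
  simp only [Pi.zero_apply] at hz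
  linarith

end limit

/-! ## The weak formulation -/

lemma sum_time_add {ι : Type*} [Fintype ι] (N : ℕ) (δt : ℝ) (v : ι → ℝ) (a b : ℕ → ι → ℝ) :
    ∑ n ∈ Finset.range N, δt * ∑ K, v K * (a n K + b n K) =
      (∑ n ∈ Finset.range N, δt * ∑ K, v K * a n K) +
        ∑ n ∈ Finset.range N, δt * ∑ K, v K * b n K := by
  simp only [mul_add, Finset.sum_add_distrib]

lemma sum_time_sum {ι κ : Type*} [Fintype ι] [Fintype κ] (N : ℕ) (δt : ℝ) (v : ι → ℝ)
    (a : κ → ℕ → ι → ℝ) :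
    ∑ n ∈ Finset.range N, δt * ∑ K, v K * ∑ i, a i n K =
      ∑ i, ∑ n ∈ Finset.range N, δt * ∑ K, v K * a i n K := by
  rw [Finset.sum_comm]
  refine Finset.sum_congr rfl fun n _ => ?_
  rw [← Finset.mul_sum, Finset.sum_comm]
  simp only [Finset.mul_sum]

section weak

variable {M : ℕ → MACMesh d Ω} {δt h : ℕ → ℝ} {N : ℕ → ℕ} {T B : ℝ}
  {ρ : ∀ m, ℕ → (M m).CellField} {u : ∀ m, ℕ → (M m).FaceField}
  {ρ₀ : (Fin d → ℝ) → ℝ} {u₀ : (Fin d → ℝ) → Fin d → ℝ}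
  {f : ℝ × (Fin d → ℝ) → ℝ} {U : ℝ × (Fin d → ℝ) → Fin d → ℝ}

/-- The Riemann sums converge to the integrals of the weak formulation, and by hypothesis they also
converge to zero; uniqueness of limits gives the identity. -/
lemma weak_mass_of_tendsto (hreg : interior (closure Ω) = Ω) (hbdd : Bornology.IsBounded Ω)
    (hd : 0 < d) (hδ : ∀ m, 0 < δt m) (hT : ∀ m, N m * δt m = T) (hδh : ∀ m, δt m ≤ h m)
    (hw : ∀ m K i, (M m).width K i ≤ h m) (hh : Tendsto h atTop (𝓝 0))
    (hB : ∀ m, ∀ n < N m, ∀ K, |ρ m n K| ≤ B) (huB : ∀ m, ∀ n < N m, ∀ K i s, |u m n K i s| ≤ B)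
    (hρ : BoundedL1Limit (volume.restrict (spaceTime T Ω))
      (fun m => (M m).cellFun (δt m) (ρ m)) f)
    (hu : ∀ i, BoundedL1Limit (volume.restrict (spaceTime T Ω))
      (fun m => (M m).cellFun (δt m) fun n K => u m n K i true) fun z => U z i)
    (hρ₀ : IntegrableOn ρ₀ Ω)
    (hinit : ∀ m K, ρ m 0 K =
      (∫ x in openBox ((M m).lo K) ((M m).hi K), ρ₀ x) / (M m).vol K)
    {ψ : ℝ × (Fin d → ℝ) → ℝ} (hψ : IsTestFunction T ψ)
    (hlim : Tendsto (fun m => (∑ n ∈ Finset.range (N m), δt m * ∑ K, (M m).vol K *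
        (ρ m n K * dt ψ (n * δt m, (M m).center K) +
          ∑ i, ρ m n K * u m n K i true * dx i ψ (n * δt m, (M m).center K))) +
      ∑ K, (M m).vol K * (ρ m 0 K * ψ (0, (M m).center K))) atTop (𝓝 0)) :
    ∫ z in spaceTime T Ω, (f z * dt ψ z + ∑ i, f z * U z i * dx i ψ z) =
      -∫ x in Ω, ρ₀ x * ψ (0, x) := by
  have : IsFiniteMeasure (volume.restrict (spaceTime T Ω)) :=
    isFiniteMeasure_restrict.2 (measure_spaceTime_ne_top hbdd)
  have hint : ∀ {F : ℕ → ℝ × (Fin d → ℝ) → ℝ} {q g : ℝ × (Fin d → ℝ) → ℝ},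
      BoundedL1Limit (volume.restrict (spaceTime T Ω)) F q → Continuous g → HasCompactSupport g →
      IntegrableOn (fun z => q z * g z) (spaceTime T Ω) := by
    intro F q g hq hg hgc
    obtain ⟨Cg, hCg⟩ := hg.bounded_above_of_compact_support hgc
    exact (hq.mul (BoundedL1Limit.const hg.aestronglyMeasurable hCg)).integrable_lim
  have t0 := tendsto_discrete_sum hreg hbdd hd hδ hT hδh hw hh hB
    (fun m n hn i K s z hz => cellFun_of_mem (hδ m) (ρ m) hz) hρ hψ.continuous_dt
    hψ.hasCompactSupport_dt
  have t1 := fun i => tendsto_discrete_sum hreg hbdd hd hδ hT hδh hw hh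
    (a := fun m n K => ρ m n K * u m n K i true) (B := |B| * |B|)
    (fun m n hn K => by
      rw [abs_mul]
      exact mul_le_mul ((hB m n hn K).trans (le_abs_self B))
        ((huB m n hn K i true).trans (le_abs_self B)) (abs_nonneg _) (abs_nonneg _))
    (fun m n hn j K s z hz => by
      rw [cellFun_of_mem (hδ m) _ hz, cellFun_of_mem (hδ m) _ hz]) (hρ.mul (hu i))
    (hψ.continuous_dx i) (hψ.hasCompactSupport_dx i)
  have t2 := tendsto_initial_mass hreg hd (fun m => (hδ m).le.trans (hδh m)) hw hh hρ₀
    hψ.continuous_initial hψ.hasCompactSupport_initial hinit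
  have t3 := ((t0.add (tendsto_finsetSum Finset.univ fun i _ => t1 i)).add t2)
  simp only [sum_time_add, sum_time_sum] at hlim
  have key := tendsto_nhds_unique t3 hlim
  rw [integral_add (hint hρ hψ.continuous_dt hψ.hasCompactSupport_dt)
    (integrable_finsetSum _ fun i _ => hint (hρ.mul (hu i)) (hψ.continuous_dx i)
      (hψ.hasCompactSupport_dx i)),
    integral_finsetSum _ fun i _ => hint (hρ.mul (hu i)) (hψ.continuous_dx i)
      (hψ.hasCompactSupport_dx i)]
  linarith

/-- One component of the momentum balance, with a scalar test function. Integrability is part of the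
conclusion because the components are summed under the integral afterwards. -/
lemma weak_momentum_of_tendsto (hreg : interior (closure Ω) = Ω) (hbdd : Bornology.IsBounded Ω)
    (hδ : ∀ m, 0 < δt m) (hT : ∀ m, N m * δt m = T) (hT0 : 0 < T) (hδh : ∀ m, δt m ≤ h m)
    (hw : ∀ m K i, (M m).width K i ≤ h m) (hh : Tendsto h atTop (𝓝 0))
    (hB : ∀ m, ∀ n < N m, ∀ K, |ρ m n K| ≤ B) (huB : ∀ m, ∀ n < N m, ∀ K i s, |u m n K i s| ≤ B)
    (hρ : BoundedL1Limit (volume.restrict (spaceTime T Ω))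
      (fun m => (M m).cellFun (δt m) (ρ m)) f)
    (hu : ∀ i, BoundedL1Limit (volume.restrict (spaceTime T Ω))
      (fun m => (M m).cellFun (δt m) fun n K => u m n K i true) fun z => U z i)
    (hρ₀ : MemLp ρ₀ ⊤ (volume.restrict Ω)) (i : Fin d)
    (hu₀ : MemLp (fun x => u₀ x i) ⊤ (volume.restrict Ω))
    (hinit : ∀ m K, ρ m 0 K =
      (∫ x in openBox ((M m).lo K) ((M m).hi K), ρ₀ x) / (M m).vol K)
    (huf : ∀ m, (M m).IsFaceField (u m 0))
    (hinit' : ∀ m K L, (M m).nbr K i true = some L →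
      u m 0 K i true = ((∫ x in (M m).halfCell K i true, u₀ x i) +
        ∫ x in (M m).halfCell L i false, u₀ x i) / (M m).dualVol K i true)
    {ψ : ℝ × (Fin d → ℝ) → ℝ} (hψ : IsTestFunction T ψ)
    (htan : ∀ x, HasAxisNormal Ω i x → ∀ t ∈ Ico 0 T, ψ (t, x) = 0)
    (hlim : Tendsto (fun m => (∑ n ∈ Finset.range (N m), δt m * ∑ K, (M m).vol K *
        (ρ m n K * u m n K i true * dt ψ (n * δt m, (M m).center K) +
          (∑ j, ρ m n K * u m n K i true * u m n K j true *
            dx j ψ (n * δt m, (M m).center K)) +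
          ρ m n K * dx i ψ (n * δt m, (M m).center K))) +
      ∑ K, ∑ s, (M m).vol K / 2 * (ρ m 0 K * u m 0 K i s) * ψ (0, (M m).faceCenter K i s))
      atTop (𝓝 0)) :
    IntegrableOn (fun z => f z * U z i * dt ψ z + (∑ j, f z * U z i * U z j * dx j ψ z) +
        f z * dx i ψ z) (spaceTime T Ω) ∧
      ∫ z in spaceTime T Ω, (f z * U z i * dt ψ z + (∑ j, f z * U z i * U z j * dx j ψ z) +
        f z * dx i ψ z) = -∫ x in Ω, ρ₀ x * u₀ x i * ψ (0, x) := by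
  have hd : 0 < d := i.pos
  have : IsFiniteMeasure (volume.restrict (spaceTime T Ω)) :=
    isFiniteMeasure_restrict.2 (measure_spaceTime_ne_top hbdd)
  have hint : ∀ {F : ℕ → ℝ × (Fin d → ℝ) → ℝ} {q g : ℝ × (Fin d → ℝ) → ℝ},
      BoundedL1Limit (volume.restrict (spaceTime T Ω)) F q → Continuous g → HasCompactSupport g →
      IntegrableOn (fun z => q z * g z) (spaceTime T Ω) := by
    intro F q g hq hg hgc
    obtain ⟨Cg, hCg⟩ := hg.bounded_above_of_compact_support hgc
    exact (hq.mul (BoundedL1Limit.const hg.aestronglyMeasurable hCg)).integrable_lim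
  have hN : ∀ m, 0 < N m := fun m => by
    rcases Nat.eq_zero_or_pos (N m) with h0 | h0
    · have := hT m; rw [h0] at this; simp at this; exact absurd this hT0.ne
    · exact h0
  have hab : ∀ m, ∀ n < N m, ∀ K, |ρ m n K * u m n K i true| ≤ |B| * |B| := fun m n hn K => by
    rw [abs_mul]
    exact mul_le_mul ((hB m n hn K).trans (le_abs_self B))
      ((huB m n hn K i true).trans (le_abs_self B)) (abs_nonneg _) (abs_nonneg _)
  have t0 := tendsto_discrete_sum hreg hbdd hd hδ hT hδh hw hh hab
    (fun m n hn j K s z hz => by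
      rw [cellFun_of_mem (hδ m) _ hz, cellFun_of_mem (hδ m) _ hz]) (hρ.mul (hu i))
    hψ.continuous_dt hψ.hasCompactSupport_dt
  have t1 := fun j => tendsto_discrete_sum hreg hbdd hd hδ hT hδh hw hh
    (a := fun m n K => ρ m n K * u m n K i true * u m n K j true) (B := |B| * |B| * |B|)
    (fun m n hn K => by
      rw [abs_mul]
      exact mul_le_mul (hab m n hn K) ((huB m n hn K j true).trans (le_abs_self B)) (abs_nonneg _)
        (by positivity))
    (fun m n hn k K s z hz => by
      rw [cellFun_of_mem (hδ m) _ hz, cellFun_of_mem (hδ m) _ hz, cellFun_of_mem (hδ m) _ hz])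
    ((hρ.mul (hu i)).mul (hu j)) (hψ.continuous_dx j) (hψ.hasCompactSupport_dx j)
  have t2 := tendsto_discrete_sum hreg hbdd hd hδ hT hδh hw hh hB
    (fun m n hn j K s z hz => cellFun_of_mem (hδ m) (ρ m) hz) hρ (hψ.continuous_dx i)
    (hψ.hasCompactSupport_dx i)
  have t3 := tendsto_initial_momentum hreg hbdd (fun m => (hδ m).le.trans (hδh m)) hw hh i hρ₀ hu₀
    hψ.continuous_initial hψ.hasCompactSupport_initial
    (fun x hx => htan x hx 0 ⟨le_rfl, hT0⟩) hinit (fun m K s => huB m 0 (hN m) K i s) huf hinit'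
  have t4 := ((t0.add (tendsto_finsetSum Finset.univ fun j _ => t1 j)).add t2).add t3
  simp only [sum_time_add, sum_time_sum] at hlim
  have key := tendsto_nhds_unique t4 hlim
  have i0 := hint (hρ.mul (hu i)) hψ.continuous_dt hψ.hasCompactSupport_dt
  have i1 := fun j => hint ((hρ.mul (hu i)).mul (hu j)) (hψ.continuous_dx j)
    (hψ.hasCompactSupport_dx j)
  have i1' := integrable_finsetSum Finset.univ fun j _ => i1 j
  have i2 := hint hρ (hψ.continuous_dx i) (hψ.hasCompactSupport_dx i)
  refine ⟨(i0.add i1').add i2, ?_⟩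
  have e0 := integral_add i0 i1'
  have e1 : ∫ z in spaceTime T Ω, (f z * U z i * dt ψ z +
      (∑ j, f z * U z i * U z j * dx j ψ z) + f z * dx i ψ z) = _ := integral_add (i0.add i1') i2
  rw [e1]
  rw [e0, integral_finsetSum _ fun j _ => i1 j]
  linarith

end weak

end MACMesh

end

/-! ### The convergence theorem: uniform constants and passage to the limit -/

theorem mainTheorem5 {d : ℕ} (hd : d = 2 ∨ d = 3)
    {Ω : Set (Fin d → ℝ)} (hΩ_open : IsOpen Ω) (hΩ_conn : IsConnected Ω)
    (hΩ_bdd : Bornology.IsBounded Ω) (hΩ_reg : interior (closure Ω) = Ω)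
    {T : ℝ} (hT : 0 < T)
    -- the initial data
    (ρ₀ : (Fin d → ℝ) → ℝ) (U₀ : (Fin d → ℝ) → Fin d → ℝ)
    (hρ₀ : MemLp ρ₀ ⊤ (volume.restrict Ω))
    (hU₀ : ∀ i, MemLp (fun x => U₀ x i) ⊤ (volume.restrict Ω))
    -- the discretisations and the discrete solutions
    (M : ℕ → MACMesh d Ω) (δt : ℕ → ℝ) (N : ℕ → ℕ)
    (hδt : ∀ m, 0 < δt m) (hN : ∀ m, N m * δt m = T)
    (hδt_lim : Tendsto δt atTop (𝓝 0))
    (hM_lim : Tendsto (fun m => (M m).meshSize) atTop (𝓝 0))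
    (η : ∀ m, ℕ → (M m).FaceField) (ρ : ∀ m, ℕ → (M m).CellField) (U : ∀ m, ℕ → (M m).FaceField)
    (hsol : ∀ m, (M m).IsSchemeSolution (δt m) (N m) ρ₀ U₀ (η m) (ρ m) (U m))
    (ηmax : ℝ)
    (hη : ∀ m, ∀ n < N m, ∀ K i s L, (M m).nbr K i s = some L → η m n K i s ≤ ηmax)
    -- uniform bounds
    (Clow Cup C : ℝ) (hClow : 0 < Clow)
    (hρ_bdd : ∀ m, ∀ n ≤ N m, ∀ K, Clow < ρ m n K ∧ ρ m n K ≤ Cup)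
    (hU_bdd : ∀ m, ∀ n ≤ N m, ∀ K i s, |U m n K i s| ≤ C)
    (hρ_BV : ∀ m, (M m).discreteBV (δt m) (N m) (ρ m) ≤ C)
    -- strong convergence
    (ρlim : ℝ × (Fin d → ℝ) → ℝ) (Ulim : ℝ × (Fin d → ℝ) → Fin d → ℝ)
    (hρlim : MemLp ρlim ⊤ (volume.restrict (spaceTime T Ω)))
    (hUlim : ∀ i, MemLp (fun z => Ulim z i) ⊤ (volume.restrict (spaceTime T Ω)))
    (hρ_conv : ∀ r : ℝ≥0∞, 1 ≤ r → r < ⊤ →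
      Tendsto (fun m => eLpNorm (fun z => (M m).cellFun (δt m) (ρ m) z - ρlim z) r
        (volume.restrict (spaceTime T Ω))) atTop (𝓝 0))
    (hU_conv : ∀ r : ℝ≥0∞, 1 ≤ r → r < ⊤ → ∀ i,
      Tendsto (fun m => eLpNorm (fun z => (M m).faceFun (δt m) (U m) z i - Ulim z i) r
        (volume.restrict (spaceTime T Ω))) atTop (𝓝 0))
    -- mesh regularity
    (θ : ℝ)
    (hθ_time : ∀ m K, δt m / (M m).vol K ≤ θ)
    (hθ_shape : ∀ m K, (M m).diam K ^ d / (M m).vol K ≤ θ)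
    (hθ_dual : ∀ m K i s, (M m).dualVol K i s / (M m).vol K ≤ θ) :
    IsWeakSolution T Ω ρ₀ U₀ ρlim Ulim := by
  have hd1 : 1 < d := by rcases hd with h | h <;> omega
  have hd0 : 0 < d := hd1.le
  have hΩ : MeasurableSet Ω := hΩ_open.measurableSet
  have : IsFiniteMeasure (volume.restrict (spaceTime T Ω)) :=
    isFiniteMeasure_restrict.2 (MACMesh.measure_spaceTime_ne_top hΩ_bdd)
  have : IsFiniteMeasure (volume.restrict Ω) :=
    isFiniteMeasure_restrict.2 (MACMesh.volume_lt_top hΩ_bdd).ne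
  set h : ℕ → ℝ := fun m => (M m).meshSize + δt m with hh_def
  have hh : Tendsto h atTop (𝓝 0) := by simpa using hM_lim.add hδt_lim
  have hδh : ∀ m, δt m ≤ h m := fun m => by
    have := (M m).meshSize_nonneg
    simp only [hh_def]; linarith
  have hh0 : ∀ m, 0 ≤ h m := fun m => (hδt m).le.trans (hδh m)
  have hw : ∀ m K i, (M m).width K i ≤ h m := fun m K i => by
    have := (M m).width_le_meshSize K i
    have := hδt m
    simp only [hh_def]; linarith
  -- A single constant dominating all bounds: `1 / Clow` for the lower density bound, and `2 * |θ|`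
  -- because neighbouring volumes compare with the factor `2 * θ`.
  set B₀ : ℝ := 1 + |Cup| + 1 / Clow + |C| + |ηmax| + 2 * |θ| with hB₀_def
  have hClow' : 0 < 1 / Clow := by positivity
  have hB₀ : 1 ≤ B₀ ∧ Cup ≤ B₀ ∧ 1 / Clow ≤ B₀ ∧ C ≤ B₀ ∧ ηmax ≤ B₀ ∧ θ ≤ B₀ ∧ 2 * θ ≤ B₀ := by
    have h1 := le_abs_self Cup
    have h2 := le_abs_self C
    have h3 := le_abs_self ηmax
    have h4 := le_abs_self θ
    have := abs_nonneg Cup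
    have := abs_nonneg C
    have := abs_nonneg ηmax
    have := abs_nonneg θ
    refine ⟨?_, ?_, ?_, ?_, ?_, ?_, ?_⟩ <;> rw [hB₀_def] <;> linarith
  obtain ⟨hB1, hBup, hBlow, hBC, hBη, hBθ, hBθ'⟩ := hB₀
  have hρpos : ∀ m, ∀ n ≤ N m, ∀ K, 0 < ρ m n K := fun m => (hsol m).density_pos
  have hρB : ∀ m, ∀ n < N m, ∀ K, |ρ m n K| ≤ B₀ := fun m n hn K => by
    rw [abs_of_pos (hρpos m n hn.le K)]
    exact (hρ_bdd m n hn.le K).2.trans hBup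
  have hUB : ∀ m, ∀ n < N m, ∀ K i s, |U m n K i s| ≤ B₀ := fun m n hn K i s =>
    (hU_bdd m n hn.le K i s).trans hBC
  -- Stated for every larger `B` so that the Taylor constant of a test function can be absorbed. It
  -- holds only eventually since `h ≤ 1` is required.
  have hS : ∀ B, B₀ ≤ B → ∀ᶠ m in atTop, ∀ n < N m,
      MACMesh.StepBounds (M m) (δt m) B (h m) (η m n) (ρ m n) (ρ m (n + 1)) (U m n) := by
    intro B hB
    filter_upwards [hh.eventually (gt_mem_nhds one_pos)] with m hm n hn
    refine (hsol m).stepBounds hd1 (hB1.trans hB) (hδt m) hm.le (fun K => ?_) (fun n hn K => ?_)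
      (fun n hn K i s => (hU_bdd m n hn K i s).trans (hBC.trans hB))
      (fun n hn K i s L hL => (hη m n hn K i s L hL).trans (hBη.trans hB)) hn
    · have h1 := hθ_time m K
      have hv := (M m).vol_pos K
      rw [div_le_iff₀ hv] at h1
      exact h1.trans (mul_le_mul_of_nonneg_right (hBθ.trans hB) hv.le)
    · obtain ⟨h1, h2⟩ := hρ_bdd m n hn K
      refine ⟨h2.trans (hBup.trans hB), ?_⟩
      calc (1 : ℝ) = 1 / Clow * Clow := by field_simp
        _ ≤ B * ρ m n K := mul_le_mul (hBlow.trans hB) h1.le hClow.le (by linarith)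
  have hvol : ∀ m K j s L, (M m).nbr K j s = some L → (M m).vol K ≤ B₀ * (M m).vol L :=
    fun m K j s L hL => (MACMesh.vol_le_of_nbr hΩ_reg (hθ_dual m) hL).trans
      (mul_le_mul_of_nonneg_right hBθ' ((M m).vol_pos L).le)
  have hfint : ∀ m i, IntegrableOn (fun z => (M m).faceFun (δt m) (U m) z i) (spaceTime T Ω) :=
    fun m i => Integrable.of_bound (MACMesh.measurable_faceFun _ _ i).aestronglyMeasurable B₀
      (MACMesh.ae_abs_le_of_timeCell (M m) i (hδt m) (hN m) hΩ fun n hn K s z hz => by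
        rw [MACMesh.faceFun_of_mem (hδt m) _ hz]; exact hUB m n hn K i s)
  have hUint : ∀ i, IntegrableOn (fun z => Ulim z i) (spaceTime T Ω) := fun i =>
    (hUlim i).integrable le_top
  have hρL1 : Tendsto (fun m => ∫ z in spaceTime T Ω,
      |(M m).cellFun (δt m) (ρ m) z - ρlim z|) atTop (𝓝 0) :=
    tendsto_integral_abs_of_eLpNorm
      (fun m => (MACMesh.measurable_cellFun _ _).aestronglyMeasurable.sub hρlim.1)
      (hρ_conv 1 le_rfl ENNReal.one_lt_top)
  have hUL1 : ∀ i, Tendsto (fun m => ∫ z in spaceTime T Ω,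
      |(M m).faceFun (δt m) (U m) z i - Ulim z i|) atTop (𝓝 0) := fun i =>
    tendsto_integral_abs_of_eLpNorm
      (fun m => (MACMesh.measurable_faceFun _ _ i).aestronglyMeasurable.sub (hUlim i).1)
      (hU_conv 1 le_rfl ENNReal.one_lt_top i)
  have hE := tendsto_totalError hΩ_reg hΩ_bdd hd0 hT hδt hN hh (zero_le_one.trans hB1)
    (hS B₀ le_rfl) hvol hρ_BV hUint (Eventually.of_forall hfint) hUL1
  have hR := MACMesh.boundedL1Limit_cellFun hΩ hd0 hδt hN hρB hρlim hρL1
  -- The upper-face velocities differ from the reconstruction on dual cells by at most the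
  -- consistency error in `L¹`, so they have the same limit.
  have hW : ∀ i, BoundedL1Limit (volume.restrict (spaceTime T Ω))
      (fun m => (M m).cellFun (δt m) fun n K => U m n K i true) fun z => Ulim z i := by
    intro i
    have hUB' : ∀ m, ∀ n < N m, ∀ K, |U m n K i true| ≤ B₀ := fun m n hn K =>
      hUB m n hn K i true
    refine MACMesh.boundedL1Limit_cellFun hΩ hd0 hδt hN hUB' (hUlim i) ?_
    refine squeeze_zero (fun m => integral_nonneg fun z => abs_nonneg _) (fun m => ?_)
      (by simpa using hE.add (hUL1 i))
    have h1 := MACMesh.integral_abs_cellFun_sub_faceFun_le hΩ_reg hΩ hΩ_bdd (hδt m) (hN m) (hh0 m)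
      (ρ m) (hUB m) i
    have i0 : IntegrableOn ((M m).cellFun (δt m) fun n K => U m n K i true) (spaceTime T Ω) :=
      Integrable.of_bound (MACMesh.measurable_cellFun _ _).aestronglyMeasurable B₀
        (MACMesh.ae_abs_le_of_timeCell (M m) i (hδt m) (hN m) hΩ fun n hn K s z hz => by
          rw [MACMesh.cellFun_of_mem (hδt m) _ hz]; exact hUB' m n hn K)
    have i1 := (i0.sub (hfint m i)).abs
    have i2 := ((hfint m i).sub (hUint i)).abs
    refine le_trans ?_ (add_le_add_left h1 _)
    refine (integral_mono (i0.sub (hUint i)).abs (i1.add i2) fun z => ?_).trans_eq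
      (integral_add i1 i2)
    exact abs_sub_le _ _ _
  refine ⟨hρlim, ?_, hUlim, fun ψ hψ => ?_, fun ψ hψ htan => ?_⟩
  -- A uniform positive lower bound survives in the limit, while mere positivity would not.
  · have := MACMesh.ae_le_of_boundedL1Limit hR (c := Clow) fun m =>
      MACMesh.ae_of_forall_timeCell (M m) ⟨0, hd0⟩ (hδt m) (hN m) hΩ fun n hn K s z hz => by
        rw [MACMesh.cellFun_of_mem (hδt m) _ hz]; exact (hρ_bdd m n hn.le K).1.le
    filter_upwards [this] with z hz using hClow.trans_le hz
  · obtain ⟨Bψ, hBψ⟩ := exists_taylorBound hψ.smooth hψ.compact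
    refine MACMesh.weak_mass_of_tendsto hΩ_reg hΩ_bdd hd0 hδt hN hδh hw hh hρB hUB hR hW
      (hρ₀.integrable le_top) (fun m => (hsol m).density_init) hψ ?_
    -- `totalError` does not depend on `B`, so enlarging the constant for a given test function
    -- changes only the prefactor.
    have hE' := hE.const_mul (11 * (d + 1) * (max B₀ Bψ) ^ 5)
    rw [mul_zero] at hE'
    refine squeeze_zero_norm' ?_ hE'
    filter_upwards [hS _ (le_max_left B₀ Bψ)] with m hm
    exact MACMesh.abs_weak_mass_le hΩ_reg (hN m) (hsol m) hm hψ (hBψ.mono (le_max_right _ _))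
  · have key := fun i => MACMesh.weak_momentum_of_tendsto hΩ_reg hΩ_bdd hδt hN hT hδh hw
      hh hρB hUB hR hW hρ₀ i (hU₀ i) (fun m => (hsol m).density_init)
      (fun m => ((hsol m).velocity_mem 0 (Nat.zero_le _)).1)
      (fun m K L => (hsol m).velocity_init K i L) (hψ i) (htan i) (by
        obtain ⟨Bψ, hBψ⟩ := exists_taylorBound (hψ i).smooth (hψ i).compact
        have hE' := hE.const_mul (61 * d * (max B₀ Bψ) ^ 9)
        rw [mul_zero] at hE'
        refine squeeze_zero_norm' ?_ hE'
        filter_upwards [hS _ (le_max_left B₀ Bψ)] with m hm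
        exact MACMesh.abs_weak_momentum_le hΩ_reg (hN m) (hsol m) hm i
          (hψ i) (hBψ.mono (le_max_right _ _)) (htan i))
    have i0 : ∀ i, IntegrableOn (fun x => ρ₀ x * U₀ x i * ψ i (0, x)) Ω := fun i => by
      obtain ⟨c, hc⟩ := exists_ae_abs_le (hU₀ i)
      obtain ⟨c', hc'⟩ := (hψ i).continuous_initial.bounded_above_of_compact_support
        (hψ i).hasCompactSupport_initial
      exact ((hρ₀.integrable le_top).mul_bdd (c := c) (hU₀ i).1 hc).mul_bdd (c := c')
        (hψ i).continuous_initial.aestronglyMeasurable (Eventually.of_forall hc')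
    rw [integral_finsetSum _ fun i _ => i0 i, ← Finset.sum_neg_distrib,
      ← Finset.sum_congr rfl fun i _ => (key i).2, ← integral_finsetSum _ fun i _ => (key i).1]
    refine integral_congr_ae (Eventually.of_forall fun z => ?_)
    simp only [Finset.sum_add_distrib, Finset.mul_sum]
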